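/- Let $p,q,X\in\mathbb R$ with $p>\tfrac12$, put $c=-p+iq$, and consider on $\mathbb R$ the generalised Cauchy weight $e^{-2V(z)}=(1-iz)^{c}(1+iz)^{\bar c}=(1+z^2)^{-p}e^{2q\arctan z}$. Put $V_1=V+\tfrac12\log(1+z^2)$ and $V_2=V-\tfrac12\log(1+z^2)$, so that $e^{-V_1}=(1-iz)^{(c-1)/2}(1+iz)^{(\bar c-1)/2}$ and $e^{-V_2}=(1-iz)^{(c+1)/2}(1+iz)^{(\bar c+1)/2}$. For polynomials $\phi,\psi\in\mathbb C[z]$ let $$\langle\phi,\psi\rangle_{1,V}=\tfrac12\iint\phi(y)\psi(z)\,\mathrm{sgn}(z-y)\,e^{-V(y)-V(z)}\,dy\,dz,\qquad \langle\phi,\psi\rangle_{2,V}=\int\phi\psi\, e^{-2V}dz,$$ $$\langle\phi,\psi\rangle_{4,V}=\tfrac12\int(\phi\psi'-\phi'\psi)\,e^{-2V}dz,\qquad \langle\phi,\psi\rangle_{X}=X^2\langle\phi,\psi\rangle_{1,V_1}+\langle\phi,\psi\rangle_{4,V_2}.$$ The integral for $\langle\phi,\psi\rangle_{2,V}$ converges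 absolutely if $\deg\phi+\deg\psi<2p-1$, that for $\langle\phi,\psi\rangle_{1,V_1}$ if $\deg\phi,\deg\psi<p$, and that for $\langle\phi,\psi\rangle_{4,V_2}$ if $\deg\phi,\deg\psi<p-\tfrac12$. Let $p_n(z)=i^{-n}P_n(iz)$, where $P_n$ is the monic Jacobi polynomial $P_n^{(a,b)}$ with parameters $a=c$, $b=\bar c$ (the monic Routh–Romanovski polynomials), and $p_{-1}=0$. Let $$h_n=2^{2n-2p+2}\pi\frac{\Gamma(n+1)\Gamma(2p-2n)\Gamma(2p-2n-1)}{\Gamma(2p-n)\Gamma(p-iq-n)\Gamma(p+iq-n)},$$ $$\zeta_n=\frac{16n(p-n)(p-iq-2n)(p+iq-2n)}{(2p-4n-2)(2p-4n-1)(2p-4n)(2p-4n+1)},$$ $$h^{(1)}_n=2^{4n-2p+3}\pi\frac{\Gamma(2n+1)\Gamma(2p-4n)\Gamma(2p-4n-2)}{\Gamma(2p-2n)\Gamma(p+iq-2n)\Gamma(p-iq-2n)},$$ $$h^{(4)}_j=2^{2j-2p+3}\pi\frac{\Gamma(j+2)\Gamma(2p-2j-1)\Gamma(2p-2j-3)}{\Gamma(2p-j-1)\Gamma(p-1-iq-j)\Gamma(p-1+iq-j)}.$$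 Then the following hold. 1. For $n<p$, $p_n$ is monic of degree $n$, and $\langle p_n,p_m\rangle_{2,V}=h_n\delta_{n,m}$ whenever $n,m<p$ and $n+m<2p-1$. 2. Whenever the polynomial indices occurring are less than $p$: $\langle p_{2m},p_{2n+1}-\zeta_np_{2n-1}\rangle_{1,V_1}=h^{(1)}_n\delta_{n,m}$ and $\langle p_{2m},p_{2n}\rangle_{1,V_1}=\langle p_{2m+1}-\zeta_mp_{2m-1},p_{2n+1}-\zeta_np_{2n-1}\rangle_{1,V_1}=0$. 3. Whenever the polynomial indices occurring are less than $p-\frac12$: $\langle p_{2m},p_{2n+1}\rangle_{4,V_2}=h^{(4)}_{2n}\delta_{n,m}-h^{(4)}_{2m-1}\delta_{m-1,n}$ and $\langle p_{2m},p_{2n}\rangle_{4,V_2}=\langle p_{2m+1},p_{2n+1}\rangle_{4,V_2}=0$. 4. The recurrence $$h^{(4)}_{2j+1}\alpha_{j+1}-\bigl(X^2h^{(1)}_j+h^{(4)}_{2j}+\zeta_jh^{(4)}_{2j-1}\bigr)\alpha_j+\zeta_jh^{(4)}_{2j-2}\alpha_{j-1}=0\qquad(2j+2<p-\tfrac12)$$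 with $\alpha_{-1}=0$, $\alpha_0=1$ (where $\zeta_0=0$, so the terms containing it are absent) has, for $2j<p-\frac12$, exactly the solution $$\alpha_j=\frac{\Gamma(2p-1)}{\Gamma(-c)}\,(-1)^j2^{-2j}\frac{\Gamma(-c-2j)}{\Gamma(2j+1)\Gamma(2p-4j-1)}\,\tilde W_j\!\left(\tfrac{X^2}{4};\tfrac{\bar c+1}{2},\tfrac{c+1}{2},\tfrac12,0\right),$$ where $\tilde W_n(x^2;a,b,c,d)={}_4F_3(-n,\,n+a+b+c+d-1,\,a+ix,\,a-ix;\;a+b,\,a+c,\,a+d;\;1)$ is the normalised Wilson polynomial. These $\alpha_j$ do not vanish. 5. If $p>1$, the recurrence $$\zeta_{j+1}h^{(4)}_{2j}\xi_{j+1}-\bigl(X^2h^{(1)}_j+h^{(4)}_{2j}+\zeta_jh^{(4)}_{2j-1}\bigr)\xi_j+h^{(4)}_{2j-1}\xi_{j-1}=0\qquad(2j+3<p)$$ with $\xi_{-1}=0$, $\xi_0=1$ has, for $2j+1<p$, exactly the solution $$\xi_j=\frac{2p-4j-2}{2p-2}\,\alpha_j=\frac{\Gamma(2p-1)}{\Gamma(-c)}\,\frac{(-1)^j2^{-2j}\,\Gamma(-c-2j)}{(2p-2)\Gamma(2j+1)\Gamma(2p-4j-2)}\,\tilde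 W_j\!\left(\tfrac{X^2}{4};\tfrac{\bar c+1}{2},\tfrac{c+1}{2},\tfrac12,0\right),$$ and these $\xi_j$ do not vanish. 6. The polynomials $Q_{2m}=\frac1{\alpha_m}\sum_{k=0}^m\alpha_kp_{2k}$ and $Q_{2m+1}=\frac1{\xi_m}\sum_{k=0}^m\xi_k(p_{2k+1}-\zeta_kp_{2k-1})$ of degrees less than $p-\frac12$ are monic, of degrees $2m$ and $2m+1$, and skew orthogonal: $\langle Q_{2m},Q_{2n}\rangle_X=\langle Q_{2m+1},Q_{2n+1}\rangle_X=0$, and $\langle Q_{2m},Q_{2n+1}\rangle_X$ vanishes exactly when $m\ne n$. -/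

import Mathlib

open Polynomial MeasureTheory

noncomputable section

/-- The shifted value `a_{j-1}` of a sequence, with the convention `a_{-1} = 0`. -/
def prevTerm {M : Type*} [Zero M] (a : ℕ → M) : ℕ → M
  | 0 => 0
  | j + 1 => a j

/-- The Pochhammer symbol `(x)_k = x (x+1) ⋯ (x+k-1)`. -/
def poch (x : ℂ) (k : ℕ) : ℂ := (ascPochhammer ℂ k).eval x

/-- The parameter `c = -p + i q`. -/
def cauchyParam (p q : ℝ) : ℂ := -(p : ℂ) + (q : ℂ) * Complex.I

/-- The generalised Cauchy weight `(1 - i z)^c (1 + i z)^{c̄}` (principal branches). -/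
def cauchyWeight (c : ℂ) (z : ℝ) : ℂ :=
  (1 - Complex.I * (z : ℂ)) ^ c * (1 + Complex.I * (z : ℂ)) ^ ((starRingEnd ℂ) c)

/-- The potential `V`, with `e^{-2V(z)} = (1+z²)^{-p} exp(2 q arctan z)`. -/
def cauchyV (p q : ℝ) (z : ℝ) : ℝ :=
  p / 2 * Real.log (1 + z ^ 2) - q * Real.arctan z

/-- `V₁ = V + (1/2) log f` with `f(z) = 1 + z²`. -/
def cauchyV1 (p q : ℝ) (z : ℝ) : ℝ := cauchyV p q z + 1 / 2 * Real.log (1 + z ^ 2)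

/-- `V₂ = V - (1/2) log f` with `f(z) = 1 + z²`. -/
def cauchyV2 (p q : ℝ) (z : ℝ) : ℝ := cauchyV p q z - 1 / 2 * Real.log (1 + z ^ 2)

/-! The (skew) inner products on `ℂ[z]`; no complex conjugation is involved. -/

def integrand1 (V : ℝ → ℝ) (φ ψ : ℂ[X]) (t : ℝ × ℝ) : ℂ :=
  φ.eval (t.1 : ℂ) * ψ.eval (t.2 : ℂ) * ((Real.sign (t.2 - t.1) : ℝ) : ℂ)
    * ((Real.exp (-V t.1 - V t.2) : ℝ) : ℂ)

def integrand2 (V : ℝ → ℝ) (φ ψ : ℂ[X]) (z : ℝ) : ℂ :=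
  φ.eval (z : ℂ) * ψ.eval (z : ℂ) * ((Real.exp (-2 * V z) : ℝ) : ℂ)

def integrand4 (V : ℝ → ℝ) (φ ψ : ℂ[X]) (z : ℝ) : ℂ :=
  (φ.eval (z : ℂ) * ψ.derivative.eval (z : ℂ) - φ.derivative.eval (z : ℂ) * ψ.eval (z : ℂ))
    * ((Real.exp (-2 * V z) : ℝ) : ℂ)

/-- `⟨φ, ψ⟩_{1,V}` -/
def skew1 (V : ℝ → ℝ) (φ ψ : ℂ[X]) : ℂ := 1 / 2 * ∫ t : ℝ × ℝ, integrand1 V φ ψ t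

/-- `⟨φ, ψ⟩_{2,V}` -/
def inner2 (V : ℝ → ℝ) (φ ψ : ℂ[X]) : ℂ := ∫ z : ℝ, integrand2 V φ ψ z

/-- `⟨φ, ψ⟩_{4,V}` -/
def skew4 (V : ℝ → ℝ) (φ ψ : ℂ[X]) : ℂ := 1 / 2 * ∫ z : ℝ, integrand4 V φ ψ z

/-- `⟨φ, ψ⟩_{X,V₁,V₂} = X² ⟨φ, ψ⟩_{1,V₁} + ⟨φ, ψ⟩_{4,V₂}` -/
def skewX (X : ℝ) (V₁ V₂ : ℝ → ℝ) (φ ψ : ℂ[X]) : ℂ :=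
  (X : ℂ) ^ 2 * skew1 V₁ φ ψ + skew4 V₂ φ ψ

/-- The monic Jacobi polynomial
`p_n^{(a,b)}(z) = 2^n (a+1)_n / (n+a+b+1)_n · ₂F₁(-n, n+a+b+1; a+1; (1-z)/2)`, with
`(a+1)_n / (a+1)_k` written as `(a+k+1)_{n-k}` and `(-n)_k / k!` as `(-1)^k (n choose k)`. -/
def monicJacobi (n : ℕ) (a b : ℂ) : ℂ[X] :=
  C (2 ^ n / poch (n + a + b + 1) n) *
    ∑ k ∈ Finset.range (n + 1),
      C ((-1) ^ k * (n.choose k : ℂ) * poch (n + a + b + 1) k * poch (a + k + 1) (n - k)) *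
        (C (1 / 2) * (1 - X)) ^ k

/-- The monic Routh–Romanovski polynomial `Ĩ_n(z) = i^{-n} p_n^{(c,c̄)}(i z)`. -/
def routhRomanovski (p q : ℝ) (n : ℕ) : ℂ[X] :=
  C ((Complex.I ^ n)⁻¹) *
    (monicJacobi n (cauchyParam p q) ((starRingEnd ℂ) (cauchyParam p q))).comp (C Complex.I * X)

/-- The squared norm `h_n` of `Ĩ_n`. -/
def rrNorm (p q : ℝ) (n : ℕ) : ℂ :=
  (2 : ℂ) ^ (2 * n - 2 * p + 2 : ℂ) * Real.pi *
    (Complex.Gamma (n + 1) * Complex.Gamma (2 * p - 2 * n) * Complex.Gamma (2 * p - 2 * n - 1)) /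
    (Complex.Gamma (2 * p - n) * Complex.Gamma (p - Complex.I * q - n) *
      Complex.Gamma (p + Complex.I * q - n))

/-- `ζ_n` -/
def rrZeta (p q : ℝ) (n : ℕ) : ℂ :=
  16 * n * (p - n) * (p - Complex.I * q - 2 * n) * (p + Complex.I * q - 2 * n) /
    ((2 * p - 4 * n - 2) * (2 * p - 4 * n - 1) * (2 * p - 4 * n) * (2 * p - 4 * n + 1))

/-- `h^{(1)}_n` -/
def rrH1 (p q : ℝ) (n : ℕ) : ℂ :=
  (2 : ℂ) ^ (4 * n - 2 * p + 3 : ℂ) * Real.pi *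
    (Complex.Gamma (2 * n + 1) * Complex.Gamma (2 * p - 4 * n) *
      Complex.Gamma (2 * p - 4 * n - 2)) /
    (Complex.Gamma (2 * p - 2 * n) * Complex.Gamma (p + Complex.I * q - 2 * n) *
      Complex.Gamma (p - Complex.I * q - 2 * n))

/-- `h^{(4)}_j` -/
def rrH4 (p q : ℝ) (j : ℕ) : ℂ :=
  (2 : ℂ) ^ (2 * j - 2 * p + 3 : ℂ) * Real.pi *
    (Complex.Gamma (j + 2) * Complex.Gamma (2 * p - 2 * j - 1) *
      Complex.Gamma (2 * p - 2 * j - 3)) /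
    (Complex.Gamma (2 * p - j - 1) * Complex.Gamma (p - 1 - Complex.I * q - j) *
      Complex.Gamma (p - 1 + Complex.I * q - j))

/-- `q_{2k+1} = Ĩ_{2k+1} - ζ_k Ĩ_{2k-1}`, with `Ĩ_{-1} = 0`. -/
def rrOdd (p q : ℝ) (k : ℕ) : ℂ[X] :=
  routhRomanovski p q (2 * k + 1) -
    C (rrZeta p q k) * prevTerm (fun i => routhRomanovski p q (2 * i + 1)) k

/-- `X² h^{(1)}_j + h^{(4)}_{2j} + ζ_j h^{(4)}_{2j-1}`; as `ζ_0 = 0`, the last term is absent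
for `j = 0`. -/
def rrMiddle (p q X : ℝ) (j : ℕ) : ℂ :=
  (X : ℂ) ^ 2 * rrH1 p q j + rrH4 p q (2 * j) +
    rrZeta p q j * prevTerm (fun i => rrH4 p q (2 * i + 1)) j

/-- The recurrence for `α` at `j`:
`h4_{2j+1} α_{j+1} - (X² h1_j + h4_{2j} + ζ_j h4_{2j-1}) α_j + ζ_j h4_{2j-2} α_{j-1} = 0`. -/
def AlphaRecurrence (p q X : ℝ) (α : ℕ → ℂ) (j : ℕ) : Prop :=
  rrH4 p q (2 * j + 1) * α (j + 1) - rrMiddle p q X j * α j +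
    rrZeta p q j * prevTerm (fun i => rrH4 p q (2 * i)) j * prevTerm α j = 0

/-- The recurrence for `ξ` at `j`:
`ζ_{j+1} h4_{2j} ξ_{j+1} - (X² h1_j + h4_{2j} + ζ_j h4_{2j-1}) ξ_j + h4_{2j-1} ξ_{j-1} = 0`. -/
def XiRecurrence (p q X : ℝ) (ξ : ℕ → ℂ) (j : ℕ) : Prop :=
  rrZeta p q (j + 1) * rrH4 p q (2 * j) * ξ (j + 1) - rrMiddle p q X j * ξ j +
    prevTerm (fun i => rrH4 p q (2 * i + 1)) j * prevTerm ξ j = 0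

/-- The normalised Wilson polynomial
`W̃_n(y; a, b, c, d) = ₄F₃(-n, n+a+b+c+d-1, a+i√y, a-i√y; a+b, a+c, a+d; 1)`, a polynomial in `y`
because `(a+ix)_k (a-ix)_k = ∏_{i<k} ((a+i)² + x²)`. -/
def wilson (n : ℕ) (y a b c d : ℂ) : ℂ :=
  ∑ k ∈ Finset.range (n + 1),
    poch (-(n : ℂ)) k * poch (n + a + b + c + d - 1) k *
      (∏ i ∈ Finset.range k, ((a + i) ^ 2 + y)) /
      (poch (a + b) k * poch (a + c) k * poch (a + d) k * (k.factorial : ℂ))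

/-- `W̃_j(X²/4; (c̄+1)/2, (c+1)/2, 1/2, 0)` -/
def cauchyWilson (p q X : ℝ) (j : ℕ) : ℂ :=
  wilson j ((X : ℂ) ^ 2 / 4) (((starRingEnd ℂ) (cauchyParam p q) + 1) / 2)
    ((cauchyParam p q + 1) / 2) (1 / 2) 0

/-- `α_j`, normalised by `α_0 = 1`. -/
def alphaCoeff (p q X : ℝ) (j : ℕ) : ℂ :=
  Complex.Gamma (2 * p - 1) / Complex.Gamma (-cauchyParam p q) *
    ((-1) ^ j * ((2 : ℂ) ^ (2 * j))⁻¹ *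
      (Complex.Gamma (-cauchyParam p q - 2 * j) /
        (Complex.Gamma (2 * j + 1) * Complex.Gamma (2 * p - 4 * j - 1))) *
      cauchyWilson p q X j)

/-- `ξ_j = (2p-4j-2)/(2p-2) · α_j` -/
def xiCoeff (p q X : ℝ) (j : ℕ) : ℂ :=
  (2 * p - 4 * j - 2) / (2 * p - 2) * alphaCoeff p q X j

/-- `Q_{2m} = α_m⁻¹ ∑_{k ≤ m} α_k Ĩ_{2k}` -/
def QEven (p q X : ℝ) (m : ℕ) : ℂ[X] :=
  C ((alphaCoeff p q X m)⁻¹) *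
    ∑ k ∈ Finset.range (m + 1), C (alphaCoeff p q X k) * routhRomanovski p q (2 * k)

/-- `Q_{2m+1} = ξ_m⁻¹ ∑_{k ≤ m} ξ_k (Ĩ_{2k+1} - ζ_k Ĩ_{2k-1})` -/
def QOdd (p q X : ℝ) (m : ℕ) : ℂ[X] :=
  C ((xiCoeff p q X m)⁻¹) *
    ∑ k ∈ Finset.range (m + 1), C (xiCoeff p q X k) * rrOdd p q k

end

/-! Let w_{s,t}(z) = (1+z²)^{-s} e^{2t arctan z}. By Pearson's equation, differentiation sends
polynomial · w_{s,t} to polynomial · w_{s+1,t} (`weightDeriv`). Everything rests on integrating such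
derivatives over the line or over half-lines.

Orthogonality. On the monomials (1-iz)^k (1+iz)^m the vanishing of these integrals is a first-order
recurrence, so each moment is a quotient of Pochhammer symbols times the total mass
(`cauchyL_cayleyMonomial`). Expanding p_n in powers of 1-iz and testing it against (1+iz)^m leaves
an n-th finite difference: for m < n of a polynomial of degree n-m-1, hence zero, and for m = n of
1/(x+k), which gives the norm. The mass is the Cauchy beta integral (`cauchyMass_eq`). It follows
from its shift relation in p, the concentration of the weight at 0 as p grows, Euler's limit for Γ,
and the case q = 0.

Skew products. The operator N with (ψ e^{-V₂})' = (Nψ) e^{-V₁} is skew adjoint for ⟨,⟩₂ and links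
the three products: ⟨φ,ψ⟩₄ = ⟨φ,Nψ⟩₂, and ⟨φ,Nψ⟩₁ = -⟨φ,ψ⟩₂ because the sign kernel inverts d/dz.
Degree and skew adjointness force N p_n into the span of p_{n+1} and p_{n-1}
(`cauchyN_routhRomanovski`), and p_{2n+1} - ζ_n p_{2n-1} is a multiple of N p_{2n} (`rrOdd_eq`). The
β = 1 and β = 4 relations follow from these facts.

Skew orthogonal polynomials. Between the p_{2m} and the p_{2n+1} - ζ_n p_{2n-1} the matrix of ⟨,⟩_X
is tridiagonal. The recurrence for α says that the row vector α annihilates every column but the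
last, the one for ξ that the column vector ξ annihilates every row but the last, so ⟨Q_{2m},
Q_{2n+1}⟩_X collapses unless m = n. After rescaling, the recurrence for α is the three-term
recurrence of the Wilson polynomials (`wilson_recurrence`), and the one for ξ is a multiple of it.
Nonvanishing of α and of the diagonal value comes from positivity of all the constants involved
(`alphaCoeff_pos_and`). -/

noncomputable section

/-! ### The weight, its decay and Pearson's equation -/

/-- The weight `(1 + z²)^{-s} exp(2 t arctan z)`. -/
def cw (s t z : ℝ) : ℝ := Real.exp (-s * Real.log (1 + z ^ 2) + 2 * t * Real.arctan z)

theorem one_add_sq_pos (z : ℝ) : 0 < 1 + z ^ 2 := by positivity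

theorem cw_pos (s t z : ℝ) : 0 < cw s t z := Real.exp_pos _

/-- The logarithmic derivative is (2t - 2sz)/(1+z²), and raising s by one absorbs the denominator.
-/
theorem hasDerivAt_cw (s t z : ℝ) :
    HasDerivAt (cw s t) ((2 * t - 2 * s * z) * cw (s + 1) t z) z := by
  have hz := one_add_sq_pos z
  have h1 : HasDerivAt (fun z : ℝ => 1 + z ^ 2) (2 * z) z := by
    simpa using (hasDerivAt_pow 2 z).const_add 1
  have h2 := ((h1.log hz.ne').const_mul (-s)).add ((Real.hasDerivAt_arctan z).const_mul (2 * t))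
  have : cw (s + 1) t z = cw s t z * (1 + z ^ 2)⁻¹ := by
    rw [cw, cw, ← Real.exp_log hz, ← Real.exp_neg, ← Real.exp_add, Real.exp_log hz]
    congr 1; ring
  rw [this]
  refine h2.exp.congr_deriv ?_
  simp only [cw, Pi.add_apply]
  field_simp
  ring

theorem continuous_cw (s t : ℝ) : Continuous (cw s t) :=
  continuous_iff_continuousAt.2 fun z => (hasDerivAt_cw s t z).continuousAt

theorem one_add_sq_mul_cw (s t z : ℝ) : (1 + z ^ 2) * cw (s + 1) t z = cw s t z := by
  have hz := one_add_sq_pos z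
  rw [cw, cw, ← Real.exp_log hz, ← Real.exp_add, Real.exp_log hz]
  congr 1; ring

theorem cw_mul_cw (s t s' t' z : ℝ) : cw s t z * cw s' t' z = cw (s + s') (t + t') z := by
  rw [cw, cw, cw, ← Real.exp_add]; congr 1; ring

theorem cw_le (s t z : ℝ) : cw s t z ≤ Real.exp (Real.pi * |t|) * (1 + z ^ 2) ^ (-s) := by
  have hz := one_add_sq_pos z
  rw [Real.rpow_def_of_pos hz, ← Real.exp_add, cw]
  apply Real.exp_le_exp.2
  have h1 : |Real.arctan z| ≤ Real.pi / 2 :=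
    abs_le.2 ⟨(Real.neg_pi_div_two_lt_arctan z).le, (Real.arctan_lt_pi_div_two z).le⟩
  have h2 : t * Real.arctan z ≤ |t| * (Real.pi / 2) :=
    (le_abs_self _).trans (by rw [abs_mul]; gcongr)
  nlinarith

theorem exists_norm_eval_le (φ : ℂ[X]) (d : ℕ) (hd : φ.natDegree ≤ d) :
    ∃ C : ℝ, 0 ≤ C ∧ ∀ z : ℝ, ‖φ.eval (z : ℂ)‖ ≤ C * (1 + z ^ 2) ^ ((d : ℝ) / 2) := by
  refine ⟨∑ k ∈ Finset.range (d + 1), ‖φ.coeff k‖, Finset.sum_nonneg fun _ _ => norm_nonneg _,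
    fun z => ?_⟩
  have hz : 1 ≤ 1 + z ^ 2 := by nlinarith [sq_nonneg z]
  rw [eval_eq_sum_range' (Nat.lt_succ_of_le hd), Finset.sum_mul]
  refine (norm_sum_le _ _).trans (Finset.sum_le_sum fun k hk => ?_)
  rw [norm_mul, norm_pow, Complex.norm_real]
  gcongr
  have h1 : ‖z‖ ≤ (1 + z ^ 2) ^ (1 / 2 : ℝ) := by
    rw [← Real.sqrt_eq_rpow, Real.norm_eq_abs]
    apply Real.abs_le_sqrt; linarith
  calc ‖z‖ ^ k ≤ ((1 + z ^ 2) ^ (1 / 2 : ℝ)) ^ k := by gcongr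
    _ = (1 + z ^ 2) ^ ((k : ℝ) / 2) := by
      rw [← Real.rpow_natCast, ← Real.rpow_mul (by positivity)]; congr 1; ring
    _ ≤ _ := by
      apply Real.rpow_le_rpow_of_exponent_le hz
      have : (k : ℝ) ≤ d := by exact_mod_cast Nat.lt_succ_iff.1 (Finset.mem_range.1 hk)
      linarith

theorem exists_norm_eval_mul_cw_le (φ : ℂ[X]) (s t : ℝ) (d : ℕ) (hd : φ.natDegree ≤ d) :
    ∃ C : ℝ, 0 ≤ C ∧ ∀ z : ℝ,
      ‖φ.eval (z : ℂ) * (cw s t z : ℂ)‖ ≤ C * (1 + ‖z‖ ^ 2) ^ (-(2 * s - d) / 2) := by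
  obtain ⟨C, hC, h⟩ := exists_norm_eval_le φ d hd
  refine ⟨C * Real.exp (Real.pi * |t|), by positivity, fun z => ?_⟩
  have hz := one_add_sq_pos z
  rw [norm_mul, Complex.norm_real, Real.norm_of_nonneg (cw_pos s t z).le, Real.norm_eq_abs, sq_abs]
  calc _ ≤ (C * (1 + z ^ 2) ^ ((d : ℝ) / 2)) *
        (Real.exp (Real.pi * |t|) * (1 + z ^ 2) ^ (-s)) := by
        gcongr
        · exact (cw_pos s t z).le
        · exact h z
        · exact cw_le s t z
    _ = C * Real.exp (Real.pi * |t|) * ((1 + z ^ 2) ^ ((d : ℝ) / 2) * (1 + z ^ 2) ^ (-s)) := by ring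
    _ = _ := by rw [← Real.rpow_add hz]; congr 2; ring

theorem continuous_eval_mul_cw (φ : ℂ[X]) (s t : ℝ) :
    Continuous fun z : ℝ => φ.eval (z : ℂ) * (cw s t z : ℂ) :=
  (φ.continuous.comp Complex.continuous_ofReal).mul
    (Complex.continuous_ofReal.comp (continuous_cw s t))

theorem integrable_eval_mul_cw (φ : ℂ[X]) (s t : ℝ) (h : (φ.natDegree : ℝ) < 2 * s - 1) :
    Integrable fun z : ℝ => φ.eval (z : ℂ) * (cw s t z : ℂ) := by
  obtain ⟨C, -, hC⟩ := exists_norm_eval_mul_cw_le φ s t _ le_rfl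
  have h1 := (integrable_rpow_neg_one_add_norm_sq (E := ℝ) (μ := volume)
    (r := 2 * s - φ.natDegree) (by simp; linarith)).const_mul C
  exact h1.mono' (continuous_eval_mul_cw φ s t).aestronglyMeasurable (Filter.Eventually.of_forall hC)

theorem tendsto_eval_mul_cw (φ : ℂ[X]) (s t : ℝ) (h : (φ.natDegree : ℝ) < 2 * s) :
    Filter.Tendsto (fun z : ℝ => φ.eval (z : ℂ) * (cw s t z : ℂ)) (Filter.cocompact ℝ) (nhds 0) := by
  obtain ⟨C, -, hC⟩ := exists_norm_eval_mul_cw_le φ s t _ le_rfl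
  refine squeeze_zero_norm hC ?_
  have h1 : Filter.Tendsto (fun z : ℝ => 1 + ‖z‖ ^ 2) (Filter.cocompact ℝ) Filter.atTop :=
    Filter.tendsto_atTop_add_const_left _ _
      ((Filter.tendsto_pow_atTop two_ne_zero).comp tendsto_norm_cocompact_atTop)
  have h2 := (tendsto_rpow_neg_atTop (y := (2 * s - φ.natDegree) / 2) (by linarith)).comp h1
  simpa only [neg_div, mul_zero, Function.comp_def] using h2.const_mul C

/-- The polynomial `D` with `(φ w_{s,t})' = D w_{s+1,t}`. -/
def weightDeriv (s t : ℝ) (φ : ℂ[X]) : ℂ[X] :=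
  (1 + X ^ 2) * derivative φ + (C (2 * t : ℂ) - C (2 * s : ℂ) * X) * φ

theorem hasDerivAt_eval_mul_cw (s t : ℝ) (φ : ℂ[X]) (z : ℝ) :
    HasDerivAt (fun z : ℝ => φ.eval (z : ℂ) * (cw s t z : ℂ))
      ((weightDeriv s t φ).eval (z : ℂ) * (cw (s + 1) t z : ℂ)) z := by
  have h1 := (φ.hasDerivAt (z : ℂ)).comp_ofReal
  have h2 := (hasDerivAt_cw s t z).ofReal_comp
  refine (h1.mul h2).congr_deriv ?_
  rw [← one_add_sq_mul_cw s t z]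
  simp [weightDeriv]
  ring

theorem natDegree_weightDeriv_le (s t : ℝ) (φ : ℂ[X]) :
    (weightDeriv s t φ).natDegree ≤ φ.natDegree + 1 := by
  unfold weightDeriv
  refine natDegree_add_le_of_degree_le ?_ ?_
  -- Constants are separate: for them the product bound would give 2 instead of 1.
  · rcases Nat.eq_zero_or_pos φ.natDegree with h | h
    · rw [eq_C_of_natDegree_eq_zero h]; simp
    · refine natDegree_mul_le.trans ?_
      have h1 : (1 + X ^ 2 : ℂ[X]).natDegree ≤ 2 := by compute_degree
      have h2 := natDegree_derivative_lt h.ne'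
      omega
  · refine natDegree_mul_le.trans ?_
    have h1 : (C (2 * t : ℂ) - C (2 * s : ℂ) * X : ℂ[X]).natDegree ≤ 1 := by compute_degree
    omega

/-- The degree and s both rise by one, so the bound that makes the boundary terms vanish, one weaker
than integrability of φ w_{s,t}, already makes the derivative integrable. -/
theorem integrable_weightDeriv (s t : ℝ) (φ : ℂ[X]) (h : (φ.natDegree : ℝ) < 2 * s) :
    Integrable fun z : ℝ => (weightDeriv s t φ).eval (z : ℂ) * (cw (s + 1) t z : ℂ) := by
  apply integrable_eval_mul_cw
  have : ((weightDeriv s t φ).natDegree : ℝ) ≤ φ.natDegree + 1 := by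
    exact_mod_cast natDegree_weightDeriv_le s t φ
  linarith

theorem integral_weightDeriv (s t : ℝ) (φ : ℂ[X]) (h : (φ.natDegree : ℝ) < 2 * s) :
    ∫ z : ℝ, (weightDeriv s t φ).eval (z : ℂ) * (cw (s + 1) t z : ℂ) = 0 := by
  have h0 := tendsto_eval_mul_cw φ s t h
  rw [integral_of_hasDerivAt_of_tendsto (hasDerivAt_eval_mul_cw s t φ)
    (integrable_weightDeriv s t φ h) (h0.mono_left atBot_le_cocompact)
    (h0.mono_left atTop_le_cocompact), sub_zero]

theorem measurable_real_sign : Measurable Real.sign :=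
  Measurable.ite measurableSet_Iio measurable_const
    (Measurable.ite measurableSet_Ioi measurable_const measurable_const)

theorem norm_sign_le_one (x : ℝ) : ‖((Real.sign x : ℝ) : ℂ)‖ ≤ 1 := by
  rcases Real.sign_apply_eq x with h | h | h <;> simp [h]

/-- The sign kernel inverts differentiation: each of the two half-lines ending at y contributes the
same boundary value, with the same sign, and the far ends contribute nothing. -/
theorem integral_sign_mul_weightDeriv (s t : ℝ) (φ : ℂ[X]) (h : (φ.natDegree : ℝ) < 2 * s)
    (y : ℝ) :
    ∫ z : ℝ, ((Real.sign (z - y) : ℝ) : ℂ) *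
      ((weightDeriv s t φ).eval (z : ℂ) * (cw (s + 1) t z : ℂ)) =
      -2 * (φ.eval (y : ℂ) * (cw s t y : ℂ)) := by
  have h0 := tendsto_eval_mul_cw φ s t h
  have hi := integrable_weightDeriv s t φ h
  have h1 := integral_Ioi_of_hasDerivAt_of_tendsto' (a := y)
    (fun x _ => hasDerivAt_eval_mul_cw s t φ x) hi.integrableOn (h0.mono_left atTop_le_cocompact)
  have h2 := integral_Iic_of_hasDerivAt_of_tendsto' (a := y)
    (fun x _ => hasDerivAt_eval_mul_cw s t φ x) hi.integrableOn (h0.mono_left atBot_le_cocompact)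
  have h3 : Integrable fun z : ℝ => ((Real.sign (z - y) : ℝ) : ℂ) *
      ((weightDeriv s t φ).eval (z : ℂ) * (cw (s + 1) t z : ℂ)) := by
    refine hi.bdd_mul (c := 1) ?_ ?_
    · exact (Complex.measurable_ofReal.comp (measurable_real_sign.comp
        (measurable_id.sub_const y))).aestronglyMeasurable
    · exact Filter.Eventually.of_forall fun z => norm_sign_le_one _
  -- The endpoint y, where `Real.sign` is 0, is dropped from the left half-line before the sign is
  -- replaced by -1, and restored afterwards.
  rw [← intervalIntegral.integral_Iic_add_Ioi h3.integrableOn h3.integrableOn (b := y),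
    integral_Iic_eq_integral_Iio,
    setIntegral_congr_fun (g := fun z : ℝ =>
      -((weightDeriv s t φ).eval (z : ℂ) * (cw (s + 1) t z : ℂ))) measurableSet_Iio
      (fun z hz => by simp [Real.sign_of_neg (sub_neg.2 hz)]),
    setIntegral_congr_fun (s := Set.Ioi y) (g := fun z : ℝ =>
      ((weightDeriv s t φ).eval (z : ℂ) * (cw (s + 1) t z : ℂ))) measurableSet_Ioi
      (fun z hz => by simp [Real.sign_of_pos (sub_pos.2 hz)]),
    integral_neg, ← integral_Iic_eq_integral_Iio, h1, h2]
  ring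

/-! ### Moments of the Cauchy weight -/

/-- Integration of a polynomial against the weight `cw s t`. -/
def cauchyL (s t : ℝ) (φ : ℂ[X]) : ℂ := ∫ z : ℝ, φ.eval (z : ℂ) * (cw s t z : ℂ)

theorem cauchyL_add {s t : ℝ} {φ ψ : ℂ[X]} (hφ : (φ.natDegree : ℝ) < 2 * s - 1)
    (hψ : (ψ.natDegree : ℝ) < 2 * s - 1) :
    cauchyL s t (φ + ψ) = cauchyL s t φ + cauchyL s t ψ := by
  simp only [cauchyL, eval_add, add_mul]
  exact integral_add (integrable_eval_mul_cw φ s t hφ) (integrable_eval_mul_cw ψ s t hψ)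

theorem cauchyL_C_mul (s t : ℝ) (a : ℂ) (φ : ℂ[X]) :
    cauchyL s t (C a * φ) = a * cauchyL s t φ := by
  simp only [cauchyL, eval_mul, eval_C, mul_assoc]
  exact integral_const_mul _ _

theorem cauchyL_neg (s t : ℝ) (φ : ℂ[X]) : cauchyL s t (-φ) = -cauchyL s t φ := by
  rw [neg_eq_neg_one_mul φ, ← C_1, ← C_neg, cauchyL_C_mul, neg_one_mul]

theorem cauchyL_sub {s t : ℝ} {φ ψ : ℂ[X]} (hφ : (φ.natDegree : ℝ) < 2 * s - 1)
    (hψ : (ψ.natDegree : ℝ) < 2 * s - 1) :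
    cauchyL s t (φ - ψ) = cauchyL s t φ - cauchyL s t ψ := by
  rw [sub_eq_add_neg, cauchyL_add hφ (by rwa [natDegree_neg]), cauchyL_neg, ← sub_eq_add_neg]

theorem cauchyL_sum {ι : Type*} {s t : ℝ} (A : Finset ι) (φ : ι → ℂ[X])
    (h : ∀ i ∈ A, ((φ i).natDegree : ℝ) < 2 * s - 1) :
    cauchyL s t (∑ i ∈ A, φ i) = ∑ i ∈ A, cauchyL s t (φ i) := by
  simp only [cauchyL, eval_finsetSum, Finset.sum_mul]
  exact integral_finsetSum _ fun i hi => integrable_eval_mul_cw _ s t (h i hi)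

theorem poch_zero (x : ℂ) : poch x 0 = 1 := by simp [poch]

theorem poch_succ (x : ℂ) (k : ℕ) : poch x (k + 1) = poch x k * (x + k) := by
  simp [poch, ascPochhammer_succ_eval]

theorem poch_ne_zero {x : ℂ} {k : ℕ} (h : ∀ i < k, x + i ≠ 0) : poch x k ≠ 0 := by
  induction k with
  | zero => simp [poch_zero]
  | succ k ih =>
    rw [poch_succ]
    exact mul_ne_zero (ih fun i hi => h i (by omega)) (h k (by omega))

theorem poch_add (x : ℂ) (k m : ℕ) : poch x (k + m) = poch x k * poch (x + k) m := by
  induction m with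
  | zero => simp [poch_zero]
  | succ m ih => rw [← add_assoc, poch_succ, ih, poch_succ]; push_cast; ring

theorem poch_succ_left (x : ℂ) (k : ℕ) : poch x (k + 1) = x * poch (x + 1) k := by
  rw [add_comm, poch_add]; simp [poch_succ, poch_zero]

/-- The polynomial `(1 - i z)^k (1 + i z)^m`. -/
def cayleyMonomial (k m : ℕ) : ℂ[X] := (1 - C Complex.I * X) ^ k * (1 + C Complex.I * X) ^ m

theorem C_I_sq : (C Complex.I : ℂ[X]) ^ 2 = -1 := by rw [← C_pow, Complex.I_sq]; simp

theorem natDegree_cayleyMonomial_le (k m : ℕ) : (cayleyMonomial k m).natDegree ≤ k + m := by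
  refine natDegree_mul_le.trans (add_le_add ?_ ?_)
  · refine natDegree_pow_le.trans ?_
    have : (1 - C Complex.I * X : ℂ[X]).natDegree ≤ 1 := by compute_degree
    nlinarith
  · refine natDegree_pow_le.trans ?_
    have : (1 + C Complex.I * X : ℂ[X]).natDegree ≤ 1 := by compute_degree
    nlinarith

theorem mul_derivative_pow (f : ℂ[X]) (k : ℕ) :
    f * derivative (f ^ k) = (k : ℂ[X]) * f ^ k * derivative f := by
  cases k with
  | zero => simp
  | succ k => rw [derivative_pow_succ]; simp; ring

/-- Since 1+z² = (1-iz)(1+iz), differentiating such a monomial costs only one factor of either kind,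
so just two neighbouring monomials appear. -/
theorem weightDeriv_cayleyMonomial (p q : ℝ) (k m : ℕ) :
    weightDeriv (p - 1) q (cayleyMonomial k m) =
      C (Complex.I * (1 - p - q * Complex.I + m)) * cayleyMonomial (k + 1) m -
        C (Complex.I * (1 - p + q * Complex.I + k)) * cayleyMonomial k (m + 1) := by
  have h1 := mul_derivative_pow (1 - C Complex.I * X) k
  have h2 := mul_derivative_pow (1 + C Complex.I * X) m
  have hI := C_I_sq
  simp only [derivative_add, derivative_sub, derivative_one, derivative_C_mul, derivative_X] at h1 h2
  simp only [weightDeriv, cayleyMonomial, derivative_mul, pow_succ, C_mul, C_add, C_sub, C_1,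
    Complex.ofReal_sub, Complex.ofReal_one, map_natCast]
  have hC : (C (2 : ℂ) : ℂ[X]) = 2 := rfl
  rw [hC]
  set A := (1 - C Complex.I * X : ℂ[X]) ^ k
  set B := (1 + C Complex.I * X : ℂ[X]) ^ m
  have h3 : (1 + X ^ 2 : ℂ[X]) = (1 - C Complex.I * X) * (1 + C Complex.I * X) := by
    linear_combination X ^ 2 * hI
  linear_combination (derivative A * B + A * derivative B) * h3 + (1 + C Complex.I * X) * B * h1 + (1 - C Complex.I * X) * A * h2
    + (2 * C (q : ℂ) * A * B) * hI + (2 * (1 - C (p : ℂ)) * X * A * B) * hI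

/-- Two linear equations for the two neighbouring moments: the integral of a derivative vanishes,
and (1-iz) + (1+iz) = 2. Solving them gives both steps at once. -/
theorem cauchyL_cayleyMonomial_succ_left (p q : ℝ) (k m : ℕ) (h : (k : ℝ) + m + 1 < 2 * p - 1) :
    (2 - 2 * p + (k + m : ℕ)) * cauchyL p q (cayleyMonomial (k + 1) m) =
        2 * (1 - p + q * Complex.I + k) * cauchyL p q (cayleyMonomial k m) ∧
    (2 - 2 * p + (k + m : ℕ)) * cauchyL p q (cayleyMonomial k (m + 1)) =
        2 * (1 - p - q * Complex.I + m) * cauchyL p q (cayleyMonomial k m) := by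
  have d (a b : ℕ) (hab : a + b ≤ k + m + 1) :
      ((cayleyMonomial a b).natDegree : ℝ) < 2 * p - 1 := by
    have h1 : ((cayleyMonomial a b).natDegree : ℝ) ≤ (k + m + 1 : ℕ) := by
      exact_mod_cast (natDegree_cayleyMonomial_le a b).trans hab
    push_cast at h1; linarith
  have d' (a b : ℕ) (x : ℂ) (hab : a + b ≤ k + m + 1) :
      ((C x * cayleyMonomial a b).natDegree : ℝ) < 2 * p - 1 := by
    refine lt_of_le_of_lt ?_ (d a b hab)
    exact_mod_cast natDegree_C_mul_le _ _
  have h1 : cauchyL p q (weightDeriv (p - 1) q (cayleyMonomial k m)) = 0 := by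
    have := integral_weightDeriv (p - 1) q (cayleyMonomial k m) (by
      have h1 : ((cayleyMonomial k m).natDegree : ℝ) ≤ (k + m : ℕ) := by
        exact_mod_cast natDegree_cayleyMonomial_le k m
      push_cast at h1; linarith)
    rwa [sub_add_cancel] at this
  rw [weightDeriv_cayleyMonomial, cauchyL_sub (d' _ _ _ (by omega)) (d' _ _ _ (by omega)),
    cauchyL_C_mul, cauchyL_C_mul] at h1
  have h2 : cauchyL p q (cayleyMonomial (k + 1) m) + cauchyL p q (cayleyMonomial k (m + 1)) =
      2 * cauchyL p q (cayleyMonomial k m) := by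
    rw [← cauchyL_add (d _ _ (by omega)) (d _ _ (by omega)), ← cauchyL_C_mul]
    congr 1
    have hC : (C (2 : ℂ) : ℂ[X]) = 2 := rfl
    rw [hC]; simp only [cayleyMonomial]; ring
  have hI := Complex.I_mul_I
  push_cast
  constructor
  · linear_combination (-Complex.I) * h1 + (1 - p + q * Complex.I + k) * h2 +
      ((1 - p - q * Complex.I + m) * cauchyL p q (cayleyMonomial (k + 1) m)
        - (1 - p + q * Complex.I + k) * cauchyL p q (cayleyMonomial k (m + 1))) * hI
  · linear_combination (Complex.I) * h1 + (1 - p - q * Complex.I + m) * h2 -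
      ((1 - p - q * Complex.I + m) * cauchyL p q (cayleyMonomial (k + 1) m)
        - (1 - p + q * Complex.I + k) * cauchyL p q (cayleyMonomial k (m + 1))) * hI

/-- The moments of the Cauchy weight in the basis `(1 - i z)^k (1 + i z)^m`. -/
theorem cauchyL_cayleyMonomial (p q : ℝ) (k m : ℕ) (h : (k : ℝ) + m < 2 * p - 1) :
    poch (2 - 2 * p) (k + m) * cauchyL p q (cayleyMonomial k m) =
      2 ^ (k + m) * poch (1 - p + q * Complex.I) k * poch (1 - p - q * Complex.I) m *
        cauchyL p q 1 := by
  induction k with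
  | zero =>
    induction m with
    | zero => simp [poch_zero, cayleyMonomial]
    | succ m ih =>
      push_cast at h ih
      have h1 := ih (by linarith)
      have h2 := (cauchyL_cayleyMonomial_succ_left p q 0 m (by push_cast; linarith)).2
      rw [← add_assoc, poch_succ, poch_succ, pow_succ]
      simp only [zero_add] at *
      linear_combination poch (2 - 2 * p) m * h2 + 2 * (1 - p - q * Complex.I + m) * h1
  | succ k ih =>
    push_cast at h
    have h1 := ih (by linarith)
    have h2 := (cauchyL_cayleyMonomial_succ_left p q k m (by linarith)).1
    rw [show k + 1 + m = k + m + 1 by omega, poch_succ, poch_succ, pow_succ]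
    linear_combination poch (2 - 2 * p) (k + m) * h2 + 2 * (1 - p + q * Complex.I + k) * h1

/-! ### The Cauchy beta integral -/

/-- The total mass of the Cauchy weight. -/
def cauchyMass (p q : ℝ) : ℝ := ∫ z : ℝ, cw p q z

theorem cauchyL_one (p q : ℝ) : cauchyL p q 1 = cauchyMass p q := by
  simp only [cauchyL, cauchyMass, eval_one, one_mul]
  exact integral_ofReal

theorem integrable_cw {p : ℝ} (q : ℝ) (hp : 1 / 2 < p) : Integrable (cw p q) := by
  have h := integrable_eval_mul_cw 1 p q (by simp; linarith)
  simp only [eval_one, one_mul] at h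
  exact h.re

theorem cauchyMass_pos {p : ℝ} (q : ℝ) (hp : 1 / 2 < p) : 0 < cauchyMass p q :=
  integral_pos_of_integrable_nonneg_nonzero (x := 0) (continuous_cw p q) (integrable_cw q hp)
    (fun z => (cw_pos p q z).le) (cw_pos p q 0).ne'

/-- This is the moment k = m = 1 at parameter p+1, because (1+z²) w_{p+1} = w_p. -/
theorem cauchyMass_add_one {p : ℝ} (q : ℝ) (hp : 1 / 2 < p) :
    2 * (p ^ 2 + q ^ 2) * cauchyMass (p + 1) q = p * (2 * p - 1) * cauchyMass p q := by
  have h1 := cauchyL_cayleyMonomial (p + 1) q 1 1 (by push_cast; linarith)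
  have h2 : cauchyL (p + 1) q (cayleyMonomial 1 1) = cauchyL p q 1 := by
    refine integral_congr_ae (Filter.Eventually.of_forall fun z => ?_)
    simp only [← one_add_sq_mul_cw p q z]
    simp [cayleyMonomial]
    ring_nf; simp
  rw [h2, cauchyL_one, cauchyL_one] at h1
  simp only [poch_succ, poch_zero] at h1
  have h3 : (2 * (p ^ 2 + q ^ 2) * cauchyMass (p + 1) q : ℂ) =
      p * (2 * p - 1) * cauchyMass p q := by
    have hI := Complex.I_sq
    push_cast at h1
    linear_combination (-1 / 2) * h1 + 2 * (q : ℂ) ^ 2 * cauchyMass (p + 1) q * hI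
  exact_mod_cast h3

theorem cw_zero_right (p z : ℝ) : cw p 0 z = (1 + z ^ 2) ^ (-p) := by
  rw [cw, Real.rpow_def_of_pos (one_add_sq_pos z)]; ring_nf

/-- Write Γ(p)(1+z²)^{-p} as the integral of t^{p-1} e^{-t(1+z²)} over t > 0 and exchange the
integrals; the inner one becomes Gaussian and lowers the exponent of t by 1/2. -/
theorem cauchyMass_zero {p : ℝ} (hp : 1 / 2 < p) :
    Real.Gamma p * cauchyMass p 0 = √Real.pi * Real.Gamma (p - 1 / 2) := by
  set f : ℝ → ℝ → ℝ := fun t z => t ^ (p - 1) * Real.exp (-t) * Real.exp (-t * z ^ 2) with hf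
  have hgauss : ∀ t ∈ Set.Ioi (0 : ℝ), ∫ z, f t z =
      √Real.pi * (Real.exp (-t) * t ^ (p - 1 / 2 - 1)) := by
    intro t ht
    have ht : 0 < t := ht
    simp only [hf]
    rw [integral_const_mul, integral_gaussian, Real.sqrt_div Real.pi_pos.le,
      show t ^ (p - 1 / 2 - 1) = t ^ (p - 1) / √t by
        rw [Real.sqrt_eq_rpow, ← Real.rpow_sub ht]; congr 1; ring]
    ring
  have hint : Integrable (Function.uncurry f) ((volume.restrict (Set.Ioi 0)).prod volume) := by
    rw [integrable_prod_iff]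
    · constructor
      · filter_upwards [ae_restrict_mem measurableSet_Ioi] with t ht
        exact ((integrable_exp_neg_mul_sq ht).const_mul (t ^ (p - 1) * Real.exp (-t)) :)
      · have h1 := (Real.GammaIntegral_convergent (s := p - 1 / 2) (by linarith)).const_mul √Real.pi
        refine Integrable.congr h1 ?_
        filter_upwards [ae_restrict_mem measurableSet_Ioi] with t ht
        rw [← hgauss t ht]
        refine integral_congr_ae (Filter.Eventually.of_forall fun z => ?_)
        have ht : 0 < t := ht
        simp only [Function.uncurry, hf]
        rw [Real.norm_of_nonneg (by positivity)]
    · refine Measurable.aestronglyMeasurable ?_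
      simp only [hf, Function.uncurry_def]
      fun_prop
  have h1 := integral_integral_swap hint
  rw [setIntegral_congr_fun measurableSet_Ioi hgauss, integral_const_mul,
    ← Real.Gamma_eq_integral (by linarith)] at h1
  rw [h1, cauchyMass, ← integral_const_mul]
  refine integral_congr_ae (Filter.Eventually.of_forall fun z => ?_)
  have hz := one_add_sq_pos z
  have h2 := Real.integral_rpow_mul_exp_neg_mul_Ioi (a := p) (r := 1 + z ^ 2) (by linarith) hz
  simp only [cw_zero_right, hf]
  rw [Real.rpow_neg hz.le, ← Real.inv_rpow hz.le, inv_eq_one_div, mul_comm, ← h2]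
  refine setIntegral_congr_fun measurableSet_Ioi fun t _ => ?_
  simp only [mul_assoc, ← Real.exp_add]
  ring_nf

theorem abs_exp_sub_one_le_abs_mul_exp (u : ℝ) : |Real.exp u - 1| ≤ |u| * Real.exp |u| := by
  have h1 := Real.add_one_le_exp u
  have h2 := Real.add_one_le_exp (-u)
  have h3 : Real.exp u * Real.exp (-u) = 1 := by rw [← Real.exp_add]; simp
  have h4 := Real.exp_pos u
  rcases le_total 0 u with h | h
  · rw [abs_of_nonneg h, abs_of_nonneg (by linarith)]
    nlinarith
  · rw [abs_of_nonpos h, abs_of_nonpos (by linarith [Real.exp_le_one_iff.2 h])]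
    have : 1 ≤ Real.exp (-u) := Real.one_le_exp (by linarith)
    nlinarith

/-- With θ = arctan z the quotient of the weights is e^{2qθ}. Jordan's inequality bounds |θ| by a
multiple of |sin θ|, which is at most ε + ε⁻¹ sin²θ, and sin²θ · w_p = w_p - w_{p+1} is a difference
whose integral the shift relation evaluates. -/
theorem abs_cw_sub_cw_zero_le (p q z : ℝ) {ε : ℝ} (hε : 0 < ε) :
    |cw p q z - cw p 0 z| ≤ |q| * Real.pi * Real.exp (|q| * Real.pi) *
      (ε * cw p 0 z + ε⁻¹ * (cw p 0 z - cw (p + 1) 0 z)) := by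
  have hz := one_add_sq_pos z
  have hpi := Real.pi_pos
  set θ := Real.arctan z with hθ
  have hθ' : |θ| ≤ Real.pi / 2 :=
    abs_le.2 ⟨(Real.neg_pi_div_two_lt_arctan z).le, (Real.arctan_lt_pi_div_two z).le⟩
  have hsin := Real.mul_abs_le_abs_sin hθ'
  have hs2 : Real.sin θ ^ 2 = z ^ 2 / (1 + z ^ 2) := by
    rw [hθ, Real.sin_arctan, div_pow, Real.sq_sqrt hz.le]
  have e1 : cw p q z = cw p 0 z * Real.exp (2 * q * θ) := by
    rw [cw, cw, ← Real.exp_add, hθ]; ring_nf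
  have e2 : cw p 0 z - cw (p + 1) 0 z = cw p 0 z * Real.sin θ ^ 2 := by
    rw [hs2, ← one_add_sq_mul_cw p 0 z]; field_simp; ring
  have e3 : |Real.sin θ| ≤ ε + ε⁻¹ * Real.sin θ ^ 2 := by
    rw [← sq_abs (Real.sin θ)]
    have h1 := abs_nonneg (Real.sin θ)
    set x := |Real.sin θ|
    have h2 : ε * x ≤ ε * (ε + ε⁻¹ * x ^ 2) := by
      rw [mul_add, ← mul_assoc, mul_inv_cancel₀ hε.ne']
      nlinarith [sq_nonneg (ε - x)]
    exact le_of_mul_le_mul_left h2 hε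
  have e4 : |2 * q * θ| ≤ |q| * Real.pi * |Real.sin θ| := by
    rw [abs_mul, abs_mul, abs_two]
    have : 2 * |θ| ≤ Real.pi * |Real.sin θ| := by
      rw [div_mul_eq_mul_div, div_le_iff₀ hpi] at hsin; linarith
    nlinarith [abs_nonneg q]
  have e5 : |2 * q * θ| ≤ |q| * Real.pi := by
    rw [abs_mul, abs_mul, abs_two]
    nlinarith [abs_nonneg q]
  have hc := cw_pos p 0 z
  rw [e1, e2, show cw p 0 z * Real.exp (2 * q * θ) - cw p 0 z =
    cw p 0 z * (Real.exp (2 * q * θ) - 1) by ring, abs_mul, abs_of_pos hc]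
  calc _ ≤ cw p 0 z * (|2 * q * θ| * Real.exp |2 * q * θ|) := by
        gcongr; exact abs_exp_sub_one_le_abs_mul_exp _
    _ ≤ cw p 0 z * ((|q| * Real.pi * (ε + ε⁻¹ * Real.sin θ ^ 2)) * Real.exp (|q| * Real.pi)) := by
        gcongr
        exact e4.trans (by gcongr)
    _ = _ := by ring

theorem abs_cauchyMass_div_sub_one_le (q : ℝ) {p : ℝ} (hp : 1 / 2 < p) :
    |cauchyMass p q / cauchyMass p 0 - 1| ≤
      |q| * Real.pi * Real.exp (|q| * Real.pi) * (2 * p ^ (-(1 / 2) : ℝ)) := by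
  have hp0 : 0 < p := by linarith
  have h0 := cauchyMass_pos 0 hp
  have hr := cauchyMass_add_one 0 hp
  set K := |q| * Real.pi * Real.exp (|q| * Real.pi)
  have hK : 0 ≤ K := by positivity
  -- By the shift relation at q = 0 the masses at p and p+1 differ by the mass at p divided by 2p; ε
  -- = p^{-1/2} balances ε against ε⁻¹/(2p).
  set ε := p ^ (-(1 / 2) : ℝ) with hε
  have hεp : 0 < ε := by positivity
  have hε2 : ε * ε * p = 1 := by
    rw [hε, ← Real.rpow_add hp0, ← Real.rpow_add_one hp0.ne']; norm_num
  have hεi : ε⁻¹ = ε * p := inv_eq_of_mul_eq_one_right (by linarith)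
  have i0 := integrable_cw 0 hp
  have i1 := integrable_cw (p := p + 1) 0 (by linarith)
  have h1 : |cauchyMass p q - cauchyMass p 0| ≤
      K * (ε * cauchyMass p 0 + ε⁻¹ * (cauchyMass p 0 - cauchyMass (p + 1) 0)) := by
    have h2 : ∫ z, K * (ε * cw p 0 z + ε⁻¹ * (cw p 0 z - cw (p + 1) 0 z)) =
        K * (ε * cauchyMass p 0 + ε⁻¹ * (cauchyMass p 0 - cauchyMass (p + 1) 0)) := by
      have i2 : Integrable fun z => ε⁻¹ * (cw p 0 z - cw (p + 1) 0 z) := (i0.sub i1).const_mul _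
      rw [integral_const_mul, integral_add (i0.const_mul _) i2, integral_const_mul,
        integral_const_mul, integral_sub i0 i1]
      rfl
    rw [← h2, cauchyMass, cauchyMass, ← integral_sub (integrable_cw q hp) i0]
    refine (abs_integral_le_integral_abs).trans (integral_mono_of_nonneg
      (Filter.Eventually.of_forall fun z => abs_nonneg _)
      (((i0.const_mul _).add ((i0.sub i1).const_mul _)).const_mul _)
      (Filter.Eventually.of_forall fun z => abs_cw_sub_cw_zero_le p q z hεp))
  have h2 : cauchyMass p 0 - cauchyMass (p + 1) 0 = cauchyMass p 0 / (2 * p) := by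
    field_simp
    have : p * (2 * p * cauchyMass (p + 1) 0) = p * ((2 * p - 1) * cauchyMass p 0) := by
      linear_combination hr
    linarith [mul_left_cancel₀ hp0.ne' this]
  rw [div_sub_one h0.ne', abs_div, abs_of_pos h0, div_le_iff₀ h0]
  refine h1.trans ?_
  rw [h2, hεi, mul_assoc K]
  refine mul_le_mul_of_nonneg_left ?_ hK
  have : ε * p * (cauchyMass p 0 / (2 * p)) = ε * cauchyMass p 0 / 2 := by field_simp
  rw [this]
  nlinarith [mul_pos hεp h0]

theorem tendsto_cauchyMass_div (q : ℝ) {p : ℝ} (hp : 1 / 2 < p) :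
    Filter.Tendsto (fun n : ℕ => cauchyMass (p + n) q / cauchyMass (p + n) 0) Filter.atTop
      (nhds 1) := by
  rw [tendsto_iff_norm_sub_tendsto_zero]
  refine squeeze_zero (fun _ => norm_nonneg _)
    (fun n => abs_cauchyMass_div_sub_one_le q (p := p + n) (by
      have : (0 : ℝ) ≤ n := n.cast_nonneg
      linarith)) ?_
  have h1 : Filter.Tendsto (fun n : ℕ => p + (n : ℝ)) Filter.atTop Filter.atTop :=
    Filter.tendsto_atTop_add_const_left _ _ tendsto_natCast_atTop_atTop
  have h2 := (tendsto_rpow_neg_atTop (y := 1 / 2) (by norm_num)).comp h1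
  simpa using (h2.const_mul 2).const_mul (|q| * Real.pi * Real.exp (|q| * Real.pi))

theorem cauchyMass_div_add_nat (q : ℝ) {p : ℝ} (hp : 1 / 2 < p) (n : ℕ) :
    ((cauchyMass (p + n) q / cauchyMass (p + n) 0 : ℝ) : ℂ) *
      ∏ j ∈ Finset.range n, ((p + q * Complex.I + j) * (p - q * Complex.I + j)) =
    ((cauchyMass p q / cauchyMass p 0 : ℝ) : ℂ) * ∏ j ∈ Finset.range n, ((p + j : ℂ) * (p + j)) := by
  induction n with
  | zero => simp
  | succ n ih =>
    rw [Finset.prod_range_succ, Finset.prod_range_succ, ← mul_assoc _ _ ((p + n : ℂ) * (p + n)), ← ih]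
    have hP : 1 / 2 < p + n := by
      have : (0 : ℝ) ≤ n := n.cast_nonneg
      linarith
    have h1 := cauchyMass_add_one q hP
    have h2 := cauchyMass_add_one 0 hP
    have h3 := cauchyMass_pos 0 hP
    have h4 := cauchyMass_pos (p := p + n + 1) 0 (by linarith)
    have h5 : cauchyMass (p + n + 1) q / cauchyMass (p + n + 1) 0 * ((p + n) ^ 2 + q ^ 2) =
        cauchyMass (p + n) q / cauchyMass (p + n) 0 * (p + n) ^ 2 := by
      field_simp
      linear_combination (1 / 2) * cauchyMass (p + n) 0 * h1 - (1 / 2) * cauchyMass (p + n) q * h2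
    have h6 : (p + q * Complex.I + n) * (p - q * Complex.I + n) =
        (((p + n) ^ 2 + q ^ 2 : ℝ) : ℂ) := by
      push_cast; linear_combination (-(q : ℂ) ^ 2) * Complex.I_sq
    rw [h6]
    have h7 := congrArg (fun x : ℝ => (x : ℂ)) h5
    push_cast at h7 ⊢
    rw [← add_assoc (p : ℝ)]
    linear_combination (∏ j ∈ Finset.range n, ((p + q * Complex.I + j) * (p - q * Complex.I + j))) * h7

/-- Iterate the shift p → p+1. The quotient of masses tends to 1, while the accumulated products are
those in Euler's limit formula for the three Gamma values; the powers n^{±iq} cancel. -/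
theorem cauchyMass_div (q : ℝ) {p : ℝ} (hp : 1 / 2 < p) :
    ((cauchyMass p q / cauchyMass p 0 : ℝ) : ℂ) *
      (Complex.Gamma (p + q * Complex.I) * Complex.Gamma (p - q * Complex.I)) =
      Complex.Gamma p ^ 2 := by
  have hp0 : 0 < p := by linarith
  set g := ((cauchyMass p q / cauchyMass p 0 : ℝ) : ℂ)
  have h1 := ((Complex.GammaSeq_tendsto_Gamma (p + q * Complex.I)).mul
    (Complex.GammaSeq_tendsto_Gamma (p - q * Complex.I))).const_mul g
  -- Shifted to n+1 because the product in `Complex.GammaSeq` has n+1 factors.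
  have h2 := ((Complex.continuous_ofReal.tendsto _).comp
    ((tendsto_cauchyMass_div q hp).comp (Filter.tendsto_add_atTop_nat 1))).mul
      ((Complex.GammaSeq_tendsto_Gamma p).pow 2)
  rw [Complex.ofReal_one, one_mul] at h2
  refine tendsto_nhds_unique_of_eventuallyEq h1 h2 ?_
  filter_upwards [Filter.eventually_gt_atTop 0] with n hn
  have hn' : (n : ℂ) ≠ 0 := by exact_mod_cast hn.ne'
  have h3 := cauchyMass_div_add_nat q hp (n + 1)
  simp only [Function.comp, Complex.GammaSeq]
  rw [Finset.prod_mul_distrib, Finset.prod_mul_distrib] at h3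
  have a1 : ∏ j ∈ Finset.range (n + 1), (p + q * Complex.I + j : ℂ) ≠ 0 :=
    Finset.prod_ne_zero_iff.2 fun j _ h => by
      have := congrArg Complex.re h
      have hj : (0 : ℝ) ≤ j := j.cast_nonneg
      simp at this; linarith
  have a2 : ∏ j ∈ Finset.range (n + 1), (p - q * Complex.I + j : ℂ) ≠ 0 :=
    Finset.prod_ne_zero_iff.2 fun j _ h => by
      have := congrArg Complex.re h
      have hj : (0 : ℝ) ≤ j := j.cast_nonneg
      simp at this; linarith
  have a3 : ∏ j ∈ Finset.range (n + 1), (p + j : ℂ) ≠ 0 :=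
    Finset.prod_ne_zero_iff.2 fun j _ h => by
      have := congrArg Complex.re h
      have hj : (0 : ℝ) ≤ j := j.cast_nonneg
      simp at this; linarith
  rw [show (p + q * Complex.I : ℂ) = p + (q * Complex.I) from rfl, Complex.cpow_add _ _ hn',
    Complex.cpow_sub _ _ hn']
  have hc : (n : ℂ) ^ (q * Complex.I : ℂ) ≠ 0 := by simp [Complex.cpow_eq_zero_iff, hn']
  field_simp
  linear_combination (-((n : ℂ) ^ (p : ℂ)) ^ 2 * (n.factorial : ℂ) ^ 2) * h3

/-- The Cauchy beta integral. -/
theorem cauchyMass_eq (q : ℝ) {p : ℝ} (hp : 1 / 2 < p) :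
    (cauchyMass p q : ℂ) *
      (Complex.Gamma (p + q * Complex.I) * Complex.Gamma (p - q * Complex.I)) =
      (2 : ℂ) ^ (2 - 2 * p : ℂ) * Real.pi * Complex.Gamma (2 * p - 1) := by
  have h0 := cauchyMass_pos 0 hp
  have hG : Real.Gamma p ≠ 0 := (Real.Gamma_pos_of_pos (by linarith)).ne'
  have h1 := cauchyMass_div q hp
  have h2 := cauchyMass_zero hp
  -- Legendre duplication merges Γ(p - 1/2) and Γ(p) into Γ(2p-1).
  have h3 := Real.Gamma_mul_Gamma_add_half (p - 1 / 2)
  rw [sub_add_cancel] at h3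
  have h4 : cauchyMass p 0 * Real.Gamma p ^ 2 =
      (2 : ℝ) ^ (2 - 2 * p) * Real.pi * Real.Gamma (2 * p - 1) := by
    have : √Real.pi * √Real.pi = Real.pi := Real.mul_self_sqrt Real.pi_pos.le
    rw [show 1 - 2 * (p - 1 / 2) = 2 - 2 * p by ring, show 2 * (p - 1 / 2) = 2 * p - 1 by ring] at h3
    linear_combination Real.Gamma p * h2 + √Real.pi * h3 +
      Real.Gamma (2 * p - 1) * 2 ^ (2 - 2 * p) * this
  have h5 := congrArg (fun x : ℝ => (x : ℂ)) h4
  simp only [Complex.ofReal_mul, Complex.ofReal_pow, ← Complex.Gamma_ofReal] at h5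
  rw [Complex.ofReal_cpow (by norm_num)] at h5
  push_cast at h5 h1
  rw [← h5, ← h1]
  have : (cauchyMass p 0 : ℂ) ≠ 0 := by exact_mod_cast h0.ne'
  field_simp

/-! ### Alternating binomial sums -/

/-- Pascal's rule: an (n+1)-st finite difference is a difference of two n-th ones. -/
theorem sum_alternating_choose_succ (n : ℕ) (f : ℕ → ℂ) :
    ∑ k ∈ Finset.range (n + 2), (-1) ^ k * ((n + 1).choose k : ℂ) * f k =
      ∑ k ∈ Finset.range (n + 1), (-1) ^ k * (n.choose k : ℂ) * f k -
        ∑ k ∈ Finset.range (n + 1), (-1) ^ k * (n.choose k : ℂ) * f (k + 1) := by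
  have h : ∑ k ∈ Finset.range (n + 1), (-1) ^ k * (n.choose k : ℂ) * f k =
      ∑ k ∈ Finset.range (n + 1), (-1) ^ (k + 1) * (n.choose (k + 1) : ℂ) * f (k + 1) + f 0 := by
    have h1 := Finset.sum_range_succ (fun k => (-1) ^ k * (n.choose k : ℂ) * f k) (n + 1)
    rw [Finset.sum_range_succ'] at h1
    simpa using h1.symm
  rw [h, Finset.sum_range_succ', add_sub_right_comm, ← Finset.sum_sub_distrib]
  congr 1
  · refine Finset.sum_congr rfl fun k _ => ?_
    rw [Nat.choose_succ_succ]; push_cast; ring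
  · simp

theorem poch_add_one_sub (x : ℂ) (r : ℕ) :
    poch (x + 1) (r + 1) - poch x (r + 1) = (r + 1) * poch (x + 1) r := by
  rw [poch_succ, poch_succ_left]; ring

/-- An n-th difference kills a polynomial of degree r < n. The Pochhammer basis suits the induction:
one difference turns it into a multiple of the Pochhammer symbol of length one less. -/
theorem sum_alternating_choose_poch (n r : ℕ) (h : r < n) (x : ℂ) :
    ∑ k ∈ Finset.range (n + 1), (-1) ^ k * (n.choose k : ℂ) * poch (x + k) r = 0 := by
  induction n generalizing r x with
  | zero => omega
  | succ n ih =>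
    rw [sum_alternating_choose_succ, ← Finset.sum_sub_distrib]
    cases r with
    | zero => simp [poch_zero]
    | succ r =>
      have h1 := ih r (by omega) (x + 1)
      calc _ = ∑ k ∈ Finset.range (n + 1),
            (-(r + 1 : ℂ)) * ((-1) ^ k * (n.choose k : ℂ) * poch (x + 1 + k) r) := by
            refine Finset.sum_congr rfl fun k _ => ?_
            have := poch_add_one_sub (x + k) r
            push_cast
            rw [show x + ((k : ℂ) + 1) = x + k + 1 by ring, show x + 1 + (k : ℂ) = x + k + 1 by ring]
            linear_combination (-(-1) ^ k * (n.choose k : ℂ)) * this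
        _ = 0 := by rw [← Finset.mul_sum, h1, mul_zero]

theorem sum_alternating_choose_inv (n : ℕ) (x : ℂ) (h : ∀ i ≤ n, x + i ≠ 0) :
    ∑ k ∈ Finset.range (n + 1), (-1) ^ k * (n.choose k : ℂ) * (x + k)⁻¹ =
      n.factorial / poch x (n + 1) := by
  induction n generalizing x with
  | zero => simp [poch_zero, poch_succ]
  | succ n ih =>
    have h' : ∀ i ≤ n, x + 1 + i ≠ 0 := fun i hi => by
      have := h (i + 1) (by omega)
      push_cast at this
      rwa [show x + 1 + (i : ℂ) = x + (i + 1) by ring]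
    rw [sum_alternating_choose_succ, ih x fun i hi => h i (by omega)]
    have h1 := ih (x + 1) h'
    simp only [show ∀ k : ℕ, x + 1 + (k : ℂ) = x + ((k + 1 : ℕ) : ℂ) from
      fun k => by push_cast; ring] at h1
    rw [h1]
    have a1 : poch x (n + 1) ≠ 0 := poch_ne_zero fun i hi => h i (by omega)
    have a2 : poch (x + 1) n ≠ 0 := poch_ne_zero fun i hi => h' i (by omega)
    have a3 : x + ((n + 1 : ℕ) : ℂ) ≠ 0 := h (n + 1) le_rfl
    have a4 : x ≠ 0 := by simpa using h 0 (by omega)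
    rw [poch_succ x (n + 1), poch_succ_left x n, poch_succ (x + 1) n, Nat.factorial_succ]
    rw [poch_succ_left] at a1
    push_cast at a3 ⊢
    rw [show x + 1 + (n : ℂ) = x + (n + 1) by ring]
    field_simp
    ring

theorem poch_ofReal_ne_zero {x : ℝ} {k : ℕ} (h : x + k < 1) : poch (x : ℂ) k ≠ 0 :=
  poch_ne_zero fun i hi h0 => by
    have h1 : x + i = 0 := by exact_mod_cast h0
    have h2 : (i : ℝ) + 1 ≤ k := by exact_mod_cast hi
    linarith

/-- With r = n-m-1, splitting (s)_{m+r+k} in two ways turns the quotient into (s+m+k)_r / (s)_{m+r},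
a polynomial in k of degree r < n. -/
theorem sum_jacobi_moments_eq_zero {s : ℝ} {n m : ℕ} (hm : m < n) (h : s + n + m < 1) :
    ∑ k ∈ Finset.range (n + 1),
      (-1) ^ k * (n.choose k : ℂ) * (poch (s + n - 1) k / poch s (k + m)) = 0 := by
  obtain ⟨r, rfl⟩ : ∃ r, n = m + r + 1 := ⟨n - m - 1, by omega⟩
  push_cast at h
  have hr : (0 : ℝ) ≤ r := r.cast_nonneg
  have hm0 : (0 : ℝ) ≤ m := m.cast_nonneg
  have a1 : poch (s : ℂ) (m + r) ≠ 0 := poch_ofReal_ne_zero (by push_cast; linarith)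
  calc _ = ∑ k ∈ Finset.range (m + r + 1 + 1), (poch (s : ℂ) (m + r))⁻¹ *
        ((-1) ^ k * ((m + r + 1).choose k : ℂ) * poch (s + m + k) r) := by
        refine Finset.sum_congr rfl fun k hk => ?_
        have hk : (k : ℝ) ≤ m + r + 1 := by exact_mod_cast Nat.lt_succ_iff.1 (Finset.mem_range.1 hk)
        have a2 : poch (s : ℂ) (k + m) ≠ 0 := poch_ofReal_ne_zero (by push_cast; linarith)
        have e1 := poch_add s (m + r) k
        have e2 := poch_add s (k + m) r
        rw [show m + r + k = k + m + r by omega, e2] at e1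
        push_cast at e1 ⊢
        rw [show (s + (m + r + 1) - 1 : ℂ) = s + (m + r) by ring,
          show (s + m + k : ℂ) = s + (k + m) by ring]
        field_simp
        linear_combination (-((m + r + 1).choose k : ℂ)) * e1
    _ = 0 := by
        rw [← Finset.mul_sum, sum_alternating_choose_poch _ _ (by omega), mul_zero]

/-- On the diagonal the same splitting leaves, for n ≥ 1, the simple pole 1/((s)_{n-1} (s+n-1+k)),
whose n-th difference is known in closed form. -/
theorem sum_jacobi_moments_self {s : ℝ} {n : ℕ} (h : s + n + n < 1) :
    ∑ k ∈ Finset.range (n + 1),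
      (-1) ^ k * (n.choose k : ℂ) * (poch (s + n - 1) k / poch s (k + n)) =
        n.factorial / poch s (2 * n) := by
  cases n with
  | zero => simp [poch_zero]
  | succ n =>
    push_cast at h
    have hn : (0 : ℝ) ≤ n := n.cast_nonneg
    have a1 : poch (s : ℂ) n ≠ 0 := poch_ofReal_ne_zero (by linarith)
    have a3 (i : ℕ) (hi : i ≤ n + 1) : (s + n + i : ℂ) ≠ 0 := fun h0 => by
      have h1 : s + n + i = 0 := by exact_mod_cast h0
      have h2 : (i : ℝ) ≤ n + 1 := by exact_mod_cast hi
      linarith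
    calc _ = ∑ k ∈ Finset.range (n + 1 + 1), (poch (s : ℂ) n)⁻¹ *
          ((-1) ^ k * ((n + 1).choose k : ℂ) * ((s : ℂ) + n + k)⁻¹) := by
          refine Finset.sum_congr rfl fun k hk => ?_
          have hk' := Nat.lt_succ_iff.1 (Finset.mem_range.1 hk)
          have hk : (k : ℝ) ≤ n + 1 := by exact_mod_cast hk'
          have a2 : poch (s : ℂ) (k + n) ≠ 0 := poch_ofReal_ne_zero (by push_cast; linarith)
          have e1 := poch_add s n k
          rw [show n + k = k + n by omega] at e1
          rw [← add_assoc, poch_succ]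
          push_cast at e1 ⊢
          rw [show (s + (n + 1) - 1 : ℂ) = s + n by ring]
          have := a3 k hk'
          rw [show (s + (k + n) : ℂ) = s + n + k by ring]
          field_simp
          rw [e1]
          ring
      _ = _ := by
          rw [← Finset.mul_sum, sum_alternating_choose_inv _ _ a3,
            show 2 * (n + 1) = n + (n + 1 + 1) by omega, poch_add _ n (n + 1 + 1)]
          field_simp

/-! ### Routh–Romanovski polynomials: degree, orthogonality, norm -/

theorem conj_cauchyParam (p q : ℝ) :
    (starRingEnd ℂ) (cauchyParam p q) = -(p : ℂ) - q * Complex.I := by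
  simp [cauchyParam, sub_eq_add_neg]

theorem routhRomanovski_eq_sum (p q : ℝ) (n : ℕ) :
    routhRomanovski p q n = ∑ k ∈ Finset.range (n + 1),
      C ((Complex.I ^ n)⁻¹ * (2 ^ n / poch (n + 1 - 2 * p) n) *
        ((-1) ^ k * (n.choose k : ℂ) * poch (n + 1 - 2 * p) k *
          poch (1 - p + q * Complex.I + k) (n - k)) * (1 / 2) ^ k) *
        (1 - C Complex.I * X) ^ k := by
  rw [routhRomanovski, monicJacobi, conj_cauchyParam, cauchyParam]
  rw [mul_comp, Polynomial.sum_comp, Finset.mul_sum, Finset.mul_sum]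
  refine Finset.sum_congr rfl fun k _ => ?_
  rw [show (n + (-(p : ℂ) + q * Complex.I) + (-(p : ℂ) - q * Complex.I) + 1) = n + 1 - 2 * p by ring,
    show (-(p : ℂ) + q * Complex.I + k + 1) = 1 - p + q * Complex.I + k by ring]
  simp only [mul_comp, C_comp, pow_comp, sub_comp, one_comp, X_comp, mul_pow, C_mul, C_pow]
  ring

theorem natDegree_one_sub_C_I_mul_X_pow_le (k : ℕ) :
    ((1 - C Complex.I * X : ℂ[X]) ^ k).natDegree ≤ k := by
  simpa [cayleyMonomial] using natDegree_cayleyMonomial_le k 0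

theorem natDegree_routhRomanovski_le (p q : ℝ) (n : ℕ) :
    (routhRomanovski p q n).natDegree ≤ n := by
  rw [routhRomanovski_eq_sum]
  refine natDegree_sum_le_of_forall_le _ _ fun k hk => ?_
  exact (natDegree_C_mul_le _ _).trans ((natDegree_one_sub_C_I_mul_X_pow_le k).trans
    (Nat.lt_succ_iff.1 (Finset.mem_range.1 hk)))

theorem coeff_routhRomanovski {p : ℝ} (q : ℝ) {n : ℕ} (hn : (n : ℝ) < p) :
    (routhRomanovski p q n).coeff n = 1 := by
  rw [routhRomanovski_eq_sum, finsetSum_coeff, Finset.sum_eq_single n]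
  · have h1 := coeff_pow_of_natDegree_le (p := (1 - C Complex.I * X : ℂ[X])) (n := 1) (m := n)
      (by simpa using natDegree_one_sub_C_I_mul_X_pow_le 1)
    have h2 : (1 - C Complex.I * X : ℂ[X]).coeff 1 = -Complex.I := by simp [coeff_one]
    rw [mul_one, h2] at h1
    rw [coeff_C_mul, h1, Nat.choose_self, Nat.sub_self, poch_zero]
    have h3 : poch (n + 1 - 2 * p : ℂ) n ≠ 0 := by
      have := poch_ofReal_ne_zero (x := n + 1 - 2 * p) (k := n) (by linarith)
      push_cast at this; exact this
    rw [neg_pow Complex.I n, div_pow]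
    have := pow_ne_zero n Complex.I_ne_zero
    field_simp
    rw [← pow_mul, mul_comm n 2, pow_mul]; simp
  · intro k hk hkn
    have := Finset.mem_range.1 hk
    rw [coeff_C_mul, coeff_eq_zero_of_natDegree_lt, mul_zero]
    exact (natDegree_one_sub_C_I_mul_X_pow_le k).trans_lt (by omega)
  · simp

theorem natDegree_routhRomanovski {p : ℝ} (q : ℝ) {n : ℕ} (hn : (n : ℝ) < p) :
    (routhRomanovski p q n).natDegree = n :=
  le_antisymm (natDegree_routhRomanovski_le p q n)
    (le_natDegree_of_ne_zero (by rw [coeff_routhRomanovski q hn]; exact one_ne_zero))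

theorem monic_routhRomanovski {p : ℝ} (q : ℝ) {n : ℕ} (hn : (n : ℝ) < p) :
    (routhRomanovski p q n).Monic := by
  rw [Monic, leadingCoeff, natDegree_routhRomanovski q hn, coeff_routhRomanovski q hn]

/-- In powers of 1-iz every term times (1+iz)^m is a monomial of known moment. The factor (1-p+iq)_k
of that moment completes the coefficient to (1-p+iq)_n, which is independent of k and leaves the
purely real alternating sum. -/
theorem cauchyL_routhRomanovski_mul_pow {p : ℝ} (q : ℝ) {n m : ℕ} (h : (n : ℝ) + m < 2 * p - 1) :
    cauchyL p q (routhRomanovski p q n * (1 + C Complex.I * X) ^ m) =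
      (Complex.I ^ n)⁻¹ * (2 ^ n / poch (n + 1 - 2 * p) n) * poch (1 - p + q * Complex.I) n *
        poch (1 - p - q * Complex.I) m * 2 ^ m * cauchyL p q 1 *
        ∑ k ∈ Finset.range (n + 1), (-1) ^ k * (n.choose k : ℂ) *
          (poch (((2 - 2 * p : ℝ) : ℂ) + n - 1) k / poch ((2 - 2 * p : ℝ) : ℂ) (k + m)) := by
  rw [routhRomanovski_eq_sum, Finset.sum_mul]
  simp only [mul_assoc (C _)]
  rw [cauchyL_sum, Finset.mul_sum]
  · refine Finset.sum_congr rfl fun k hk => ?_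
    have hk' := Nat.lt_succ_iff.1 (Finset.mem_range.1 hk)
    have hk : (k : ℝ) ≤ n := by exact_mod_cast hk'
    have h1 := cauchyL_cayleyMonomial p q k m (by linarith)
    have a1 := poch_ofReal_ne_zero (x := 2 - 2 * p) (k := k + m) (by push_cast; linarith)
    have h2 := poch_add (1 - p + q * Complex.I) k (n - k)
    rw [Nat.add_sub_cancel' hk'] at h2
    rw [cauchyL_C_mul, h2]
    push_cast at a1 ⊢
    rw [show (2 - 2 * p + n - 1 : ℂ) = n + 1 - 2 * p by ring]
    have h3 : cauchyL p q (cayleyMonomial k m) = 2 ^ (k + m) * poch (1 - p + q * Complex.I) k *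
        poch (1 - p - q * Complex.I) m * cauchyL p q 1 / poch (2 - 2 * p) (k + m) := by
      rw [eq_div_iff a1, ← h1, mul_comm]
    change _ * cauchyL p q (cayleyMonomial k m) = _
    rw [h3, pow_add, div_pow]
    field_simp
    ring
  · intro k hk
    have h1 : ((C ((Complex.I ^ n)⁻¹ * (2 ^ n / poch (n + 1 - 2 * p) n) *
        ((-1) ^ k * (n.choose k : ℂ) * poch (n + 1 - 2 * p) k *
          poch (1 - p + q * Complex.I + k) (n - k)) * (1 / 2) ^ k) *
          ((1 - C Complex.I * X) ^ k * (1 + C Complex.I * X) ^ m)).natDegree : ℝ) ≤ (n + m : ℕ) := by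
      refine Nat.cast_le.2 ((natDegree_C_mul_le _ _).trans
        ((natDegree_cayleyMonomial_le k m).trans ?_))
      have := Finset.mem_range.1 hk
      omega
    push_cast at h1
    exact h1.trans_lt h

theorem exists_eq_sum_one_add_pow (ψ : ℂ[X]) :
    ∃ a : ℕ → ℂ, ψ = ∑ m ∈ Finset.range (ψ.natDegree + 1), C (a m) * (1 + C Complex.I * X) ^ m := by
  set χ := ψ.comp (C (-Complex.I) * (X - 1)) with hχ
  have hd : χ.natDegree ≤ ψ.natDegree := by
    refine natDegree_comp_le.trans ?_
    have : (C (-Complex.I) * (X - 1) : ℂ[X]).natDegree ≤ 1 := by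
      rw [mul_sub]; compute_degree
    nlinarith
  refine ⟨χ.coeff, ?_⟩
  have h1 : χ.comp (1 + C Complex.I * X) = ψ := by
    have h2 : (C (-Complex.I) * (X - 1) : ℂ[X]).comp (1 + C Complex.I * X) = X := by
      simp only [mul_comp, C_comp, sub_comp, X_comp, one_comp, C_neg, neg_comp]
      linear_combination (-X) * C_I_sq
    rw [hχ, comp_assoc, h2, comp_X]
  conv_lhs => rw [← h1]
  rw [comp, eval₂_eq_sum_range' _ (Nat.lt_succ_of_le hd)]

/-- The Routh–Romanovski polynomials are orthogonal to polynomials of lower degree. -/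
theorem cauchyL_routhRomanovski_mul_eq_zero {p : ℝ} (q : ℝ) {n : ℕ} {ψ : ℂ[X]}
    (hψ : ψ.degree < n) (h : (n : ℝ) + ψ.natDegree < 2 * p - 1) :
    cauchyL p q (routhRomanovski p q n * ψ) = 0 := by
  by_cases h0 : ψ = 0
  · simp [h0, cauchyL]
  rw [degree_eq_natDegree h0, Nat.cast_lt] at hψ
  obtain ⟨a, ha⟩ := exists_eq_sum_one_add_pow ψ
  rw [ha, Finset.mul_sum]
  have hm' (m : ℕ) (hm : m ∈ Finset.range (ψ.natDegree + 1)) : (m : ℝ) ≤ ψ.natDegree := by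
    exact_mod_cast Nat.lt_succ_iff.1 (Finset.mem_range.1 hm)
  rw [cauchyL_sum]
  · refine Finset.sum_eq_zero fun m hm => ?_
    have h1 := hm' m hm
    have h2 := Finset.mem_range.1 hm
    rw [mul_left_comm, cauchyL_C_mul, cauchyL_routhRomanovski_mul_pow q (by linarith),
      sum_jacobi_moments_eq_zero (by omega) (by linarith), mul_zero, mul_zero]
  · intro m hm
    have h1 := hm' m hm
    rw [mul_left_comm]
    have h2 : ((C (a m) * (routhRomanovski p q n * (1 + C Complex.I * X) ^ m)).natDegree : ℝ) ≤
        (n + m : ℕ) := by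
      refine Nat.cast_le.2 ((natDegree_C_mul_le _ _).trans (natDegree_mul_le.trans
        (add_le_add (natDegree_routhRomanovski_le p q n) ?_)))
      simpa [cayleyMonomial] using natDegree_cayleyMonomial_le 0 m
    push_cast at h2
    linarith

/-- Brings every Gamma value of the mass formula down to the arguments that occur in h_n, so that
the comparison becomes algebra of Pochhammer symbols. -/
theorem Gamma_eq_poch_mul (z : ℂ) (n : ℕ) (h : (n : ℝ) < z.re) :
    Complex.Gamma z = (-1) ^ n * poch (1 - z) n * Complex.Gamma (z - n) := by
  induction n with
  | zero => simp [poch_zero]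
  | succ n ih =>
    push_cast at h
    have h1 : z - (n + 1) ≠ 0 := fun h0 => by
      have := congrArg Complex.re h0
      simp at this; linarith
    have h2 := Complex.Gamma_add_one _ h1
    rw [show z - (n + 1) + 1 = z - n by ring] at h2
    rw [ih (by linarith), h2, poch_succ]; push_cast; ring

/-- The squared norm of the Routh–Romanovski polynomial. -/
theorem cauchyL_routhRomanovski_mul_self {p : ℝ} (q : ℝ) {n : ℕ} (hp : 1 / 2 < p) (hn : (n : ℝ) < p)
    (h : (n : ℝ) + n < 2 * p - 1) :
    cauchyL p q (routhRomanovski p q n * routhRomanovski p q n) = rrNorm p q n := by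
  have hn0 : (0 : ℝ) ≤ n := n.cast_nonneg
  -- The leading coefficient of (1+iz)^n is i^n. By orthogonality the second factor p_n may thus be
  -- replaced by i^{-n}(1+iz)^n.
  have hdeg : (routhRomanovski p q n - C (Complex.I ^ n)⁻¹ * (1 + C Complex.I * X) ^ n).degree
      < (n : WithBot ℕ) := by
    have hf : (1 + C Complex.I * X : ℂ[X]).natDegree ≤ 1 := by compute_degree
    rw [degree_lt_iff_coeff_zero]
    intro m hm
    rcases hm.eq_or_lt with rfl | hm
    · have h1 := coeff_pow_of_natDegree_le (m := n) hf
      have h2 : (1 + C Complex.I * X : ℂ[X]).coeff 1 = Complex.I := by simp [coeff_one]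
      rw [mul_one, h2] at h1
      rw [coeff_sub, coeff_C_mul, h1, coeff_routhRomanovski q hn,
        inv_mul_cancel₀ (pow_ne_zero n Complex.I_ne_zero), sub_self]
    · refine coeff_eq_zero_of_natDegree_lt (lt_of_le_of_lt ?_ hm)
      refine (natDegree_sub_le_of_le (natDegree_routhRomanovski_le p q n)
        ((natDegree_C_mul_le _ _).trans ?_)).trans (max_self n).le
      simpa [cayleyMonomial] using natDegree_cayleyMonomial_le 0 n
  set R := routhRomanovski p q n - C (Complex.I ^ n)⁻¹ * (1 + C Complex.I * X) ^ n with hR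
  have hRd : (R.natDegree : ℝ) ≤ n := by exact_mod_cast natDegree_le_of_degree_le hdeg.le
  have d1 : ((routhRomanovski p q n * R).natDegree : ℝ) < 2 * p - 1 := by
    have h1 : ((routhRomanovski p q n * R).natDegree : ℝ) ≤ (n + R.natDegree : ℕ) :=
      Nat.cast_le.2 (natDegree_mul_le.trans
        (add_le_add (natDegree_routhRomanovski_le p q n) le_rfl))
    push_cast at h1; linarith
  have d2 : ((C (Complex.I ^ n)⁻¹ * (routhRomanovski p q n *
      (1 + C Complex.I * X) ^ n)).natDegree : ℝ) < 2 * p - 1 := by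
    have h1 : ((C (Complex.I ^ n)⁻¹ * (routhRomanovski p q n *
      (1 + C Complex.I * X) ^ n)).natDegree : ℝ) ≤ (n + n : ℕ) := by
      refine Nat.cast_le.2 ((natDegree_C_mul_le _ _).trans (natDegree_mul_le.trans
        (add_le_add (natDegree_routhRomanovski_le p q n) ?_)))
      simpa [cayleyMonomial] using natDegree_cayleyMonomial_le 0 n
    push_cast at h1; linarith
  have e1 : routhRomanovski p q n * routhRomanovski p q n = routhRomanovski p q n * R +
      C (Complex.I ^ n)⁻¹ * (routhRomanovski p q n * (1 + C Complex.I * X) ^ n) := by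
    rw [hR]; ring
  rw [e1, cauchyL_add d1 d2, cauchyL_routhRomanovski_mul_eq_zero q hdeg (by linarith),
    cauchyL_C_mul, cauchyL_routhRomanovski_mul_pow q h, sum_jacobi_moments_self (by linarith),
    cauchyL_one, zero_add]
  have hm := cauchyMass_eq q hp
  have g1 := Gamma_eq_poch_mul (p + q * Complex.I) n (by simpa using hn)
  have g2 := Gamma_eq_poch_mul (p - q * Complex.I) n (by simpa using hn)
  have g3 := Gamma_eq_poch_mul (2 * p - 1) (2 * n) (by simp; linarith)
  have g4 := Gamma_eq_poch_mul (2 * p - n) n (by simp; linarith)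
  have n1 : Complex.Gamma (p + q * Complex.I) ≠ 0 :=
    Complex.Gamma_ne_zero_of_re_pos (by simp; linarith)
  have n2 : Complex.Gamma (p - q * Complex.I) ≠ 0 :=
    Complex.Gamma_ne_zero_of_re_pos (by simp; linarith)
  have n3 : Complex.Gamma (2 * p - 1) ≠ 0 :=
    Complex.Gamma_ne_zero_of_re_pos (by simp; linarith)
  have n4 : Complex.Gamma (2 * p - n) ≠ 0 :=
    Complex.Gamma_ne_zero_of_re_pos (by simp; linarith)
  have m1 : (cauchyMass p q : ℂ) = (2 : ℂ) ^ (2 - 2 * p : ℂ) * Real.pi * Complex.Gamma (2 * p - 1) /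
      (Complex.Gamma (p + q * Complex.I) * Complex.Gamma (p - q * Complex.I)) := by
    rw [← hm]; field_simp
  rw [rrNorm, m1, show (2 * n - 2 * p + 2 : ℂ) = (2 - 2 * p) + (2 * n : ℕ) by push_cast; ring,
    Complex.cpow_add _ _ two_ne_zero, Complex.cpow_natCast, Complex.Gamma_nat_eq_factorial]
  rw [g1, g2, g3, g4]
  rw [g1] at n1
  rw [g2] at n2
  rw [g3] at n3
  rw [g4] at n4
  have hs : ((-1 : ℂ) ^ n) * (-1) ^ n = 1 := by rw [← mul_pow]; simp
  have hI : Complex.I ^ n * Complex.I ^ n = (-1) ^ n := by rw [← mul_pow]; simp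
  simp only [mul_ne_zero_iff] at n1 n2 n3 n4
  push_cast at *
  rw [show (1 - (p + q * Complex.I) : ℂ) = 1 - p - q * Complex.I by ring] at *
  rw [show (1 - (p - q * Complex.I) : ℂ) = 1 - p + q * Complex.I by ring] at *
  rw [show (1 - (2 * p - 1) : ℂ) = 2 - 2 * p by ring] at *
  rw [show (1 - (2 * p - n) : ℂ) = n + 1 - 2 * p by ring] at *
  rw [show (2 * p - n - n : ℂ) = 2 * p - 2 * n by ring] at *
  rw [show (2 * p - 1 - 2 * n : ℂ) = 2 * p - 2 * n - 1 by ring] at *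
  rw [show (p - Complex.I * q - n : ℂ) = p - q * Complex.I - n by ring,
    show (p + Complex.I * q - n : ℂ) = p + q * Complex.I - n by ring]
  obtain ⟨⟨-, a1⟩, b1⟩ := n1
  obtain ⟨⟨-, a2⟩, b2⟩ := n2
  obtain ⟨⟨-, a3⟩, b3⟩ := n3
  obtain ⟨⟨-, a4⟩, b4⟩ := n4
  have hI0 := pow_ne_zero n Complex.I_ne_zero
  have hs0 := pow_ne_zero n (neg_ne_zero.2 (one_ne_zero (α := ℂ)))
  have hs2 : (-1 : ℂ) ^ (2 * n) = 1 := by rw [pow_mul]; simp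
  rw [hs2]
  clear hm m1 g1 g2 g3 g4
  generalize poch (2 - 2 * p : ℂ) (2 * n) = A at *
  generalize Complex.Gamma (2 * p - 2 * n) = B at *
  generalize Complex.Gamma (2 * p - 2 * n - 1) = D at *
  field_simp
  rw [pow_two (Complex.I ^ n), hI, hs, pow_mul']
  ring

/-! ### The potentials, convergence and skew symmetry -/

theorem exp_neg_two_mul_cauchyV (p q z : ℝ) : Real.exp (-2 * cauchyV p q z) = cw p q z := by
  rw [cauchyV, cw]; ring_nf

theorem exp_neg_cauchyV1 (p q z : ℝ) :
    Real.exp (-cauchyV1 p q z) = cw ((p - 1) / 2 + 1) (q / 2) z := by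
  rw [cauchyV1, cauchyV, cw]; ring_nf

theorem exp_neg_cauchyV2 (p q z : ℝ) :
    Real.exp (-cauchyV2 p q z) = cw ((p - 1) / 2) (q / 2) z := by
  rw [cauchyV2, cauchyV, cw]; ring_nf

theorem exp_neg_two_mul_cauchyV2 (p q z : ℝ) :
    Real.exp (-2 * cauchyV2 p q z) = cw (p - 1) q z := by
  rw [cauchyV2, cauchyV, cw]; ring_nf

/-- The points 1 ± iz lie in the right half-plane, where the principal logarithm is ½ log(1+z²) ± i
arctan z. -/
theorem cauchyWeight_eq_cw (s t z : ℝ) :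
    cauchyWeight (-(s : ℂ) + t * Complex.I) z = cw s t z := by
  have hz := one_add_sq_pos z
  have h1 : (1 + Complex.I * z : ℂ) ≠ 0 := fun h => by simpa using congrArg Complex.re h
  have h2 : (1 - Complex.I * z : ℂ) ≠ 0 := fun h => by simpa using congrArg Complex.re h
  have hn : ‖(1 + Complex.I * z : ℂ)‖ = √(1 + z ^ 2) := by
    rw [Complex.norm_eq_sqrt_sq_add_sq]; simp
  have l1 : Complex.log (1 + Complex.I * z) =
      (1 / 2 : ℂ) * Real.log (1 + z ^ 2) + Real.arctan z * Complex.I := by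
    apply Complex.ext
    · rw [Complex.log_re, hn, Real.log_sqrt hz.le]; simp [-Complex.ofReal_arctan]; ring
    · rw [Complex.log_im, Complex.arg_of_re_nonneg (by simp), hn, Real.arctan_eq_arcsin]
      simp [-Complex.ofReal_arctan]
  have l2 : Complex.log (1 - Complex.I * z) =
      (1 / 2 : ℂ) * Real.log (1 + z ^ 2) - Real.arctan z * Complex.I := by
    have h3 : (1 - Complex.I * z : ℂ) = (starRingEnd ℂ) (1 + Complex.I * z) := by
      simp [sub_eq_add_neg]
    rw [h3, Complex.log_conj, l1]
    · simp [-Complex.ofReal_arctan, sub_eq_add_neg, Complex.conj_ofNat]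
    · intro h
      have := Complex.arg_eq_pi_iff.1 h
      simp at this; linarith
  rw [cauchyWeight, Complex.cpow_def_of_ne_zero h1, Complex.cpow_def_of_ne_zero h2,
    ← Complex.exp_add, cw, Complex.ofReal_exp, l1, l2]
  congr 1
  simp only [map_add, map_neg, map_mul, Complex.conj_ofReal, Complex.conj_I]
  generalize Real.arctan z = θ
  push_cast
  linear_combination (-2 * (t : ℂ) * θ) * Complex.I_sq

theorem inner2_eq_cauchyL (p q : ℝ) (φ ψ : ℂ[X]) :
    inner2 (cauchyV p q) φ ψ = cauchyL p q (φ * ψ) := by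
  simp only [inner2, integrand2, cauchyL, exp_neg_two_mul_cauchyV, eval_mul]

theorem integrable_integrand2 (p q : ℝ) (φ ψ : ℂ[X])
    (h : (φ.natDegree : ℝ) + ψ.natDegree < 2 * p - 1) :
    Integrable (integrand2 (cauchyV p q) φ ψ) := by
  have h1 : ((φ * ψ).natDegree : ℝ) ≤ (φ.natDegree + ψ.natDegree : ℕ) :=
    Nat.cast_le.2 natDegree_mul_le
  push_cast at h1
  rw [show integrand2 (cauchyV p q) φ ψ = fun z : ℝ => (φ * ψ).eval (z : ℂ) * (cw p q z : ℂ) from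
    funext fun z => by simp only [integrand2, eval_mul, exp_neg_two_mul_cauchyV]]
  exact integrable_eval_mul_cw (φ * ψ) p q (by linarith)

theorem integrand1_eq (p q : ℝ) (φ ψ : ℂ[X]) (t : ℝ × ℝ) :
    integrand1 (cauchyV1 p q) φ ψ t = ((Real.sign (t.2 - t.1) : ℝ) : ℂ) *
      ((φ.eval (t.1 : ℂ) * (cw ((p - 1) / 2 + 1) (q / 2) t.1 : ℂ)) *
        (ψ.eval (t.2 : ℂ) * (cw ((p - 1) / 2 + 1) (q / 2) t.2 : ℂ))) := by
  rw [integrand1, sub_eq_add_neg (-_), Real.exp_add, exp_neg_cauchyV1, exp_neg_cauchyV1]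
  push_cast; ring

theorem integrable_integrand1 (p q : ℝ) {φ ψ : ℂ[X]} (hφ : (φ.natDegree : ℝ) < p)
    (hψ : (ψ.natDegree : ℝ) < p) : Integrable (integrand1 (cauchyV1 p q) φ ψ) := by
  have h1 := integrable_eval_mul_cw φ ((p - 1) / 2 + 1) (q / 2) (by linarith)
  have h2 := integrable_eval_mul_cw ψ ((p - 1) / 2 + 1) (q / 2) (by linarith)
  rw [show integrand1 (cauchyV1 p q) φ ψ = _ from funext (integrand1_eq p q φ ψ)]
  refine (h1.mul_prod h2).bdd_mul (c := 1) ?_ (Filter.Eventually.of_forall fun _ => norm_sign_le_one _)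
  exact (Complex.measurable_ofReal.comp (measurable_real_sign.comp
    (measurable_snd.sub measurable_fst))).aestronglyMeasurable

theorem integrand4_eq (p q : ℝ) (φ ψ : ℂ[X]) (z : ℝ) :
    integrand4 (cauchyV2 p q) φ ψ z =
      (φ * derivative ψ - derivative φ * ψ).eval (z : ℂ) * (cw (p - 1) q z : ℂ) := by
  simp only [integrand4, exp_neg_two_mul_cauchyV2, eval_sub, eval_mul]

theorem natDegree_mul_derivative_sub_le (φ ψ : ℂ[X]) :
    (φ * derivative ψ - derivative φ * ψ).natDegree ≤ φ.natDegree + ψ.natDegree - 1 := by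
  rcases Nat.eq_zero_or_pos φ.natDegree with h | h <;>
  rcases Nat.eq_zero_or_pos ψ.natDegree with h' | h'
  · rw [eq_C_of_natDegree_eq_zero h, eq_C_of_natDegree_eq_zero h']; simp
  · rw [eq_C_of_natDegree_eq_zero h]
    simp only [derivative_C, zero_mul, sub_zero, natDegree_C, zero_add]
    exact (natDegree_C_mul_le _ _).trans (natDegree_derivative_le _)
  · rw [eq_C_of_natDegree_eq_zero h']
    simp only [derivative_C, mul_zero, zero_sub, natDegree_C, add_zero, natDegree_neg]
    exact (natDegree_mul_C_le _ _).trans (natDegree_derivative_le _)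
  · have h1 := natDegree_derivative_le φ
    have h2 := natDegree_derivative_le ψ
    have h3 := natDegree_mul_le (p := φ) (q := derivative ψ)
    have h4 := natDegree_mul_le (p := derivative φ) (q := ψ)
    refine (natDegree_sub_le _ _).trans (max_le ?_ ?_) <;> omega

theorem integrable_integrand4_of_add_lt (p q : ℝ) (φ ψ : ℂ[X])
    (h : φ.natDegree + ψ.natDegree = 0 ∨ (φ.natDegree : ℝ) + ψ.natDegree < 2 * p - 2) :
    Integrable (integrand4 (cauchyV2 p q) φ ψ) := by
  rw [show integrand4 (cauchyV2 p q) φ ψ = _ from funext (integrand4_eq p q φ ψ)]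
  by_cases h0 : φ.natDegree + ψ.natDegree = 0
  · have h1 : φ.natDegree = 0 := by omega
    have h2 : ψ.natDegree = 0 := by omega
    rw [eq_C_of_natDegree_eq_zero h1, eq_C_of_natDegree_eq_zero h2]; simp
  · apply integrable_eval_mul_cw
    have h1 := natDegree_mul_derivative_sub_le φ ψ
    have h2 : ((φ * derivative ψ - derivative φ * ψ).natDegree : ℝ) + 1 ≤
        φ.natDegree + ψ.natDegree := by exact_mod_cast (by omega)
    have := h.resolve_left h0
    linarith

theorem natCast_add_lt_two_mul {a b : ℕ} {x : ℝ} (hab : a ≠ b) (ha : (a : ℝ) < x)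
    (hb : (b : ℝ) < x) : (a : ℝ) + b < 2 * x - 1 := by
  rcases hab.lt_or_gt with h | h
  · have : (a : ℝ) + 1 ≤ b := by exact_mod_cast h
    linarith
  · have : (b : ℝ) + 1 ≤ a := by exact_mod_cast h
    linarith

/-- Distinct degrees below p - 1/2 sum to less than 2p-2, which is what the Wronskian needs. For
equal degrees the naive bound fails by one, and the top terms have to cancel. -/
theorem integrable_integrand4 (p q : ℝ) {φ ψ : ℂ[X]}
    (hφ : (φ.natDegree : ℝ) < p - 1 / 2) (hψ : (ψ.natDegree : ℝ) < p - 1 / 2) :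
    Integrable (integrand4 (cauchyV2 p q) φ ψ) := by
  by_cases hd : φ.natDegree = ψ.natDegree
  · rcases Nat.eq_zero_or_pos φ.natDegree with h0 | h0
    · exact integrable_integrand4_of_add_lt p q _ _ (Or.inl (by omega))
    · have hφ0 : φ.leadingCoeff ≠ 0 := by
        rw [Ne, leadingCoeff_eq_zero]; rintro rfl; simp at h0
      -- Subtracting this multiple of φ lowers the degree and leaves the Wronskian with φ unchanged.
      set χ := ψ - C (ψ.leadingCoeff / φ.leadingCoeff) * φ with hχ
      have hχd : χ.natDegree < φ.natDegree := by
        refine lt_of_le_of_lt ?_ (Nat.sub_lt h0 one_pos)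
        rw [natDegree_le_iff_coeff_eq_zero]
        intro N hN
        rcases (show φ.natDegree ≤ N by omega).eq_or_lt with rfl | h1
        · rw [hχ, coeff_sub, coeff_C_mul, coeff_natDegree]
          rw [hd, coeff_natDegree]; field_simp; ring
        · rw [hχ, coeff_sub, coeff_C_mul, coeff_eq_zero_of_natDegree_lt h1,
            coeff_eq_zero_of_natDegree_lt (by omega)]; simp
      have h2 := integrable_integrand4_of_add_lt p q φ χ (Or.inr (by
        have h1 := natCast_add_lt_two_mul hχd.ne' hφ
          (lt_trans (Nat.cast_lt.2 hχd) hφ)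
        linarith))
      have h3 : φ * derivative χ - derivative φ * χ = φ * derivative ψ - derivative φ * ψ := by
        rw [hχ, derivative_sub, derivative_C_mul]; ring
      refine h2.congr (Filter.Eventually.of_forall fun z => ?_)
      simp only [integrand4_eq, h3]
  · have h1 := natCast_add_lt_two_mul hd hφ hψ
    exact integrable_integrand4_of_add_lt p q _ _ (Or.inr (by linarith))

/-- No integrability is needed: exchanging the variables preserves the measure, and the integral
commutes with negation even when it takes its default value 0. -/
theorem skew1_antisymm (V : ℝ → ℝ) (φ ψ : ℂ[X]) : skew1 V φ ψ = -skew1 V ψ φ := by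
  have h1 : ∫ t : ℝ × ℝ, integrand1 V φ ψ t = ∫ t : ℝ × ℝ, -integrand1 V ψ φ t := by
    rw [Measure.volume_eq_prod,
      ← integral_prod_swap (μ := volume) (ν := volume) (integrand1 V φ ψ)]
    refine integral_congr_ae (Filter.Eventually.of_forall fun t => ?_)
    simp only [integrand1, Prod.fst_swap, Prod.snd_swap]
    rw [← neg_sub t.2 t.1, Real.sign_neg, show -V t.2 - V t.1 = -V t.1 - V t.2 by ring]
    push_cast; ring
  rw [skew1, h1, integral_neg, skew1]; ring

theorem skew1_self (V : ℝ → ℝ) (φ : ℂ[X]) : skew1 V φ φ = 0 :=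
  self_eq_neg.1 (skew1_antisymm V φ φ)

theorem skew4_antisymm (V : ℝ → ℝ) (φ ψ : ℂ[X]) : skew4 V φ ψ = -skew4 V ψ φ := by
  have h1 : ∫ z : ℝ, integrand4 V φ ψ z = ∫ z : ℝ, -integrand4 V ψ φ z := by
    refine integral_congr_ae (Filter.Eventually.of_forall fun z => ?_)
    simp only [integrand4]; ring
  rw [skew4, h1, integral_neg, skew4]; ring

theorem skew4_self (V : ℝ → ℝ) (φ : ℂ[X]) : skew4 V φ φ = 0 :=
  self_eq_neg.1 (skew4_antisymm V φ φ)

theorem skew1_sum_right {ι : Type*} (V : ℝ → ℝ) (φ : ℂ[X]) (A : Finset ι) (b : ι → ℂ)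
    (ψ : ι → ℂ[X]) (h : ∀ i ∈ A, Integrable (integrand1 V φ (ψ i))) :
    skew1 V φ (∑ i ∈ A, C (b i) * ψ i) = ∑ i ∈ A, b i * skew1 V φ (ψ i) := by
  have h1 : ∫ t : ℝ × ℝ, integrand1 V φ (∑ i ∈ A, C (b i) * ψ i) t =
      ∫ t : ℝ × ℝ, ∑ i ∈ A, b i * integrand1 V φ (ψ i) t := by
    refine integral_congr_ae (Filter.Eventually.of_forall fun t => ?_)
    simp only [integrand1, eval_finsetSum, eval_mul, eval_C, Finset.mul_sum, Finset.sum_mul]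
    exact Finset.sum_congr rfl fun i _ => by ring
  rw [skew1, h1, integral_finsetSum _ fun i hi => (h i hi).const_mul _, Finset.mul_sum]
  refine Finset.sum_congr rfl fun i _ => ?_
  rw [integral_const_mul, skew1]; ring

theorem skew4_sum_right {ι : Type*} (V : ℝ → ℝ) (φ : ℂ[X]) (A : Finset ι) (b : ι → ℂ)
    (ψ : ι → ℂ[X]) (h : ∀ i ∈ A, Integrable (integrand4 V φ (ψ i))) :
    skew4 V φ (∑ i ∈ A, C (b i) * ψ i) = ∑ i ∈ A, b i * skew4 V φ (ψ i) := by
  have h1 : ∫ z : ℝ, integrand4 V φ (∑ i ∈ A, C (b i) * ψ i) z =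
      ∫ z : ℝ, ∑ i ∈ A, b i * integrand4 V φ (ψ i) z := by
    refine integral_congr_ae (Filter.Eventually.of_forall fun t => ?_)
    simp only [integrand4, derivative_sum, derivative_mul, derivative_C, zero_mul, zero_add,
      eval_finsetSum, eval_mul, eval_C, Finset.mul_sum, Finset.sum_mul, ← Finset.sum_sub_distrib]
    exact Finset.sum_congr rfl fun i _ => by ring
  rw [skew4, h1, integral_finsetSum _ fun i hi => (h i hi).const_mul _, Finset.mul_sum]
  refine Finset.sum_congr rfl fun i _ => ?_
  rw [integral_const_mul, skew4]; ring

theorem skewX_antisymm (X : ℝ) (V₁ V₂ : ℝ → ℝ) (φ ψ : ℂ[X]) :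
    skewX X V₁ V₂ φ ψ = -skewX X V₁ V₂ ψ φ := by
  rw [skewX, skew1_antisymm, skew4_antisymm, skewX]; ring

theorem skewX_sum_right {ι : Type*} (p q : ℝ) (X : ℝ) {φ : ℂ[X]} (A : Finset ι)
    (b : ι → ℂ) (ψ : ι → ℂ[X]) (hφ : (φ.natDegree : ℝ) < p - 1 / 2)
    (h : ∀ i ∈ A, ((ψ i).natDegree : ℝ) < p - 1 / 2) :
    skewX X (cauchyV1 p q) (cauchyV2 p q) φ (∑ i ∈ A, C (b i) * ψ i) =
      ∑ i ∈ A, b i * skewX X (cauchyV1 p q) (cauchyV2 p q) φ (ψ i) := by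
  rw [skewX, skew1_sum_right _ _ _ _ _ fun i hi => integrable_integrand1 p q (by linarith)
    (by linarith [h i hi]), skew4_sum_right _ _ _ _ _ fun i hi =>
      integrable_integrand4 p q hφ (h i hi), Finset.mul_sum, ← Finset.sum_add_distrib]
  exact Finset.sum_congr rfl fun i _ => by rw [skewX]; ring

theorem natDegree_sum_C_mul_lt {ι : Type*} {x : ℝ} (hx : 0 < x) (A : Finset ι) (b : ι → ℂ)
    (ψ : ι → ℂ[X]) (h : ∀ i ∈ A, ((ψ i).natDegree : ℝ) < x) :
    ((∑ i ∈ A, C (b i) * ψ i).natDegree : ℝ) < x := by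
  classical
  induction A using Finset.induction_on with
  | empty => simpa
  | insert i A hi ih =>
    rw [Finset.sum_insert hi]
    have h1 := ih fun j hj => h j (Finset.mem_insert_of_mem hj)
    have h2 := h i (Finset.mem_insert_self _ _)
    have h3 := natDegree_add_le (C (b i) * ψ i) (∑ i ∈ A, C (b i) * ψ i)
    have h4 := natDegree_C_mul_le (b i) (ψ i)
    rcases le_max_iff.1 h3 with h5 | h5
    · exact lt_of_le_of_lt (Nat.cast_le.2 (h5.trans h4)) h2
    · exact lt_of_le_of_lt (Nat.cast_le.2 h5) h1

theorem skewX_sum_sum {ι κ : Type*} (p q : ℝ) (hp : 1 / 2 < p) (X : ℝ) (A : Finset ι)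
    (B : Finset κ) (a : ι → ℂ) (b : κ → ℂ) (φ : ι → ℂ[X]) (ψ : κ → ℂ[X])
    (hφ : ∀ i ∈ A, ((φ i).natDegree : ℝ) < p - 1 / 2)
    (hψ : ∀ i ∈ B, ((ψ i).natDegree : ℝ) < p - 1 / 2) :
    skewX X (cauchyV1 p q) (cauchyV2 p q) (∑ i ∈ A, C (a i) * φ i) (∑ i ∈ B, C (b i) * ψ i) =
      ∑ i ∈ A, ∑ j ∈ B, a i * b j * skewX X (cauchyV1 p q) (cauchyV2 p q) (φ i) (ψ j) := by
  have hB := natDegree_sum_C_mul_lt (by linarith) B b ψ hψ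
  rw [skewX_antisymm, skewX_sum_right p q X A a φ hB hφ, ← Finset.sum_neg_distrib]
  refine Finset.sum_congr rfl fun i hi => ?_
  rw [← mul_neg, ← skewX_antisymm, skewX_sum_right p q X B b ψ (hφ i hi) hψ, Finset.mul_sum]
  exact Finset.sum_congr rfl fun j _ => by ring

/-! ### The operator N and its relation to the three products -/

/-- The operator `N ψ = (1 + z²) ψ' + (q + (1 - p) z) ψ`, characterised by
`(ψ e^{-V₂})' = (N ψ) e^{-V₁}`. -/
def cauchyN (p q : ℝ) (ψ : ℂ[X]) : ℂ[X] := weightDeriv ((p - 1) / 2) (q / 2) ψ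

theorem cauchyN_eq (p q : ℝ) (ψ : ℂ[X]) :
    cauchyN p q ψ = (1 + X ^ 2) * derivative ψ + (C (q : ℂ) - C (p - 1 : ℂ) * X) * ψ := by
  rw [cauchyN, weightDeriv]; push_cast; ring_nf

theorem natDegree_cauchyN_le (p q : ℝ) (ψ : ℂ[X]) :
    (cauchyN p q ψ).natDegree ≤ ψ.natDegree + 1 := natDegree_weightDeriv_le _ _ _

/-- The Leibniz rule for (φ e^{-V₂})(ψ e^{-V₂}): the parameters of N are half of those of the weight
w_{p-1,q} = e^{-2V₂}. -/
theorem mul_cauchyN_add (p q : ℝ) (φ ψ : ℂ[X]) :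
    φ * cauchyN p q ψ + cauchyN p q φ * ψ = weightDeriv (p - 1) q (φ * ψ) := by
  have hC : (C (2 : ℂ) : ℂ[X]) = 2 := rfl
  rw [cauchyN_eq, cauchyN_eq, weightDeriv, derivative_mul]
  push_cast
  simp only [C_mul, C_sub, C_1, hC]
  ring

theorem natDegree_mul_cauchyN_le (p q : ℝ) (φ ψ : ℂ[X]) :
    ((φ * cauchyN p q ψ).natDegree : ℝ) ≤ φ.natDegree + ψ.natDegree + 1 := by
  have h := (natDegree_mul_le (p := φ) (q := cauchyN p q ψ)).trans
    (Nat.add_le_add_left (natDegree_cauchyN_le p q ψ) _)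
  exact_mod_cast h

theorem cauchyL_weightDeriv {p : ℝ} (q : ℝ) {φ : ℂ[X]} (h : (φ.natDegree : ℝ) < 2 * p - 2) :
    cauchyL p q (weightDeriv (p - 1) q φ) = 0 := by
  have := integral_weightDeriv (p - 1) q φ (by linarith)
  rwa [sub_add_cancel] at this

theorem natDegree_mul_cast_le (φ ψ : ℂ[X]) :
    ((φ * ψ).natDegree : ℝ) ≤ φ.natDegree + ψ.natDegree := by
  exact_mod_cast natDegree_mul_le

/-- `N` is skew adjoint for the Cauchy weight. -/
theorem cauchyL_mul_cauchyN {p : ℝ} (q : ℝ) {φ ψ : ℂ[X]}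
    (h : (φ.natDegree : ℝ) + ψ.natDegree < 2 * p - 2) :
    cauchyL p q (φ * cauchyN p q ψ) = -cauchyL p q (ψ * cauchyN p q φ) := by
  have h1 := natDegree_mul_cauchyN_le p q φ ψ
  have h2 := natDegree_mul_cauchyN_le p q ψ φ
  rw [← add_eq_zero_iff_eq_neg, ← cauchyL_add (by linarith) (by linarith),
    mul_comm ψ, mul_cauchyN_add]
  exact cauchyL_weightDeriv q (lt_of_le_of_lt (natDegree_mul_cast_le _ _) h)

/-- In φ Nψ - ψ Nφ the zeroth-order terms cancel, leaving 1+z² times the Wronskian, and this factor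
turns w_p into w_{p-1}. Skew adjointness makes the two halves equal, which cancels the ½. -/
theorem skew4_eq_cauchyL {p : ℝ} (q : ℝ) {φ ψ : ℂ[X]}
    (h : (φ.natDegree : ℝ) + ψ.natDegree < 2 * p - 2) :
    skew4 (cauchyV2 p q) φ ψ = cauchyL p q (φ * cauchyN p q ψ) := by
  have h1 := natDegree_mul_cauchyN_le p q φ ψ
  have h2 := natDegree_mul_cauchyN_le p q ψ φ
  have h3 : ∫ z : ℝ, integrand4 (cauchyV2 p q) φ ψ z =
      cauchyL p q (φ * cauchyN p q ψ - ψ * cauchyN p q φ) := by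
    refine integral_congr_ae (Filter.Eventually.of_forall fun z => ?_)
    have hw := one_add_sq_mul_cw (p - 1) q z
    rw [sub_add_cancel] at hw
    simp only [integrand4_eq, ← hw, cauchyN_eq]
    simp
    ring
  rw [skew4, h3, cauchyL_sub (by linarith) (by linarith), cauchyL_mul_cauchyN q (φ := ψ)
    (by linarith)]
  ring

/-- The inner integral against the sign kernel undoes the derivative and returns -2ψ e^{-V₂};
multiplied by e^{-V₁} this carries the weight e^{-2V}. -/
theorem skew1_cauchyN {p : ℝ} (q : ℝ) {φ ψ : ℂ[X]} (hφ : (φ.natDegree : ℝ) < p)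
    (hψ : (ψ.natDegree : ℝ) + 1 < p) :
    skew1 (cauchyV1 p q) φ (cauchyN p q ψ) = -cauchyL p q (φ * ψ) := by
  have hN : ((cauchyN p q ψ).natDegree : ℝ) ≤ ψ.natDegree + 1 := by
    exact_mod_cast natDegree_cauchyN_le p q ψ
  have hi := integrable_integrand1 p q hφ (lt_of_le_of_lt hN hψ)
  rw [skew1, Measure.volume_eq_prod, integral_prod _ hi, cauchyL, ← integral_const_mul,
    ← integral_neg]
  refine integral_congr_ae (Filter.Eventually.of_forall fun y => ?_)
  have h1 (z : ℝ) : integrand1 (cauchyV1 p q) φ (cauchyN p q ψ) (y, z) =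
      (φ.eval (y : ℂ) * (cw ((p - 1) / 2 + 1) (q / 2) y : ℂ)) * (((Real.sign (z - y) : ℝ) : ℂ) *
        ((cauchyN p q ψ).eval (z : ℂ) * (cw ((p - 1) / 2 + 1) (q / 2) z : ℂ))) := by
    rw [integrand1_eq]; ring
  simp only [h1]
  rw [integral_const_mul, cauchyN, integral_sign_mul_weightDeriv _ _ _ (by linarith)]
  have hw := cw_mul_cw ((p - 1) / 2 + 1) (q / 2) ((p - 1) / 2) (q / 2) y
  rw [show (p - 1) / 2 + 1 + (p - 1) / 2 = p by ring, add_halves] at hw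
  rw [← hw, eval_mul]
  push_cast; ring

/-- Pairing of the `n`-th orthogonal polynomial with polynomials of degree at most `n`. -/
theorem cauchyL_routhRomanovski_mul {p : ℝ} (q : ℝ) {n : ℕ} {ψ : ℂ[X]} (hp : 1 / 2 < p)
    (h : (n : ℝ) + n < 2 * p - 1) (hψ : ψ.natDegree ≤ n) :
    cauchyL p q (routhRomanovski p q n * ψ) = ψ.coeff n * rrNorm p q n := by
  have hn : (n : ℝ) < p := by linarith
  have hψ' : (ψ.natDegree : ℝ) ≤ n := by exact_mod_cast hψ
  have hr := natDegree_routhRomanovski q hn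
  set R := ψ - C (ψ.coeff n) * routhRomanovski p q n with hR
  have hRd : R.degree < n := by
    rw [degree_lt_iff_coeff_zero]
    intro m hm
    rcases hm.eq_or_lt with rfl | hm
    · rw [hR, coeff_sub, coeff_C_mul, coeff_routhRomanovski q hn]; ring
    · rw [hR, coeff_sub, coeff_C_mul, coeff_eq_zero_of_natDegree_lt (hψ.trans_lt hm),
        coeff_eq_zero_of_natDegree_lt (hr.trans_lt hm)]; simp
  have hRn : (R.natDegree : ℝ) ≤ n := by exact_mod_cast natDegree_le_of_degree_le hRd.le
  have e1 : routhRomanovski p q n * ψ = routhRomanovski p q n * R +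
      C (ψ.coeff n) * (routhRomanovski p q n * routhRomanovski p q n) := by rw [hR]; ring
  have d1 := natDegree_mul_cast_le (routhRomanovski p q n) R
  have d2 : ((C (ψ.coeff n) * (routhRomanovski p q n * routhRomanovski p q n)).natDegree : ℝ) ≤
      n + n := by
    refine (Nat.cast_le.2 (natDegree_C_mul_le _ _)).trans
      ((natDegree_mul_cast_le _ _).trans ?_)
    rw [hr]
  rw [hr] at d1
  rw [e1, cauchyL_add (by linarith) (by linarith), cauchyL_C_mul,
    cauchyL_routhRomanovski_mul_eq_zero q hRd (by linarith),
    cauchyL_routhRomanovski_mul_self q hp hn h, zero_add]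

theorem cauchyL_routhRomanovski_mul_of_ne {p : ℝ} (q : ℝ) {n m : ℕ} (hnm : n ≠ m)
    (h : (n : ℝ) + m < 2 * p - 1) :
    cauchyL p q (routhRomanovski p q n * routhRomanovski p q m) = 0 := by
  have key (a b : ℕ) (hab : b < a) (h : (a : ℝ) + b < 2 * p - 1) :
      cauchyL p q (routhRomanovski p q a * routhRomanovski p q b) = 0 := by
    have hb := natDegree_routhRomanovski_le p q b
    refine cauchyL_routhRomanovski_mul_eq_zero q ?_ ?_
    · exact degree_le_natDegree.trans_lt (by exact_mod_cast hb.trans_lt hab)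
    · have : ((routhRomanovski p q b).natDegree : ℝ) ≤ b := by exact_mod_cast hb
      linarith
  rcases hnm.lt_or_gt with h1 | h1
  · rw [mul_comm]; exact key m n h1 (by linarith)
  · exact key n m h1 h

theorem rrNorm_ne_zero {p : ℝ} (q : ℝ) {n : ℕ} (h : (n : ℝ) + n < 2 * p - 1) :
    rrNorm p q n ≠ 0 := by
  have hn : (0 : ℝ) ≤ n := n.cast_nonneg
  have hpi : (Real.pi : ℂ) ≠ 0 := by exact_mod_cast Real.pi_ne_zero
  have g (z : ℂ) (hz : 0 < z.re) : Complex.Gamma z ≠ 0 := Complex.Gamma_ne_zero_of_re_pos hz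
  rw [rrNorm]
  refine div_ne_zero (mul_ne_zero (mul_ne_zero ?_ hpi) ?_) ?_
  · simp [Complex.cpow_eq_zero_iff]
  · refine mul_ne_zero (mul_ne_zero (g _ ?_) (g _ ?_)) (g _ ?_) <;> simp <;> linarith
  · refine mul_ne_zero (mul_ne_zero (g _ ?_) (g _ ?_)) (g _ ?_) <;> simp <;> linarith

theorem coeff_cauchyN {p : ℝ} (q : ℝ) {ψ : ℂ[X]} {n : ℕ} (hψ : ψ.natDegree ≤ n) :
    (cauchyN p q ψ).coeff (n + 1) = (n + 1 - p) * ψ.coeff n := by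
  have h0 : ψ.coeff (n + 1) = 0 := coeff_eq_zero_of_natDegree_lt (by omega)
  have h1 : ψ.coeff (n + 2) = 0 := coeff_eq_zero_of_natDegree_lt (by omega)
  have e : cauchyN p q ψ = derivative ψ + X ^ 2 * derivative ψ + C (q : ℂ) * ψ -
      C (p - 1 : ℂ) * (X * ψ) := by rw [cauchyN_eq]; ring
  have h2 : (X ^ 2 * derivative ψ).coeff (n + 1) = n * ψ.coeff n := by
    cases n with
    | zero => rw [coeff_X_pow_mul']; simp
    | succ n =>
      rw [show n + 1 + 1 = n + 2 by omega, coeff_X_pow_mul, coeff_derivative]; push_cast; ring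
  rw [e, coeff_sub, coeff_add, coeff_add, h2, coeff_derivative, h1, coeff_C_mul, h0, coeff_C_mul,
    coeff_X_mul]
  ring

/-- If R is nonzero of degree d, its pairing with p_d is its leading coefficient times h_d ≠ 0. -/
theorem eq_zero_of_cauchyL_routhRomanovski_mul {p : ℝ} (q : ℝ) {n : ℕ} (hp : 1 / 2 < p)
    (h : (n : ℝ) + n < 2 * p - 1) {R : ℂ[X]} (hR : R.natDegree ≤ n)
    (h0 : ∀ k ≤ n, cauchyL p q (routhRomanovski p q k * R) = 0) : R = 0 := by
  by_contra hne
  have h1 : ((R.natDegree : ℕ) : ℝ) ≤ n := by exact_mod_cast hR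
  have h2 := cauchyL_routhRomanovski_mul q hp (n := R.natDegree) (by linarith) le_rfl
  rw [h0 _ hR] at h2
  exact mul_ne_zero (by rwa [coeff_natDegree, Ne, leadingCoeff_eq_zero])
    (rrNorm_ne_zero q (by linarith)) h2.symm

/-- The action of `N` on the orthogonal polynomials. -/
theorem cauchyN_routhRomanovski {p : ℝ} (q : ℝ) {n : ℕ} (hn : (n : ℝ) + 1 < p) :
    cauchyN p q (routhRomanovski p q n) =
      C ((n : ℂ) + 1 - p) * routhRomanovski p q (n + 1) +
        C ((p - n) * rrNorm p q n * prevTerm (fun i => (rrNorm p q i)⁻¹) n) *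
          prevTerm (routhRomanovski p q) n := by
  have hn0 : (0 : ℝ) ≤ n := n.cast_nonneg
  have hp : 1 / 2 < p := by linarith
  have hn' : ((n + 1 : ℕ) : ℝ) < p := by push_cast; exact hn
  -- For n ≥ 1 skew adjointness gives ⟨p_{n-1}, N p_n⟩ = -⟨p_n, N p_{n-1}⟩ = (p-n) h_n; division by
  -- h_{n-1} gives the coefficient of p_{n-1}. For n = 0 the convention of `prevTerm` makes it zero.
  set κ := (p - n) * rrNorm p q n * prevTerm (fun i => (rrNorm p q i)⁻¹) n with hκ
  have dprev : (prevTerm (routhRomanovski p q) n).natDegree ≤ n := by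
    cases n with
    | zero => simp [prevTerm]
    | succ n => exact (natDegree_routhRomanovski_le p q n).trans (by omega)
  have dn := natDegree_routhRomanovski_le p q n
  have dn1 := natDegree_routhRomanovski_le p q (n + 1)
  have dN : (cauchyN p q (routhRomanovski p q n)).natDegree ≤ n + 1 :=
    (natDegree_cauchyN_le _ _ _).trans (by omega)
  set R := cauchyN p q (routhRomanovski p q n) - C ((n : ℂ) + 1 - p) * routhRomanovski p q (n + 1) -
    C κ * prevTerm (routhRomanovski p q) n with hR
  suffices R = 0 by rw [sub_sub] at hR; exact sub_eq_zero.1 (hR ▸ this)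
  refine eq_zero_of_cauchyL_routhRomanovski_mul q hp (n := n) (by linarith) ?_ ?_
  · rw [natDegree_le_iff_coeff_eq_zero]
    intro N hN
    have hκ0 : (C κ * prevTerm (routhRomanovski p q) n).coeff N = 0 := by
      rw [coeff_C_mul, coeff_eq_zero_of_natDegree_lt (by omega), mul_zero]
    rw [hR, coeff_sub, hκ0, sub_zero, coeff_sub, coeff_C_mul]
    rcases (show n + 1 ≤ N by omega).eq_or_lt with rfl | h1
    · rw [coeff_cauchyN q dn, coeff_routhRomanovski q hn',
        coeff_routhRomanovski q (show (n : ℝ) < p by linarith)]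
      ring
    · rw [coeff_eq_zero_of_natDegree_lt (by omega), coeff_eq_zero_of_natDegree_lt (by omega)]
      simp
  · intro k hk
    have hk' : (k : ℝ) ≤ n := by exact_mod_cast hk
    have dk := natDegree_routhRomanovski_le p q k
    have deg3 (a : ℂ) (ψ : ℂ[X]) (hψ : ψ.natDegree ≤ n + 1) :
        ((C a * (routhRomanovski p q k * ψ)).natDegree : ℝ) < 2 * p - 1 := by
      have h1 : ((C a * (routhRomanovski p q k * ψ)).natDegree : ℝ) ≤ (k + (n + 1) : ℕ) :=
        Nat.cast_le.2 ((natDegree_C_mul_le _ _).trans (natDegree_mul_le.trans (by omega)))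
      push_cast at h1; linarith
    have e1 : routhRomanovski p q k * R =
        C 1 * (routhRomanovski p q k * cauchyN p q (routhRomanovski p q n)) -
          C ((n : ℂ) + 1 - p) * (routhRomanovski p q k * routhRomanovski p q (n + 1)) -
          C κ * (routhRomanovski p q k * prevTerm (routhRomanovski p q) n) := by
      rw [hR, C_1]; ring
    rw [e1, cauchyL_sub _ (deg3 _ _ (by omega)), cauchyL_sub (deg3 _ _ dN) (deg3 _ _ dn1),
      cauchyL_C_mul, cauchyL_C_mul, cauchyL_C_mul,
      cauchyL_routhRomanovski_mul_of_ne q (show k ≠ n + 1 by omega) (by push_cast; linarith)]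
    · have hadj := cauchyL_mul_cauchyN q (φ := routhRomanovski p q k) (ψ := routhRomanovski p q n)
        (p := p) (by
          have h1 : ((routhRomanovski p q k).natDegree : ℝ) ≤ k := by exact_mod_cast dk
          have h2 : ((routhRomanovski p q n).natDegree : ℝ) ≤ n := by exact_mod_cast dn
          linarith)
      have dNk := natDegree_cauchyN_le p q (routhRomanovski p q k)
      rcases hk.eq_or_lt with rfl | hlt
      -- Diagonal entry: skew adjointness makes ⟨p_n, N p_n⟩ its own negative.
      · rw [self_eq_neg.1 hadj]
        cases k with
        | zero => simp [prevTerm, cauchyL]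
        | succ k =>
          simp only [prevTerm]
          rw [cauchyL_routhRomanovski_mul_of_ne q (by omega) (by push_cast at *; linarith)]
          ring
      -- Here N is moved to p_k, giving degree at most k+1, so only the index just below the top
      -- contributes.
      · obtain ⟨n, rfl⟩ : ∃ n', n = n' + 1 := ⟨n - 1, by omega⟩
        push_cast at hn
        simp only [prevTerm] at *
        rw [hadj, cauchyL_routhRomanovski_mul q hp (by push_cast; linarith) (by omega)]
        rcases (show k ≤ n by omega).eq_or_lt with rfl | hlt'
        · rw [coeff_cauchyN q dk, coeff_routhRomanovski q (by push_cast at hn'; linarith),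
            cauchyL_routhRomanovski_mul_self q hp (by linarith) (by linarith), hκ]
          have := rrNorm_ne_zero (p := p) q (n := k) (by linarith)
          field_simp
          push_cast
          ring
        · rw [coeff_eq_zero_of_natDegree_lt (by omega), cauchyL_routhRomanovski_mul_of_ne q
            (by omega) (by push_cast at *; linarith)]
          ring
    · have h4 := natDegree_sub_le (C 1 * (routhRomanovski p q k *
        cauchyN p q (routhRomanovski p q n)))
        (C ((n : ℂ) + 1 - p) * (routhRomanovski p q k * routhRomanovski p q (n + 1)))
      rcases le_max_iff.1 h4 with h5 | h5
      · exact (Nat.cast_le.2 h5).trans_lt (deg3 _ _ dN)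
      · exact (Nat.cast_le.2 h5).trans_lt (deg3 _ _ dn1)

/-! ### Relations among the constants -/

theorem two_cpow_add_one (x : ℂ) : (2 : ℂ) ^ (x + 1) = 2 * 2 ^ x := by
  rw [Complex.cpow_add _ _ two_ne_zero, Complex.cpow_one, mul_comm]

/-- This and the next two lemmas express all constants through the norms h_n: the factor p-j-1 is
minus the leading coefficient of N p_j. -/
theorem rrH4_eq {p : ℝ} (q : ℝ) {j : ℕ} (h : (j : ℝ) + 1 < p) :
    rrH4 p q j = (p - j - 1) * rrNorm p q (j + 1) := by
  have h1 : (2 * p - 2 * j - 2 : ℂ) ≠ 0 := fun h0 => by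
    have := congrArg Complex.re h0
    simp at this; linarith
  have h2 := Complex.Gamma_add_one _ h1
  rw [show (2 * p - 2 * j - 2 + 1 : ℂ) = 2 * p - 2 * j - 1 by ring] at h2
  rw [rrH4, rrNorm, h2, show (2 * ((j + 1 : ℕ) : ℂ) - 2 * p + 2) = (2 * j - 2 * p + 3) + 1 by
    push_cast; ring, two_cpow_add_one]
  push_cast
  rw [show (j + 1 + 1 : ℂ) = j + 2 by ring, show (2 * p - 2 * (j + 1) : ℂ) = 2 * p - 2 * j - 2 by ring,
    show (2 * p - 2 * j - 2 - 1 : ℂ) = 2 * p - 2 * j - 3 by ring,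
    show (2 * p - (j + 1) : ℂ) = 2 * p - j - 1 by ring,
    show (p - Complex.I * q - (j + 1) : ℂ) = p - 1 - Complex.I * q - j by ring,
    show (p + Complex.I * q - (j + 1) : ℂ) = p - 1 + Complex.I * q - j by ring]
  ring

theorem rrH1_mul {p : ℝ} (q : ℝ) {n : ℕ} (h : 2 * (n : ℝ) + 1 < p) :
    rrH1 p q n * (p - 2 * n - 1) = rrNorm p q (2 * n) := by
  have h1 : (2 * p - 4 * n - 2 : ℂ) ≠ 0 := fun h0 => by
    have := congrArg Complex.re h0
    simp at this; linarith
  have h2 := Complex.Gamma_add_one _ h1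
  rw [show (2 * p - 4 * n - 2 + 1 : ℂ) = 2 * p - 4 * n - 1 by ring] at h2
  rw [rrH1, rrNorm, show (4 * n - 2 * p + 3 : ℂ) = (4 * n - 2 * p + 2) + 1 by ring,
    two_cpow_add_one]
  push_cast
  rw [show (2 * (2 * n) - 2 * p + 2 : ℂ) = 4 * n - 2 * p + 2 by ring,
    show (2 * p - 2 * (2 * n) : ℂ) = 2 * p - 4 * n by ring, h2]
  ring

/-- Every Gamma factor moves by one or two steps of the functional equation; the two complex
conjugate ones combine into (p-n-1)² + q². -/
theorem rrNorm_succ {p : ℝ} (q : ℝ) {n : ℕ} (h : 2 * (n : ℝ) + 3 < 2 * p) :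
    (2 * p - 2 * n - 1) * (2 * p - 2 * n - 2) ^ 2 * (2 * p - 2 * n - 3) * rrNorm p q (n + 1) =
      4 * (n + 1) * (2 * p - n - 1) * ((p - n - 1) ^ 2 + q ^ 2) * rrNorm p q n := by
  have hn : (0 : ℝ) ≤ n := n.cast_nonneg
  have ne (z : ℂ) (hz : 0 < z.re) : z ≠ 0 := fun h0 => by rw [h0] at hz; simp at hz
  have a1 : (2 * p - 2 * n - 1 : ℂ) ≠ 0 := ne _ (by simp; linarith)
  have a2 : (2 * p - 2 * n - 2 : ℂ) ≠ 0 := ne _ (by simp; linarith)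
  have a3 : (2 * p - 2 * n - 3 : ℂ) ≠ 0 := ne _ (by simp; linarith)
  have a4 : (2 * p - n - 1 : ℂ) ≠ 0 := ne _ (by simp; linarith)
  have a5 : (p - Complex.I * q - n - 1 : ℂ) ≠ 0 := ne _ (by simp; linarith)
  have a6 : (p + Complex.I * q - n - 1 : ℂ) ≠ 0 := ne _ (by simp; linarith)
  have a7 : (n + 1 : ℂ) ≠ 0 := ne _ (by simp; linarith)
  have g1 := Complex.Gamma_add_one _ a1
  have g2 := Complex.Gamma_add_one _ a2
  have g3 := Complex.Gamma_add_one _ a3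
  have g4 := Complex.Gamma_add_one _ a4
  have g5 := Complex.Gamma_add_one _ a5
  have g6 := Complex.Gamma_add_one _ a6
  have g7 := Complex.Gamma_add_one _ a7
  rw [show (2 * p - 2 * n - 1 + 1 : ℂ) = 2 * p - 2 * n by ring] at g1
  rw [show (2 * p - 2 * n - 2 + 1 : ℂ) = 2 * p - 2 * n - 1 by ring] at g2
  rw [show (2 * p - 2 * n - 3 + 1 : ℂ) = 2 * p - 2 * n - 2 by ring] at g3
  rw [sub_add_cancel] at g4 g5 g6
  have m1 : Complex.Gamma (2 * p - n - 1) ≠ 0 :=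
    Complex.Gamma_ne_zero_of_re_pos (by simp; linarith)
  have m2 : Complex.Gamma (p - Complex.I * q - n - 1) ≠ 0 :=
    Complex.Gamma_ne_zero_of_re_pos (by simp; linarith)
  have m3 : Complex.Gamma (p + Complex.I * q - n - 1) ≠ 0 :=
    Complex.Gamma_ne_zero_of_re_pos (by simp; linarith)
  rw [rrNorm, rrNorm]
  push_cast
  rw [show (2 * (n + 1) - 2 * p + 2 : ℂ) = 2 * n - 2 * p + 2 + 1 + 1 by ring, two_cpow_add_one,
    two_cpow_add_one, show (2 * p - 2 * (n + 1) : ℂ) = 2 * p - 2 * n - 2 by ring,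
    show (2 * p - 2 * n - 2 - 1 : ℂ) = 2 * p - 2 * n - 3 by ring,
    show (2 * p - (n + 1) : ℂ) = 2 * p - n - 1 by ring,
    show (p - Complex.I * q - (n + 1) : ℂ) = p - Complex.I * q - n - 1 by ring,
    show (p + Complex.I * q - (n + 1) : ℂ) = p + Complex.I * q - n - 1 by ring,
    g7, g4, g5, g6, g1, g2, g3]
  have hI : ((p - n - 1) ^ 2 + q ^ 2 : ℂ) = (p - Complex.I * q - n - 1) *
      (p + Complex.I * q - n - 1) := by linear_combination (q : ℂ) ^ 2 * Complex.I_sq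
  rw [hI]
  generalize Complex.Gamma (2 * p - n - 1) = A at *
  generalize Complex.Gamma (p - Complex.I * q - n - 1) = B at *
  generalize Complex.Gamma (p + Complex.I * q - n - 1) = D at *
  generalize (p - Complex.I * q - n - 1 : ℂ) = b at *
  generalize (p + Complex.I * q - n - 1 : ℂ) = d at *
  generalize (2 * p - n - 1 : ℂ) = a at *
  field_simp
  ring

/-- Up to sign, ζ_{k+1} is the quotient of the two coefficients in the expansion of N p_{2k+2}. -/
theorem rrZeta_mul {p : ℝ} (q : ℝ) {k : ℕ} (h : 2 * (k : ℝ) + 3 < p) :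
    rrZeta p q (k + 1) * (p - 2 * k - 3) * rrNorm p q (2 * k + 1) =
      (p - 2 * k - 2) * rrNorm p q (2 * k + 2) := by
  have hk : (0 : ℝ) ≤ k := k.cast_nonneg
  have h1 := rrNorm_succ q (n := 2 * k + 1) (p := p) (by push_cast; linarith)
  have ne (z : ℂ) (hz : 0 < z.re) : z ≠ 0 := fun h0 => by rw [h0] at hz; simp at hz
  have a1 : (2 * p - 4 * (k + 1) - 2 : ℂ) ≠ 0 := ne _ (by simp; linarith)
  have a2 : (2 * p - 4 * (k + 1) - 1 : ℂ) ≠ 0 := ne _ (by simp; linarith)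
  have a3 : (2 * p - 4 * (k + 1) : ℂ) ≠ 0 := ne _ (by simp; linarith)
  have a4 : (2 * p - 4 * (k + 1) + 1 : ℂ) ≠ 0 := ne _ (by simp; linarith)
  have hI : (p - Complex.I * q - 2 * (k + 1)) * (p + Complex.I * q - 2 * (k + 1)) =
      ((p - 2 * k - 2) ^ 2 + q ^ 2 : ℂ) := by linear_combination (-(q : ℂ) ^ 2) * Complex.I_sq
  have hz : rrZeta p q (k + 1) * ((2 * p - 4 * (k + 1) - 2) * (2 * p - 4 * (k + 1) - 1) *
      (2 * p - 4 * (k + 1)) * (2 * p - 4 * (k + 1) + 1)) =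
      16 * (k + 1) * (p - (k + 1)) * ((p - 2 * k - 2) ^ 2 + q ^ 2) := by
    rw [rrZeta, ← hI]
    push_cast
    rw [div_mul_cancel₀ _ (mul_ne_zero (mul_ne_zero (mul_ne_zero a1 a2) a3) a4)]
    ring
  have hD : ((2 * p - 4 * (k + 1) - 1) * (2 * p - 4 * (k + 1)) * (2 * p - 4 * (k + 1) + 1) : ℂ) ≠ 0 :=
    mul_ne_zero (mul_ne_zero a2 a3) a4
  apply mul_left_cancel₀ hD
  push_cast at h1
  linear_combination (1 / 2) * rrNorm p q (2 * k + 1) * hz - (1 / 2) * h1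

/-- The reason for the odd combinations: normalising N p_{2n} to be monic produces exactly the
subtraction of ζ_n p_{2n-1}. -/
theorem rrOdd_eq {p : ℝ} (q : ℝ) {n : ℕ} (h : 2 * (n : ℝ) + 1 < p) :
    rrOdd p q n = C (-((p : ℂ) - 2 * n - 1)⁻¹) * cauchyN p q (routhRomanovski p q (2 * n)) := by
  have hn : (0 : ℝ) ≤ n := n.cast_nonneg
  have a1 : ((p : ℂ) - 2 * n - 1) ≠ 0 := fun h0 => by
    have := congrArg Complex.re h0
    simp at this; linarith
  rw [cauchyN_routhRomanovski q (by push_cast; linarith), mul_add, ← mul_assoc, ← mul_assoc,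
    ← C_mul, ← C_mul, rrOdd]
  have e1 : -((p : ℂ) - 2 * n - 1)⁻¹ * (((2 * n : ℕ) : ℂ) + 1 - p) = 1 := by
    push_cast; field_simp; ring
  rw [e1, C_1, one_mul]
  cases n with
  | zero => simp [prevTerm]
  | succ k =>
    push_cast at h a1
    have h1 := rrZeta_mul q (k := k) (p := p) (by linarith)
    have h2 := rrNorm_ne_zero q (n := 2 * k + 1) (p := p) (by push_cast; linarith)
    have e2 : -((p : ℂ) - 2 * ((k + 1 : ℕ) : ℂ) - 1)⁻¹ * ((p - ((2 * (k + 1) : ℕ) : ℂ)) *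
        rrNorm p q (2 * (k + 1)) * prevTerm (fun i => (rrNorm p q i)⁻¹) (2 * (k + 1))) =
        -rrZeta p q (k + 1) := by
      simp only [show 2 * (k + 1) = 2 * k + 1 + 1 by ring, prevTerm]
      push_cast
      field_simp
      rw [show 2 * k + 1 + 1 = 2 * k + 2 by ring]
      linear_combination h1
    rw [e2]
    simp only [show 2 * (k + 1) = 2 * k + 1 + 1 by ring, prevTerm]
    rw [C_neg]; ring

/-! ### The β = 1 and β = 4 relations -/

theorem natDegree_rrOdd_le (p q : ℝ) (n : ℕ) : (rrOdd p q n).natDegree ≤ 2 * n + 1 := by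
  rw [rrOdd]
  refine (natDegree_sub_le _ _).trans (max_le (natDegree_routhRomanovski_le _ _ _) ?_)
  refine (natDegree_C_mul_le _ _).trans ?_
  cases n with
  | zero => simp [prevTerm]
  | succ k => exact (natDegree_routhRomanovski_le _ _ _).trans (by omega)

theorem natDegree_rr_lt (p q : ℝ) {n : ℕ} {x : ℝ} (h : (n : ℝ) < x) :
    ((routhRomanovski p q n).natDegree : ℝ) < x :=
  (Nat.cast_le.2 (natDegree_routhRomanovski_le p q n)).trans_lt h

theorem natDegree_rrOdd_lt (p q : ℝ) {n : ℕ} {x : ℝ} (h : 2 * (n : ℝ) + 1 < x) :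
    ((rrOdd p q n).natDegree : ℝ) < x :=
  (Nat.cast_le.2 (natDegree_rrOdd_le p q n)).trans_lt (by push_cast; exact h)

theorem skew1_C_mul_right (V : ℝ → ℝ) (a : ℂ) (φ ψ : ℂ[X]) :
    skew1 V φ (C a * ψ) = a * skew1 V φ ψ := by
  have h1 : ∫ t : ℝ × ℝ, integrand1 V φ (C a * ψ) t = ∫ t : ℝ × ℝ, a * integrand1 V φ ψ t := by
    refine integral_congr_ae (Filter.Eventually.of_forall fun t => ?_)
    simp only [integrand1, eval_mul, eval_C]; ring
  rw [skew1, h1, integral_const_mul, skew1]; ring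

theorem skew1_add_right {V : ℝ → ℝ} {φ ψ χ : ℂ[X]} (h : Integrable (integrand1 V φ ψ))
    (h' : Integrable (integrand1 V φ χ)) :
    skew1 V φ (ψ + χ) = skew1 V φ ψ + skew1 V φ χ := by
  have h1 : ∫ t : ℝ × ℝ, integrand1 V φ (ψ + χ) t =
      ∫ t : ℝ × ℝ, integrand1 V φ ψ t + integrand1 V φ χ t := by
    refine integral_congr_ae (Filter.Eventually.of_forall fun t => ?_)
    simp only [integrand1, eval_add]; ring
  rw [skew1, h1, integral_add h h', skew1, skew1]; ring

/-- The odd polynomial is a multiple of N p_{2n}, so the pairing collapses to ⟨p_{2m}, p_{2n}⟩₂. -/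
theorem skew1_rr_rrOdd {p : ℝ} (q : ℝ) {m n : ℕ} (hp : 1 / 2 < p) (hm : 2 * (m : ℝ) < p)
    (hn : 2 * (n : ℝ) + 1 < p) :
    skew1 (cauchyV1 p q) (routhRomanovski p q (2 * m)) (rrOdd p q n) =
      if n = m then rrH1 p q n else 0 := by
  have a1 : ((p : ℂ) - 2 * n - 1) ≠ 0 := fun h0 => by
    have := congrArg Complex.re h0
    simp at this; linarith
  have hdn := natDegree_rr_lt p q (n := 2 * n) (x := p - 1) (by push_cast; linarith)
  rw [rrOdd_eq q hn, skew1_C_mul_right, skew1_cauchyN q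
    (natDegree_rr_lt p q (by push_cast; linarith)) (by linarith)]
  split_ifs with h
  · subst h
    rw [cauchyL_routhRomanovski_mul_self q hp (by push_cast; linarith) (by push_cast; linarith),
      ← rrH1_mul q hn]
    field_simp
  · rw [cauchyL_routhRomanovski_mul_of_ne q (by omega) (by push_cast; linarith)]; simp

/-- Induction on the gap r between the half-indices. N p_{2(m+r)+1} combines p_{2(m+r)+2} and
p_{2(m+r)}, and its pairing with p_{2m} is an inner product of polynomials of opposite parity of
index, hence zero. -/
theorem skew1_rr_even {p : ℝ} (q : ℝ) {m n : ℕ} (hm : 2 * (m : ℝ) < p) (hn : 2 * (n : ℝ) < p) :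
    skew1 (cauchyV1 p q) (routhRomanovski p q (2 * m)) (routhRomanovski p q (2 * n)) = 0 := by
  have key (r m : ℕ) (h : 2 * ((m : ℝ) + r) < p) :
      skew1 (cauchyV1 p q) (routhRomanovski p q (2 * m)) (routhRomanovski p q (2 * (m + r))) = 0 := by
    induction r with
    | zero => exact skew1_self _ _
    | succ r ih =>
      have hm0 : (0 : ℝ) ≤ m := m.cast_nonneg
      have hr0 : (0 : ℝ) ≤ r := r.cast_nonneg
      push_cast at h
      have h1 := ih (by linarith)
      have h2 := cauchyN_routhRomanovski q (n := 2 * (m + r) + 1) (p := p) (by push_cast; linarith)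
      have hd := natDegree_rr_lt p q (n := 2 * (m + r) + 1) (x := p - 1) (by push_cast; linarith)
      have h3 := skew1_cauchyN q (p := p) (φ := routhRomanovski p q (2 * m))
        (ψ := routhRomanovski p q (2 * (m + r) + 1))
        (natDegree_rr_lt p q (by push_cast; linarith))
        (by linarith)
      have i1 (a : ℂ) (k : ℕ) (hk : k ≤ 2 * (m + r) + 1 + 1) :
          Integrable (integrand1 (cauchyV1 p q) (routhRomanovski p q (2 * m))
            (C a * routhRomanovski p q k)) := by
        refine integrable_integrand1 p q (natDegree_rr_lt p q (by push_cast; linarith)) ?_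
        refine (Nat.cast_le.2 (natDegree_C_mul_le _ _)).trans_lt (natDegree_rr_lt p q ?_)
        have hk' : (k : ℝ) ≤ ((2 * (m + r) + 1 + 1 : ℕ) : ℝ) := Nat.cast_le.2 hk
        push_cast at hk'
        linarith
      rw [h2] at h3
      simp only [prevTerm] at h3
      rw [skew1_add_right (i1 _ _ (by omega)) (i1 _ _ (by omega)), skew1_C_mul_right,
        skew1_C_mul_right, h1,
        cauchyL_routhRomanovski_mul_of_ne q (by omega) (by push_cast; linarith), mul_zero, add_zero,
        neg_zero] at h3
      -- The coefficient of the new even polynomial is 2(m+r+1) - p, which is negative.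
      refine (mul_eq_zero.1 h3).resolve_left fun h0 => ?_
      have := congrArg Complex.re h0
      simp at this; linarith
  rcases le_total m n with h | h
  · obtain ⟨r, rfl⟩ := Nat.exists_eq_add_of_le h
    exact key r m (by push_cast at hn; exact hn)
  · obtain ⟨r, rfl⟩ := Nat.exists_eq_add_of_le h
    rw [skew1_antisymm, key r n (by push_cast at hm; exact hm), neg_zero]

theorem skew1_rrOdd {p : ℝ} (q : ℝ) {m n : ℕ} (hm : 2 * (m : ℝ) + 1 < p)
    (hn : 2 * (n : ℝ) + 1 < p) :
    skew1 (cauchyV1 p q) (rrOdd p q m) (rrOdd p q n) = 0 := by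
  have hm0 : (0 : ℝ) ≤ m := m.cast_nonneg
  have hn0 : (0 : ℝ) ≤ n := n.cast_nonneg
  have hdn := natDegree_rr_lt p q (n := 2 * n) (x := p - 1) (by push_cast; linarith)
  have d (a : ℂ) (k : ℕ) (hk : k ≤ 2 * m + 1) :
      ((C a * (routhRomanovski p q k * routhRomanovski p q (2 * n))).natDegree : ℝ) <
        2 * p - 1 := by
    have h1 : ((C a * (routhRomanovski p q k * routhRomanovski p q (2 * n))).natDegree : ℝ) ≤
        (2 * m + 1 + 2 * n : ℕ) :=
      Nat.cast_le.2 ((natDegree_C_mul_le _ _).trans (natDegree_mul_le.trans (add_le_add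
        ((natDegree_routhRomanovski_le _ _ _).trans hk) (natDegree_routhRomanovski_le _ _ _))))
    push_cast at h1; linarith
  rw [rrOdd_eq q hn, skew1_C_mul_right, skew1_cauchyN q (natDegree_rrOdd_lt p q hm) (by linarith)]
  have h0 : cauchyL p q (routhRomanovski p q (2 * m + 1) * routhRomanovski p q (2 * n)) = 0 :=
    cauchyL_routhRomanovski_mul_of_ne q (by omega) (by push_cast; linarith)
  have e1 : rrOdd p q m * routhRomanovski p q (2 * n) =
      C 1 * (routhRomanovski p q (2 * m + 1) * routhRomanovski p q (2 * n)) -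
      C (rrZeta p q m) * (prevTerm (fun i => routhRomanovski p q (2 * i + 1)) m *
        routhRomanovski p q (2 * n)) := by
    rw [rrOdd, C_1]; ring
  cases m with
  | zero =>
    simp only [prevTerm, zero_mul, mul_zero, sub_zero, zero_add] at e1 h0
    rw [e1, cauchyL_C_mul, h0]; simp
  | succ m =>
    simp only [prevTerm] at e1
    push_cast at hm
    rw [e1, cauchyL_sub (d _ _ (by omega)) (d _ _ (by omega)), cauchyL_C_mul, cauchyL_C_mul, h0,
      cauchyL_routhRomanovski_mul_of_ne q (by omega) (by push_cast; linarith)]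
    simp

/-- The pairing is ⟨p_m, N p_n⟩₂, and N raises the degree only by one. With antisymmetry, only
neighbouring indices can pair nontrivially. -/
theorem skew4_rr_of_lt {p : ℝ} (q : ℝ) {m n : ℕ} (hn : n + 1 < m) (hm : (m : ℝ) < p - 1 / 2) :
    skew4 (cauchyV2 p q) (routhRomanovski p q m) (routhRomanovski p q n) = 0 := by
  have hn' : (n : ℝ) + 2 ≤ m := by exact_mod_cast hn
  have dm := natDegree_routhRomanovski_le p q m
  have dn := natDegree_routhRomanovski_le p q n
  have dm' : ((routhRomanovski p q m).natDegree : ℝ) ≤ m := by exact_mod_cast dm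
  have dn' : ((routhRomanovski p q n).natDegree : ℝ) ≤ n := by exact_mod_cast dn
  have dN := natDegree_cauchyN_le p q (routhRomanovski p q n)
  rw [skew4_eq_cauchyL q (by linarith), cauchyL_routhRomanovski_mul_eq_zero q]
  · exact degree_le_natDegree.trans_lt (by exact_mod_cast (by omega))
  · have : ((cauchyN p q (routhRomanovski p q n)).natDegree : ℝ) ≤ n + 1 := by
      exact_mod_cast (by omega)
    linarith

/-- Antisymmetry first puts N on the polynomial of lower degree; then only the leading coefficient
of N p_n meets p_{n+1}. -/
theorem skew4_rr_succ {p : ℝ} (q : ℝ) {n : ℕ} (hn : (n : ℝ) + 1 < p - 1 / 2) :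
    skew4 (cauchyV2 p q) (routhRomanovski p q n) (routhRomanovski p q (n + 1)) = rrH4 p q n := by
  have hn0 : (0 : ℝ) ≤ n := n.cast_nonneg
  have dn := natDegree_routhRomanovski_le p q n
  have d1 := natDegree_rr_lt p q (n := n + 1) (x := p - 1 / 2) (by push_cast; linarith)
  have d2 := natDegree_rr_lt p q (n := n) (x := p - 3 / 2) (by linarith)
  have dN := natDegree_cauchyN_le p q (routhRomanovski p q n)
  rw [skew4_antisymm, skew4_eq_cauchyL q (by linarith),
    cauchyL_routhRomanovski_mul q (by linarith) (by push_cast; linarith) (by omega),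
    coeff_cauchyN q dn, coeff_routhRomanovski q (by linarith), rrH4_eq q (by linarith)]
  ring

theorem skew4_rr_even_odd {p : ℝ} (q : ℝ) {m n : ℕ} (hm : 2 * (m : ℝ) < p - 1 / 2)
    (hn : 2 * (n : ℝ) + 1 < p - 1 / 2) :
    skew4 (cauchyV2 p q) (routhRomanovski p q (2 * m)) (routhRomanovski p q (2 * n + 1)) =
      (if n = m then rrH4 p q (2 * n) else 0) - (if m = n + 1 then rrH4 p q (2 * n + 1) else 0) := by
  rcases lt_trichotomy m n with h | rfl | h
  · rw [if_neg (by omega), if_neg (by omega), skew4_antisymm,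
      skew4_rr_of_lt q (by omega) (by push_cast; linarith)]
    simp
  · rw [if_pos rfl, if_neg (by omega), skew4_rr_succ q (by push_cast; linarith), sub_zero]
  · rcases (show n + 1 ≤ m by omega).eq_or_lt with rfl | h1
    · push_cast at hm
      rw [if_neg (by omega), if_pos rfl, skew4_antisymm, show 2 * (n + 1) = 2 * n + 1 + 1 by ring,
        skew4_rr_succ q (by push_cast; linarith)]
      ring
    · rw [if_neg (by omega), if_neg (by omega),
        skew4_rr_of_lt q (by omega) (by push_cast; linarith)]
      simp

theorem skew4_rr_of_parity {p : ℝ} (q : ℝ) {m n : ℕ} (h : m % 2 = n % 2) (hm : (m : ℝ) < p - 1 / 2)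
    (hn : (n : ℝ) < p - 1 / 2) :
    skew4 (cauchyV2 p q) (routhRomanovski p q m) (routhRomanovski p q n) = 0 := by
  rcases lt_trichotomy m n with h | rfl | h
  · rw [skew4_antisymm, skew4_rr_of_lt q (by omega) hn, neg_zero]
  · exact skew4_self _ _
  · exact skew4_rr_of_lt q (by omega) hm

/-! ### The three-term recurrence of the Wilson polynomials -/

/-- The coefficients of the normalised Wilson polynomial of complex degree `x`, with
`S = a + b + c + d`, `e = a + b`, `f = a + c`, `g = a + d`. -/
def wilsonCoeff (S e f g x : ℂ) (k : ℕ) : ℂ :=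
  poch (-x) k * poch (x + S - 1) k / (poch e k * poch f k * poch g k * (k.factorial : ℂ))

theorem wilsonCoeff_zero (S e f g x : ℂ) : wilsonCoeff S e f g x 0 = 1 := by
  simp [wilsonCoeff, poch_zero]

theorem poch_neg_natCast_eq_zero {n k : ℕ} (h : n < k) : poch (-(n : ℂ)) k = 0 := by
  obtain ⟨r, rfl⟩ := Nat.exists_eq_add_of_lt h
  rw [show n + r + 1 = n + 1 + r by omega, poch_add, poch_succ]; simp

theorem wilsonCoeff_eq_zero (S e f g : ℂ) {n k : ℕ} (h : n < k) :
    wilsonCoeff S e f g n k = 0 := by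
  rw [wilsonCoeff, poch_neg_natCast_eq_zero h]; simp

/-- The coefficients vanish beyond the degree, so polynomials of three consecutive degrees can be
summed over one common range. -/
theorem wilson_eq_sum (n N : ℕ) (h : n < N) (y a b c d : ℂ) :
    wilson n y a b c d = ∑ k ∈ Finset.range N,
      wilsonCoeff (a + b + c + d) (a + b) (a + c) (a + d) n k *
        ∏ i ∈ Finset.range k, ((a + i) ^ 2 + y) := by
  rw [wilson]
  symm
  rw [← Finset.sum_subset (Finset.range_subset_range.2 (show n + 1 ≤ N by omega))]
  · refine Finset.sum_congr rfl fun k _ => ?_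
    rw [wilsonCoeff, show (n + (a + b + c + d) - 1 : ℂ) = n + a + b + c + d - 1 by ring]
    ring
  · intro k _ hk
    rw [wilsonCoeff_eq_zero _ _ _ _ (by simpa using hk), zero_mul]

/-- The recurrence read off at one basis product. The degree x is left complex so that x-1 still
makes sense when x = 0. -/
theorem wilsonCoeff_recurrence (S e f g x : ℂ) (k : ℕ) (h0 : 2 * x + S ≠ 0) (h1 : 2 * x + S - 1 ≠ 0)
    (h2 : 2 * x + S - 2 ≠ 0) (he : poch e (k + 1) ≠ 0) (hf : poch f (k + 1) ≠ 0)
    (hg : poch g (k + 1) ≠ 0) :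
    (x + S - 1) * (x + e) * (x + f) * (x + g) / ((2 * x + S - 1) * (2 * x + S)) *
        (wilsonCoeff S e f g (x + 1) (k + 1) - wilsonCoeff S e f g x (k + 1)) -
      x * (x + S - g - 1) * (x + S - f - 1) * (x + S - e - 1) / ((2 * x + S - 2) * (2 * x + S - 1)) *
        (wilsonCoeff S e f g x (k + 1) - wilsonCoeff S e f g (x - 1) (k + 1)) =
      -wilsonCoeff S e f g x k + (k + 1) * (e + f + g - S + k + 1) * wilsonCoeff S e f g x (k + 1) := by
  have hk : (k.factorial : ℂ) ≠ 0 := by exact_mod_cast k.factorial_ne_zero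
  have hk1 : (k + 1 : ℂ) ≠ 0 := by exact_mod_cast k.succ_ne_zero
  have b1 := poch_succ_left (x + S - 1) k
  have b2 := poch_succ (x + S - 1) k
  have b3 := poch_succ_left (-x) k
  have b4 := poch_succ (-x) k
  have b5 := poch_succ_left (-(x + 1)) k
  have b6 := poch_succ (x + S) k
  have b7 := poch_succ (-(x - 1)) k
  have b8 := poch_succ_left (x - 1 + S - 1) k
  rw [show x + S - 1 + 1 = x + S by ring] at b1
  rw [show -x + 1 = 1 - x by ring] at b3
  rw [show -(x + 1) + 1 = -x by ring] at b5
  rw [show -(x - 1) = 1 - x by ring] at b7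
  rw [show x - 1 + S - 1 + 1 = x + S - 1 by ring] at b8
  simp only [wilsonCoeff, show x + 1 + S - 1 = x + S by ring, show -(x - 1) = 1 - x by ring]
  rw [b5, b6, b7, b8]
  rw [b2] at b1
  rw [b4] at b3
  rw [poch_succ] at he hf hg
  rw [b2, b4, Nat.factorial_succ, poch_succ e, poch_succ f, poch_succ g]
  push_cast
  generalize poch (x + S) k = Q' at *
  generalize poch (1 - x) k = P' at *
  generalize poch (x + S - 1) k = Q at *
  generalize poch (-x) k = P at *
  generalize poch e k = E at *
  generalize poch f k = F at *
  generalize poch g k = G at *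
  generalize (k.factorial : ℂ) = K at *
  simp only [mul_ne_zero_iff] at he hf hg
  obtain ⟨he, he'⟩ := he
  obtain ⟨hf, hf'⟩ := hf
  obtain ⟨hg, hg'⟩ := hg
  -- The differences in x of (-x)_{k+1} (x+S-1)_{k+1} factor; `c1` supplies the factor 2x+S and `c2`
  -- the factor 2x+S-2 that cancel the denominators.
  have c1 : (x + S - 1) * (-(x + 1) * P * (Q' * (x + S + k)) - P * (-x + k) * (Q * (x + S - 1 + k))) =
      -(k + 1) * (2 * x + S) * P * Q * (x + S - 1 + k) := by
    linear_combination (x + 1) * (x + S + k) * P * b1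
  have c2 : x * (P * (-x + k) * (Q * (x + S - 1 + k)) - P' * (1 - x + k) * ((x - 1 + S - 1) * Q)) =
      -(k + 1) * (2 * x + S - 2) * P * Q * (x - k) := by
    linear_combination (-(1 - x + k) * (x + S - 2) * Q) * b3
  set D := E * (e + k) * (F * (f + k)) * (G * (g + k)) * ((k + 1) * K) with hD
  have hDne : D ≠ 0 := by simp only [hD, mul_ne_zero_iff]; tauto
  have c3 : P * Q / (E * F * G * K) = P * Q * (e + k) * (f + k) * (g + k) * (k + 1) / D := by
    rw [hD]; field_simp
  rw [c3]
  obtain ⟨v, hv⟩ : ∃ v, v = 2 * x + S - 1 := ⟨_, rfl⟩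
  obtain ⟨w, hw⟩ : ∃ w, w = 2 * x + S - 2 := ⟨_, rfl⟩
  obtain ⟨u, hu⟩ : ∃ u, u = 2 * x + S := ⟨_, rfl⟩
  rw [← hv] at h1 ⊢
  rw [← hw] at h2 c2 ⊢
  rw [← hu] at h0 c1 ⊢
  calc _ = (x + e) * (x + f) * (x + g) / (v * u * D) *
        ((x + S - 1) * (-(x + 1) * P * (Q' * (x + S + k)) -
          P * (-x + k) * (Q * (x + S - 1 + k)))) -
        (x + S - g - 1) * (x + S - f - 1) * (x + S - e - 1) / (w * v * D) *
        (x * (P * (-x + k) * (Q * (x + S - 1 + k)) -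
          P' * (1 - x + k) * ((x - 1 + S - 1) * Q))) := by
        field_simp
    _ = (x + e) * (x + f) * (x + g) / (v * D) *
        (-(k + 1) * P * Q * (x + S - 1 + k)) -
        (x + S - g - 1) * (x + S - f - 1) * (x + S - e - 1) / (v * D) *
        (-(k + 1) * P * Q * (x - k)) := by
        rw [c1, c2]; field_simp
    _ = _ := by field_simp; rw [hv]; ring

/-- The three-term recurrence of the Wilson polynomials. -/
theorem wilson_recurrence (n : ℕ) (y a b c d S : ℂ) (hS : S = a + b + c + d) (h0 : 2 * n + S ≠ 0)
    (h1 : 2 * n + S - 1 ≠ 0) (h2 : 2 * n + S - 2 ≠ 0) (he : poch (a + b) (n + 1) ≠ 0)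
    (hf : poch (a + c) (n + 1) ≠ 0) (hg : poch (a + d) (n + 1) ≠ 0) :
    (n + S - 1) * (n + a + b) * (n + a + c) * (n + a + d) / ((2 * n + S - 1) * (2 * n + S)) *
        (wilson (n + 1) y a b c d - wilson n y a b c d) -
      n * (n + b + c - 1) * (n + b + d - 1) * (n + c + d - 1) /
          ((2 * n + S - 2) * (2 * n + S - 1)) *
        (wilson n y a b c d - prevTerm (fun i => wilson i y a b c d) n) =
      -(a ^ 2 + y) * wilson n y a b c d := by
  set w := wilsonCoeff S (a + b) (a + c) (a + d) with hw
  set B : ℕ → ℂ := fun k => ∏ i ∈ Finset.range k, ((a + i) ^ 2 + y) with hB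
  have hsum (m : ℕ) (hm : m < n + 2) :
      wilson m y a b c d = ∑ k ∈ Finset.range (n + 2), w m k * B k := by
    rw [wilson_eq_sum m (n + 2) hm, hw, hS]
  have pne {x : ℂ} (hx : poch x (n + 1) ≠ 0) (k : ℕ) (hk : k ≤ n + 1) : poch x k ≠ 0 := by
    obtain ⟨r, hr⟩ := Nat.exists_eq_add_of_le hk
    rw [hr, poch_add] at hx
    exact left_ne_zero_of_mul hx
  -- The factor n erases the term at n = 0, so the coefficients of degree -1 may stand there in
  -- place of the conventional zero.
  have hprev : (n : ℂ) * (wilson n y a b c d - prevTerm (fun i => wilson i y a b c d) n) =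
      n * ∑ k ∈ Finset.range (n + 2), (w n k - w ((n : ℂ) - 1) k) * B k := by
    cases n with
    | zero => simp
    | succ n =>
      simp only [prevTerm]
      rw [hsum (n + 1) (by omega), hsum n (by omega), ← Finset.sum_sub_distrib]
      push_cast
      rw [add_sub_cancel_right]
      congr 1
      exact Finset.sum_congr rfl fun k _ => by ring
  have hBs (k : ℕ) : B (k + 1) = ((a + k) ^ 2 + y) * B k := by
    simp only [hB, Finset.prod_range_succ]; ring
  have htop : w n (n + 1) = 0 := wilsonCoeff_eq_zero _ _ _ _ (by omega)
  have key : ∑ k ∈ Finset.range (n + 2),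
      ((n + S - 1) * (n + (a + b)) * (n + (a + c)) * (n + (a + d)) /
          ((2 * n + S - 1) * (2 * n + S)) * (w (n + 1) k - w n k) -
        n * (n + S - (a + d) - 1) * (n + S - (a + c) - 1) * (n + S - (a + b) - 1) /
          ((2 * n + S - 2) * (2 * n + S - 1)) * (w n k - w ((n : ℂ) - 1) k)) * B k =
      -(a ^ 2 + y) * wilson n y a b c d := by
    rw [Finset.sum_range_succ']
    have hz : ∀ x, w x 0 = 1 := fun x => wilsonCoeff_zero _ _ _ _ _
    simp only [hz, sub_self, mul_zero, zero_mul, add_zero]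
    rw [hsum n (by omega), Finset.sum_range_succ _ (n + 1), htop, zero_mul, add_zero]
    -- A shift of the summation index without boundary terms: the factor k vanishes at the bottom
    -- and the coefficient `htop` at the top. It is needed because (a+k)² + y = (a² + y) + k(2a+k).
    have e1 : ∑ k ∈ Finset.range (n + 1), ((k : ℂ) + 1) * (2 * a + k + 1) * w n (k + 1) * B (k + 1) =
        ∑ k ∈ Finset.range (n + 1), (k : ℂ) * (2 * a + k) * w n k * B k := by
      have h3 := Finset.sum_range_succ' (fun k : ℕ => (k : ℂ) * (2 * a + k) * w n k * B k) (n + 1)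
      rw [Finset.sum_range_succ, htop] at h3
      simp only [mul_zero, zero_mul, add_zero, Nat.cast_zero] at h3
      rw [h3]
      refine Finset.sum_congr rfl fun k _ => ?_
      push_cast; ring
    calc _ = ∑ k ∈ Finset.range (n + 1), (-(w n k * B (k + 1)) +
          ((k : ℂ) + 1) * (2 * a + k + 1) * w n (k + 1) * B (k + 1)) := by
          refine Finset.sum_congr rfl fun k hk => ?_
          have hk' : k + 1 ≤ n + 1 := by have := Finset.mem_range.1 hk; omega
          have := wilsonCoeff_recurrence S (a + b) (a + c) (a + d) n k h0 h1 h2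
            (pne he _ hk') (pne hf _ hk') (pne hg _ hk')
          rw [hw, this, hS]; ring
      _ = ∑ k ∈ Finset.range (n + 1), (-(w n k * B (k + 1)) +
          (k : ℂ) * (2 * a + k) * w n k * B k) := by
          rw [Finset.sum_add_distrib, e1, ← Finset.sum_add_distrib]
      _ = _ := by
          rw [Finset.mul_sum]
          refine Finset.sum_congr rfl fun k _ => ?_
          rw [hBs]; ring
  rw [← key]
  have hdiff : wilson (n + 1) y a b c d - wilson n y a b c d =
      ∑ k ∈ Finset.range (n + 2), (w (n + 1) k - w n k) * B k := by
    rw [hsum (n + 1) (by omega), hsum n (by omega), ← Finset.sum_sub_distrib]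
    push_cast
    exact Finset.sum_congr rfl fun k _ => by ring
  have hC : n * (n + b + c - 1) * (n + b + d - 1) * (n + c + d - 1) /
      ((2 * n + S - 2) * (2 * n + S - 1)) *
      (wilson n y a b c d - prevTerm (fun i => wilson i y a b c d) n) =
      (n + b + c - 1) * (n + b + d - 1) * (n + c + d - 1) /
      ((2 * n + S - 2) * (2 * n + S - 1)) *
      (n * (wilson n y a b c d - prevTerm (fun i => wilson i y a b c d) n)) := by ring
  rw [hC, hprev, hdiff, Finset.mul_sum, Finset.mul_sum, Finset.mul_sum, ← Finset.sum_sub_distrib]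
  refine Finset.sum_congr rfl fun k _ => ?_
  rw [show (n : ℂ) + S - (a + d) - 1 = n + b + c - 1 by rw [hS]; ring,
    show (n : ℂ) + S - (a + c) - 1 = n + b + d - 1 by rw [hS]; ring,
    show (n : ℂ) + S - (a + b) - 1 = n + c + d - 1 by rw [hS]; ring]
  ring

/-! ### The Wilson solution of the recurrence for α -/

/-- The factor of `alphaCoeff` that does not depend on `X`. -/
def alphaFactor (p q : ℝ) (j : ℕ) : ℂ :=
  Complex.Gamma (2 * p - 1) / Complex.Gamma (-cauchyParam p q) *
    ((-1) ^ j * ((2 : ℂ) ^ (2 * j))⁻¹ *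
      (Complex.Gamma (-cauchyParam p q - 2 * j) /
        (Complex.Gamma (2 * j + 1) * Complex.Gamma (2 * p - 4 * j - 1))))

theorem alphaCoeff_eq (p q X : ℝ) (j : ℕ) :
    alphaCoeff p q X j = alphaFactor p q j * cauchyWilson p q X j := by
  rw [alphaCoeff, alphaFactor]; ring

theorem complex_ne_zero_of_re_pos {z : ℂ} (hz : 0 < z.re) : z ≠ 0 := fun h0 => by
  rw [h0] at hz; simp at hz

theorem alphaFactor_succ {p : ℝ} (q : ℝ) {j : ℕ} (h : 2 * (j : ℝ) + 2 < p - 1 / 2) :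
    alphaFactor p q (j + 1) *
        (4 * (2 * j + 1) * (2 * j + 2) * (p - q * Complex.I - 2 * j - 1) *
          (p - q * Complex.I - 2 * j - 2)) =
      -((2 * p - 4 * j - 2) * (2 * p - 4 * j - 3) * (2 * p - 4 * j - 4) * (2 * p - 4 * j - 5)) *
        alphaFactor p q j := by
  have hj : (0 : ℝ) ≤ j := j.cast_nonneg
  have a1 : (2 * p - 4 * j - 5 : ℂ) ≠ 0 := complex_ne_zero_of_re_pos (by simp; linarith)
  have a2 : (2 * p - 4 * j - 4 : ℂ) ≠ 0 := complex_ne_zero_of_re_pos (by simp; linarith)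
  have a3 : (2 * p - 4 * j - 3 : ℂ) ≠ 0 := complex_ne_zero_of_re_pos (by simp; linarith)
  have a4 : (2 * p - 4 * j - 2 : ℂ) ≠ 0 := complex_ne_zero_of_re_pos (by simp; linarith)
  have b1 : (2 * j + 1 : ℂ) ≠ 0 := complex_ne_zero_of_re_pos (by simp; linarith)
  have b2 : (2 * j + 2 : ℂ) ≠ 0 := complex_ne_zero_of_re_pos (by simp; linarith)
  have c1 : (p - q * Complex.I - 2 * j - 1 : ℂ) ≠ 0 :=
    complex_ne_zero_of_re_pos (by simp; linarith)
  have c2 : (p - q * Complex.I - 2 * j - 2 : ℂ) ≠ 0 :=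
    complex_ne_zero_of_re_pos (by simp; linarith)
  have g1 := Complex.Gamma_add_one _ a1
  have g2 := Complex.Gamma_add_one _ a2
  have g3 := Complex.Gamma_add_one _ a3
  have g4 := Complex.Gamma_add_one _ a4
  have g5 := Complex.Gamma_add_one _ b1
  have g6 := Complex.Gamma_add_one _ b2
  have g7 := Complex.Gamma_add_one _ c1
  have g8 := Complex.Gamma_add_one _ c2
  rw [show (2 * p - 4 * j - 5 + 1 : ℂ) = 2 * p - 4 * j - 4 by ring] at g1
  rw [show (2 * p - 4 * j - 4 + 1 : ℂ) = 2 * p - 4 * j - 3 by ring] at g2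
  rw [show (2 * p - 4 * j - 3 + 1 : ℂ) = 2 * p - 4 * j - 2 by ring] at g3
  rw [show (2 * p - 4 * j - 2 + 1 : ℂ) = 2 * p - 4 * j - 1 by ring] at g4
  rw [show (2 * j + 1 + 1 : ℂ) = 2 * j + 2 by ring] at g5
  rw [show (2 * j + 2 + 1 : ℂ) = 2 * j + 3 by ring] at g6
  rw [sub_add_cancel] at g7
  rw [show (p - q * Complex.I - 2 * j - 2 + 1 : ℂ) = p - q * Complex.I - 2 * j - 1 by ring] at g8
  have m1 : Complex.Gamma (2 * p - 4 * j - 5) ≠ 0 :=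
    Complex.Gamma_ne_zero_of_re_pos (by simp; linarith)
  have m2 : Complex.Gamma (2 * j + 1) ≠ 0 :=
    Complex.Gamma_ne_zero_of_re_pos (by simp; linarith)
  rw [alphaFactor, alphaFactor, cauchyParam]
  push_cast
  rw [show (-(-(p : ℂ) + q * Complex.I) - 2 * (j + 1)) = p - q * Complex.I - 2 * j - 2 by ring,
    show (-(-(p : ℂ) + q * Complex.I) - 2 * j) = p - q * Complex.I - 2 * j by ring,
    show (2 * (j + 1) + 1 : ℂ) = 2 * j + 3 by ring,
    show (2 * p - 4 * (j + 1) - 1 : ℂ) = 2 * p - 4 * j - 5 by ring,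
    g7, g8, g6, g5, g4, g3, g2, g1, show 2 * (j + 1) = 2 * j + 2 by ring, pow_add (2 : ℂ), pow_succ (-1 : ℂ) j]
  have e2 : (2 : ℂ) ^ (2 * j) ≠ 0 := pow_ne_zero _ two_ne_zero
  generalize Complex.Gamma (2 * p - 1) / Complex.Gamma (-(-(p : ℂ) + q * Complex.I)) = K at *
  generalize (2 : ℂ) ^ (2 * j) = E at *
  generalize Complex.Gamma (2 * p - 4 * j - 5) = A at *
  generalize Complex.Gamma (2 * j + 1) = B at *
  generalize Complex.Gamma (p - q * Complex.I - 2 * j - 2) = D at *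
  generalize (2 * p - 4 * j - 5 : ℂ) = x1 at *
  generalize (2 * p - 4 * j - 4 : ℂ) = x2 at *
  generalize (2 * p - 4 * j - 3 : ℂ) = x3 at *
  generalize (2 * p - 4 * j - 2 : ℂ) = x4 at *
  generalize (2 * j + 1 : ℂ) = y1 at *
  generalize (2 * j + 2 : ℂ) = y2 at *
  field_simp
  ring

/-- In the variables s = 2p-4j and v = 2iq every denominator is a shift of s. The nonvanishing
conditions hold because the relevant quantities have negative real part in this range of j. -/
theorem cauchyWilson_recurrence {p : ℝ} (q X : ℝ) {j : ℕ} (h : 2 * (j : ℝ) + 2 < p - 1 / 2)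
    {s v : ℂ} (hs : s = 2 * p - 4 * j) (hv : v = 2 * (q * Complex.I)) :
    (s + 2 * j - 1) * (s + 2 * j - 2) * (s + v - 4) * (s + v - 2) / 16 / ((s - 1) * (s - 3)) *
        (cauchyWilson p q X (j + 1) - cauchyWilson p q X j) -
      j * (2 * j - 1) * (s - v) * (s - v + 2) / 8 / ((s + 1) * (s - 1)) *
        (cauchyWilson p q X j - prevTerm (cauchyWilson p q X) j) =
      -((s + 4 * j + v - 2) ^ 2 / 16 + X ^ 2 / 4) * cauchyWilson p q X j := by
  have hj : (0 : ℝ) ≤ j := j.cast_nonneg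
  set a : ℂ := ((starRingEnd ℂ) (cauchyParam p q) + 1) / 2 with ha
  set b : ℂ := (cauchyParam p q + 1) / 2 with hb
  rw [conj_cauchyParam] at ha
  rw [cauchyParam] at hb
  have hP : (p : ℂ) = s / 2 + 2 * j := by rw [hs]; ring
  have hq : (q * Complex.I : ℂ) = v / 2 := by rw [hv]; ring
  have ne (z : ℂ) (hz : z.re < 0) : z ≠ 0 := fun h0 => by rw [h0] at hz; simp at hz
  have hi (i : ℕ) (hi : i < j + 1) : (i : ℝ) ≤ j := by exact_mod_cast Nat.lt_succ_iff.1 hi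
  have key := wilson_recurrence j ((X : ℂ) ^ 2 / 4) a b (1 / 2) 0 (3 / 2 - p)
    (by rw [ha, hb]; ring)
    (ne _ (by norm_num; linarith)) (ne _ (by norm_num; linarith)) (ne _ (by norm_num; linarith))
    (poch_ne_zero fun i hij => ne _ (by rw [ha, hb]; have := hi i hij; norm_num; linarith))
    (poch_ne_zero fun i hij => ne _ (by rw [ha]; have := hi i hij; norm_num; linarith))
    (poch_ne_zero fun i hij => ne _ (by rw [ha]; have := hi i hij; norm_num; linarith))
  have s1 : s - 1 ≠ 0 := complex_ne_zero_of_re_pos (by rw [hs]; simp; linarith)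
  have s3 : s - 3 ≠ 0 := complex_ne_zero_of_re_pos (by rw [hs]; simp; linarith)
  have s4 : s + 1 ≠ 0 := complex_ne_zero_of_re_pos (by rw [hs]; simp; linarith)
  have e1 : (j + (3 / 2 - p : ℂ) - 1) * (j + a + b) * (j + a + 1 / 2) * (j + a + 0) /
      ((2 * j + (3 / 2 - p) - 1) * (2 * j + (3 / 2 - p))) =
      (s + 2 * j - 1) * (s + 2 * j - 2) * (s + v - 4) * (s + v - 2) / 16 / ((s - 1) * (s - 3)) := by
    rw [ha, hb, hP, hq, show (2 * j + (3 / 2 - (s / 2 + 2 * j)) - 1 : ℂ) = -((s - 1) / 2) by ring,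
      show (2 * j + (3 / 2 - (s / 2 + 2 * j)) : ℂ) = -((s - 3) / 2) by ring]
    field_simp
    ring
  have e2 : j * (j + b + 1 / 2 - 1) * (j + b + 0 - 1) * (j + 1 / 2 + 0 - 1) /
      ((2 * j + (3 / 2 - p : ℂ) - 2) * (2 * j + (3 / 2 - p) - 1)) =
      j * (2 * j - 1) * (s - v) * (s - v + 2) / 8 / ((s + 1) * (s - 1)) := by
    rw [hb, hP, hq, show (2 * j + (3 / 2 - (s / 2 + 2 * j)) - 1 : ℂ) = -((s - 1) / 2) by ring,
      show (2 * j + (3 / 2 - (s / 2 + 2 * j)) - 2 : ℂ) = -((s + 1) / 2) by ring]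
    field_simp
    ring
  have e3 : a ^ 2 = (s + 4 * j + v - 2) ^ 2 / 16 := by rw [ha, hP, hq]; ring
  rw [e1, e2, e3] at key
  exact key

theorem rrZeta_zero (p q : ℝ) : rrZeta p q 0 = 0 := by simp [rrZeta]

/-- Writes the diagonal coefficient with h_{2j} and h_{2j+1} only; since ζ_0 = 0, no case j = 0
survives. -/
theorem rrMiddle_eq {p : ℝ} (q X : ℝ) {j : ℕ} (h : 2 * (j : ℝ) + 1 < p) :
    rrMiddle p q X j = X ^ 2 * (rrNorm p q (2 * j) / (p - 2 * j - 1)) +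
      (p - 2 * j - 1) * rrNorm p q (2 * j + 1) + rrZeta p q j * ((p - 2 * j) * rrNorm p q (2 * j)) := by
  have a1 : (p - 2 * j - 1 : ℂ) ≠ 0 := complex_ne_zero_of_re_pos (by simp; linarith)
  rw [rrMiddle, rrH4_eq q (by push_cast; linarith), ← rrH1_mul q h, mul_div_cancel_right₀ _ a1]
  push_cast
  congr 1
  cases j with
  | zero => simp [rrZeta_zero]
  | succ k =>
    push_cast at h
    simp only [prevTerm]
    rw [rrH1_mul q (by push_cast; linarith), rrH4_eq q (by push_cast; linarith)]
    push_cast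
    rw [show 2 * k + 1 + 1 = 2 * (k + 1) by ring]
    ring

/-- The relation defining ζ trades the norm h_{2j-1} for h_{2j}, so that the whole recurrence can be
divided by h_{2j}. -/
theorem rrZeta_mul_prevTerm {p : ℝ} (q : ℝ) {j : ℕ} (h : 2 * (j : ℝ) + 1 < p) (α : ℕ → ℂ) :
    rrZeta p q j * prevTerm (fun i => rrH4 p q (2 * i)) j * prevTerm α j =
      (p - 2 * j + 1) * (p - 2 * j) / (p - 2 * j - 1) * rrNorm p q (2 * j) * prevTerm α j := by
  cases j with
  | zero => simp [prevTerm]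
  | succ k =>
    push_cast at h
    simp only [prevTerm]
    have h1 := rrZeta_mul q (k := k) (p := p) (by linarith)
    have a1 : (p - 2 * k - 3 : ℂ) ≠ 0 := complex_ne_zero_of_re_pos (by simp; linarith)
    rw [rrH4_eq q (by push_cast; linarith)]
    push_cast
    rw [show (p - 2 * (k + 1) - 1 : ℂ) = p - 2 * k - 3 by ring, show 2 * (k + 1) = 2 * k + 2 by ring]
    field_simp
    linear_combination (p - 2 * k - 1) * α k * h1

theorem prevTerm_alphaCoeff {p : ℝ} (q X : ℝ) {j : ℕ} (h : 2 * (j : ℝ) < p - 1 / 2)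
    {s v : ℂ} (hs : s = 2 * p - 4 * j) (hv : v = 2 * (q * Complex.I)) :
    prevTerm (alphaCoeff p q X) j * ((s + 2) * (s + 1) * s * (s - 1)) =
      -((2 * j - 1) * (2 * j) * (s - v + 2) * (s - v)) * alphaFactor p q j *
        prevTerm (cauchyWilson p q X) j := by
  cases j with
  | zero => simp [prevTerm]
  | succ k =>
    push_cast at h
    have h1 := alphaFactor_succ q (j := k) (p := p) (by linarith)
    simp only [prevTerm]
    rw [alphaCoeff_eq, hs, hv]
    push_cast
    linear_combination cauchyWilson p q X k * h1

/-- All norms reduce to h_{2j} and all prefactors to the one at j; what remains is -8/(s-2) times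
the Wilson recurrence. -/
theorem alphaRecurrence_alphaCoeff {p : ℝ} (q X : ℝ) {j : ℕ} (h : 2 * (j : ℝ) + 2 < p - 1 / 2) :
    AlphaRecurrence p q X (alphaCoeff p q X) j := by
  have hj : (0 : ℝ) ≤ j := j.cast_nonneg
  obtain ⟨s, hs⟩ : ∃ s : ℂ, s = 2 * p - 4 * j := ⟨_, rfl⟩
  obtain ⟨v, hv⟩ : ∃ v : ℂ, v = 2 * (q * Complex.I) := ⟨_, rfl⟩
  have hP : (p : ℂ) = s / 2 + 2 * j := by rw [hs]; ring
  have hq : (q * Complex.I : ℂ) = v / 2 := by rw [hv]; ring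
  have hq2 : (q : ℂ) ^ 2 = -(v ^ 2 / 4) := by
    rw [hv]; linear_combination (q : ℂ) ^ 2 * Complex.I_sq
  have b1 : (2 * j + 1 : ℂ) ≠ 0 := complex_ne_zero_of_re_pos (by simp; linarith)
  have b2 : (j + 1 : ℂ) ≠ 0 := complex_ne_zero_of_re_pos (by simp; linarith)
  have s0 : s ≠ 0 := complex_ne_zero_of_re_pos (by rw [hs]; simp; linarith)
  have s1 : s - 1 ≠ 0 := complex_ne_zero_of_re_pos (by rw [hs]; simp; linarith)
  have s2 : s - 2 ≠ 0 := complex_ne_zero_of_re_pos (by rw [hs]; simp; linarith)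
  have s3 : s - 3 ≠ 0 := complex_ne_zero_of_re_pos (by rw [hs]; simp; linarith)
  have s4 : s - 4 ≠ 0 := complex_ne_zero_of_re_pos (by rw [hs]; simp; linarith)
  have s5 : s - 5 ≠ 0 := complex_ne_zero_of_re_pos (by rw [hs]; simp; linarith)
  have t1 : s + 1 ≠ 0 := complex_ne_zero_of_re_pos (by rw [hs]; simp; linarith)
  have t2 : s + 2 ≠ 0 := complex_ne_zero_of_re_pos (by rw [hs]; simp; linarith)
  have v2 : s - v - 2 ≠ 0 := complex_ne_zero_of_re_pos (by rw [hs, hv]; simp; linarith)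
  have v4 : s - v - 4 ≠ 0 := complex_ne_zero_of_re_pos (by rw [hs, hv]; simp; linarith)
  have hW := cauchyWilson_recurrence q X h hs hv
  have hprev := prevTerm_alphaCoeff q X (j := j) (p := p) (by linarith) hs hv
  have hκ := alphaFactor_succ q h
  have n1 := rrNorm_succ q (n := 2 * j) (p := p) (by push_cast; linarith)
  have n2 := rrNorm_succ q (n := 2 * j + 1) (p := p) (by push_cast; linarith)
  have hζ : rrZeta p q j = 2 * j * (s + 2 * j) * (s ^ 2 - v ^ 2) / ((s - 2) * (s - 1) * s * (s + 1)) := by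
    rw [rrZeta, hP, mul_comm Complex.I, hq,
      show (2 * (s / 2 + 2 * j) - 4 * j - 2 : ℂ) = s - 2 by ring,
      show (2 * (s / 2 + 2 * j) - 4 * j - 1 : ℂ) = s - 1 by ring,
      show (2 * (s / 2 + 2 * j) - 4 * j : ℂ) = s by ring]
    congr 1
    ring
  rw [AlphaRecurrence, rrMiddle_eq q X (by linarith), rrZeta_mul_prevTerm q (by linarith),
    rrH4_eq q (by push_cast; linarith), alphaCoeff_eq, alphaCoeff_eq, hζ]
  push_cast at n1 n2 ⊢
  rw [hP] at hκ n1 n2 ⊢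
  rw [hq] at hκ
  rw [hq2] at n1 n2
  rw [show (s / 2 + 2 * j - 2 * j - 1 : ℂ) = (s - 2) / 2 by ring,
    show (s / 2 + 2 * j - 2 * j : ℂ) = s / 2 by ring]
  have e1 : rrNorm p q (2 * j + 1) = (2 * j + 1) * (s + 2 * j - 1) * ((s - 2) ^ 2 - v ^ 2) /
      ((s - 1) * (s - 2) ^ 2 * (s - 3)) * rrNorm p q (2 * j) := by
    field_simp
    linear_combination n1
  have e2 : rrNorm p q (2 * j + 1 + 1) = (2 * j + 2) * (s + 2 * j - 2) * ((s - 4) ^ 2 - v ^ 2) /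
      ((s - 3) * (s - 4) ^ 2 * (s - 5)) * rrNorm p q (2 * j + 1) := by
    field_simp
    linear_combination n2
  have e3 : alphaFactor p q (j + 1) = -((s - 2) * (s - 3) * (s - 4) * (s - 5)) /
      ((2 * j + 1) * (2 * (j + 1)) * (s - v - 2) * (s - v - 4)) * alphaFactor p q j := by
    field_simp
    linear_combination hκ
  have e4 : prevTerm (alphaCoeff p q X) j = -((2 * j - 1) * (2 * j) * (s - v + 2) * (s - v)) /
      ((s + 2) * (s + 1) * s * (s - 1)) * alphaFactor p q j * prevTerm (cauchyWilson p q X) j := by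
    field_simp
    linear_combination hprev
  rw [e4, e3, e2, e1]
  generalize rrNorm p q (2 * j) = H
  generalize alphaFactor p q j = κ
  generalize cauchyWilson p q X (j + 1) = W1 at *
  generalize cauchyWilson p q X j = W0 at *
  generalize prevTerm (cauchyWilson p q X) j = Wm at *
  generalize (j : ℂ) = J at *
  -- `f1`, `f2` and `f3` match the coefficients of the Wilson polynomials of degree j+1, j and j-1,
  -- and `f4` matches the X² term. `f2` is the substantial one: the diagonal constant equals a²
  -- minus both Wilson coefficients, up to the common factor.
  have f1 : (s / 2 + 2 * J - (2 * J + 1) - 1) * ((2 * J + 2) * (s + 2 * J - 2) * ((s - 4) ^ 2 - v ^ 2) /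
      ((s - 3) * (s - 4) ^ 2 * (s - 5)) * ((2 * J + 1) * (s + 2 * J - 1) * ((s - 2) ^ 2 - v ^ 2) /
      ((s - 1) * (s - 2) ^ 2 * (s - 3)))) * (-((s - 2) * (s - 3) * (s - 4) * (s - 5)) /
      ((2 * J + 1) * (2 * (J + 1)) * (s - v - 2) * (s - v - 4))) =
      -8 / (s - 2) * ((s + 2 * J - 1) * (s + 2 * J - 2) * (s + v - 4) * (s + v - 2) / 16 /
        ((s - 1) * (s - 3))) := by
    field_simp
    ring
  have f2 : (s - 2) / 2 * ((2 * J + 1) * (s + 2 * J - 1) * ((s - 2) ^ 2 - v ^ 2) /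
      ((s - 1) * (s - 2) ^ 2 * (s - 3))) +
      2 * J * (s + 2 * J) * (s ^ 2 - v ^ 2) / ((s - 2) * (s - 1) * s * (s + 1)) * (s / 2) =
      8 / (s - 2) * ((s + 4 * J + v - 2) ^ 2 / 16 -
        (s + 2 * J - 1) * (s + 2 * J - 2) * (s + v - 4) * (s + v - 2) / 16 / ((s - 1) * (s - 3)) -
        J * (2 * J - 1) * (s - v) * (s - v + 2) / 8 / ((s + 1) * (s - 1))) := by
    field_simp
    ring
  have f3 : (s / 2 + 1) * (s / 2) / ((s - 2) / 2) *
      (-((2 * J - 1) * (2 * J) * (s - v + 2) * (s - v)) / ((s + 2) * (s + 1) * s * (s - 1))) =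
      -8 / (s - 2) * (J * (2 * J - 1) * (s - v) * (s - v + 2) / 8 / ((s + 1) * (s - 1))) := by
    field_simp
  have f4 : H / ((s - 2) / 2) = 2 / (s - 2) * H := by field_simp
  rw [f4]
  linear_combination H * κ * W1 * f1 - H * κ * W0 * f2 + H * κ * Wm * f3 - 8 / (s - 2) * H * κ * hW

/-! ### Positivity, nonvanishing and uniqueness of α and ξ -/

-- In the complex order 0 < z includes that z is real. Starting from the positive mass h_0 and
-- multiplying by positive real quotients gives both facts without discussing the conjugate Gamma
-- factors.
open scoped ComplexOrder in
theorem rrNorm_pos {p : ℝ} (q : ℝ) {n : ℕ} (h : (n : ℝ) < p - 1 / 2) : 0 < rrNorm p q n := by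
  have hn0 : (0 : ℝ) ≤ n := n.cast_nonneg
  have hp : 1 / 2 < p := by linarith
  induction n with
  | zero =>
    have h1 := cauchyL_routhRomanovski_mul_self q (n := 0) hp (by push_cast; linarith)
      (by push_cast; linarith)
    have h2 : routhRomanovski p q 0 = 1 := by
      have hp0 : ((0 : ℕ) : ℝ) < p := by push_cast; linarith
      exact (monic_routhRomanovski q hp0).natDegree_eq_zero.1 (natDegree_routhRomanovski q hp0)
    rw [h2, mul_one, cauchyL_one] at h1
    rw [← h1]
    exact_mod_cast cauchyMass_pos q hp
  | succ n ih =>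
    push_cast at h
    have hn : (0 : ℝ) ≤ n := n.cast_nonneg
    have h1 := rrNorm_succ q (n := n) (p := p) (by linarith)
    have hD : 0 < (2 * p - 2 * n - 1) * (2 * p - 2 * n - 2) ^ 2 * (2 * p - 2 * n - 3) :=
      mul_pos (mul_pos (by linarith) (pow_pos (by linarith) 2)) (by linarith)
    have hN : 0 < 4 * (n + 1) * (2 * p - n - 1) * ((p - n - 1) ^ 2 + q ^ 2) := by
      have : 0 < 2 * p - n - 1 := by linarith
      have : 0 < p - n - 1 := by linarith
      positivity
    have h2 : rrNorm p q (n + 1) = ((4 * (n + 1) * (2 * p - n - 1) * ((p - n - 1) ^ 2 + q ^ 2) /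
        ((2 * p - 2 * n - 1) * (2 * p - 2 * n - 2) ^ 2 * (2 * p - 2 * n - 3)) : ℝ) : ℂ) *
        rrNorm p q n := by
      have hD' : (((2 * p - 2 * n - 1) * (2 * p - 2 * n - 2) ^ 2 * (2 * p - 2 * n - 3) : ℝ) : ℂ) ≠ 0 :=
        by exact_mod_cast hD.ne'
      rw [Complex.ofReal_div, div_mul_eq_mul_div, eq_div_iff hD']
      push_cast
      linear_combination h1
    rw [h2]
    exact mul_pos (by exact_mod_cast div_pos hN hD) (ih (by linarith) hn)

open scoped ComplexOrder in
theorem rrH4_pos {p : ℝ} (q : ℝ) {j : ℕ} (h : (j : ℝ) + 1 < p - 1 / 2) : 0 < rrH4 p q j := by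
  rw [rrH4_eq q (by linarith)]
  refine mul_pos ?_ (rrNorm_pos q (by push_cast; linarith))
  have : 0 < p - j - 1 := by linarith
  exact_mod_cast this

open scoped ComplexOrder in
theorem rrH1_pos {p : ℝ} (q : ℝ) {n : ℕ} (h : 2 * (n : ℝ) + 1 < p) : 0 < rrH1 p q n := by
  have h0 : 0 < p - 2 * n - 1 := by linarith
  have h1 := rrH1_mul q h
  have h2 : rrH1 p q n = (((p - 2 * n - 1)⁻¹ : ℝ) : ℂ) * rrNorm p q (2 * n) := by
    have h3 : (p - 2 * n - 1 : ℂ) ≠ 0 := by exact_mod_cast h0.ne'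
    rw [← h1]; push_cast; field_simp
  rw [h2]
  exact mul_pos (by exact_mod_cast inv_pos.2 h0) (rrNorm_pos q (by push_cast; linarith))

open scoped ComplexOrder in
theorem rrZeta_nonneg {p : ℝ} (q : ℝ) {n : ℕ} (h : 2 * (n : ℝ) + 1 < p) : 0 ≤ rrZeta p q n := by
  have hn : (0 : ℝ) ≤ n := n.cast_nonneg
  have h1 : rrZeta p q n = ((16 * n * (p - n) * ((p - 2 * n) ^ 2 + q ^ 2) /
      ((2 * p - 4 * n - 2) * (2 * p - 4 * n - 1) * (2 * p - 4 * n) * (2 * p - 4 * n + 1)) : ℝ) : ℂ) := by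
    rw [rrZeta]; push_cast
    congr 1
    linear_combination (-(16 * (n : ℂ) * (p - n) * q ^ 2)) * Complex.I_sq
  have a0 : 0 < p - n := by linarith
  have a1 : 0 < 2 * p - 4 * n - 2 := by linarith
  have a2 : 0 < 2 * p - 4 * n - 1 := by linarith
  have a3 : 0 < 2 * p - 4 * n := by linarith
  have a4 : 0 < 2 * p - 4 * n + 1 := by linarith
  rw [h1]
  exact Complex.zero_le_real.2 (by positivity)

open scoped ComplexOrder in
theorem rrH4_ne_zero {p : ℝ} (q : ℝ) {j : ℕ} (h : (j : ℝ) + 1 < p - 1 / 2) : rrH4 p q j ≠ 0 :=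
  (rrH4_pos q h).ne'

theorem alphaCoeff_zero {p : ℝ} (q X : ℝ) (hp : 1 / 2 < p) : alphaCoeff p q X 0 = 1 := by
  have g1 : Complex.Gamma (2 * p - 1) ≠ 0 :=
    Complex.Gamma_ne_zero_of_re_pos (by simp; linarith)
  have g2 : Complex.Gamma (-cauchyParam p q) ≠ 0 :=
    Complex.Gamma_ne_zero_of_re_pos (by simp [cauchyParam]; linarith)
  rw [alphaCoeff, cauchyWilson, wilson]
  simp [poch_zero]
  field_simp

theorem alphaRecurrence_iff (p q X : ℝ) (α : ℕ → ℂ) (j : ℕ) :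
    AlphaRecurrence p q X α j ↔ rrH4 p q (2 * j + 1) * α (j + 1) =
      (X : ℂ) ^ 2 * rrH1 p q j * α j + rrH4 p q (2 * j) * α j +
        rrZeta p q j * (prevTerm (fun i => rrH4 p q (2 * i + 1)) j * α j -
          prevTerm (fun i => rrH4 p q (2 * i)) j * prevTerm α j) := by
  rw [AlphaRecurrence, rrMiddle, ← sub_eq_zero (b := _ + _)]
  ring_nf

-- The induction carries D_j = h⁽⁴⁾_{2j-1} α_j - h⁽⁴⁾_{2j-2} α_{j-1} ≥ 0 along with α_j > 0. The
-- regrouped recurrence gives D_{j+1} = X² h⁽¹⁾_j α_j + ζ_j D_j, and h⁽⁴⁾_{2j+1} α_{j+1} exceeds it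
-- by the positive amount h⁽⁴⁾_{2j} α_j.
open scoped ComplexOrder in
theorem alphaCoeff_pos_and {p : ℝ} (q X : ℝ) {j : ℕ} (h : 2 * (j : ℝ) < p - 1 / 2) :
    0 < alphaCoeff p q X j ∧
      0 ≤ prevTerm (fun i => rrH4 p q (2 * i + 1)) j * alphaCoeff p q X j -
        prevTerm (fun i => rrH4 p q (2 * i)) j * prevTerm (alphaCoeff p q X) j := by
  have hX : (0 : ℂ) ≤ (X : ℂ) ^ 2 := by exact_mod_cast sq_nonneg X
  induction j with
  | zero => simp [prevTerm, alphaCoeff_zero q X (p := p) (by push_cast at h; linarith)]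
  | succ j ih =>
    push_cast at h
    have hj : (0 : ℝ) ≤ j := j.cast_nonneg
    obtain ⟨h1, h2⟩ := ih (by linarith)
    have h3 := (alphaRecurrence_iff _ _ _ _ _).1
      (alphaRecurrence_alphaCoeff q X (j := j) (p := p) (by linarith))
    have p1 := rrH1_pos q (n := j) (p := p) (by linarith)
    have p2 := rrH4_pos q (j := 2 * j) (p := p) (by push_cast; linarith)
    have p3 := rrH4_pos q (j := 2 * j + 1) (p := p) (by push_cast; linarith)
    have p4 := rrZeta_nonneg q (n := j) (p := p) (by linarith)
    have q1 : 0 ≤ (X : ℂ) ^ 2 * rrH1 p q j * alphaCoeff p q X j :=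
      mul_nonneg (mul_nonneg hX p1.le) h1.le
    have q2 := mul_nonneg p4 h2
    have q3 := mul_pos p2 h1
    simp only [prevTerm]
    constructor
    · have h4 : 0 < rrH4 p q (2 * j + 1) * alphaCoeff p q X (j + 1) := by
        rw [h3]
        exact add_pos_of_pos_of_nonneg (add_pos_of_nonneg_of_pos q1 q3) q2
      have h5 := mul_pos (RCLike.inv_pos_of_pos p3) h4
      rwa [← mul_assoc, inv_mul_cancel₀ p3.ne', one_mul] at h5
    · rw [h3]
      have := add_nonneg q1 q2
      convert this using 1
      ring

open scoped ComplexOrder in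
theorem alphaCoeff_ne_zero {p : ℝ} (q X : ℝ) {j : ℕ} (h : 2 * (j : ℝ) < p - 1 / 2) :
    alphaCoeff p q X j ≠ 0 := (alphaCoeff_pos_and q X h).1.ne'

-- This is the value that the recurrence would assign to h⁽⁴⁾_{2j+1} α_{j+1}, positive even when the
-- next even degree is out of range. It is the diagonal entry left over in the final pairing.
open scoped ComplexOrder in
theorem rrMiddle_mul_sub_ne_zero {p : ℝ} (q X : ℝ) {j : ℕ} (h : 2 * (j : ℝ) + 1 < p - 1 / 2) :
    rrMiddle p q X j * alphaCoeff p q X j -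
      rrZeta p q j * prevTerm (fun i => rrH4 p q (2 * i)) j * prevTerm (alphaCoeff p q X) j ≠ 0 := by
  have hX : (0 : ℂ) ≤ (X : ℂ) ^ 2 := by exact_mod_cast sq_nonneg X
  obtain ⟨h1, h2⟩ := alphaCoeff_pos_and q X (j := j) (p := p) (by linarith)
  have p1 := rrH1_pos q (n := j) (p := p) (by linarith)
  have p2 := rrH4_pos q (j := 2 * j) (p := p) (by push_cast; linarith)
  have p4 := rrZeta_nonneg q (n := j) (p := p) (by linarith)
  have q3 := add_pos_of_pos_of_nonneg (add_pos_of_nonneg_of_pos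
    (mul_nonneg (mul_nonneg hX p1.le) h1.le) (mul_pos p2 h1)) (mul_nonneg p4 h2)
  convert q3.ne' using 1
  rw [rrMiddle]; ring

theorem xiCoeff_ne_zero {p : ℝ} (q X : ℝ) {j : ℕ} (h : 2 * (j : ℝ) + 1 < p) :
    xiCoeff p q X j ≠ 0 := by
  have hj : (0 : ℝ) ≤ j := j.cast_nonneg
  refine mul_ne_zero (div_ne_zero ?_ ?_) (alphaCoeff_ne_zero q X (by linarith)) <;>
  exact complex_ne_zero_of_re_pos (by simp; linarith)

theorem xiCoeff_zero {p : ℝ} (q X : ℝ) (hp : 1 < p) : xiCoeff p q X 0 = 1 := by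
  have : (2 * p - 2 : ℂ) ≠ 0 := complex_ne_zero_of_re_pos (by simp; linarith)
  rw [xiCoeff, alphaCoeff_zero q X (by linarith)]
  simp [this]

/-- With ξ_j = (p-2j-1)/(p-1) · α_j and the relation between ζ_{j+1} and the norms, this is the
recurrence for α multiplied by (p-2j-1)/(p-1). -/
theorem xiRecurrence_xiCoeff {p : ℝ} (q X : ℝ) {j : ℕ} (h : 2 * (j : ℝ) + 3 < p) :
    XiRecurrence p q X (xiCoeff p q X) j := by
  have hj : (0 : ℝ) ≤ j := j.cast_nonneg
  have h1 := alphaRecurrence_alphaCoeff q X (j := j) (p := p) (by linarith)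
  rw [AlphaRecurrence, rrZeta_mul_prevTerm q (by linarith), rrH4_eq q (by push_cast; linarith)] at h1
  have h2 := rrZeta_mul q h
  have a1 : (p - 1 : ℂ) ≠ 0 := complex_ne_zero_of_re_pos (by simp; linarith)
  have a2 : (p - 2 * j - 1 : ℂ) ≠ 0 := complex_ne_zero_of_re_pos (by simp; linarith)
  have e1 : xiCoeff p q X (j + 1) = (p - 2 * j - 3) / (p - 1) * alphaCoeff p q X (j + 1) := by
    rw [xiCoeff, show (2 * p - 2 : ℂ) = 2 * (p - 1) by ring]; push_cast; field_simp; ring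
  have e2 : xiCoeff p q X j = (p - 2 * j - 1) / (p - 1) * alphaCoeff p q X j := by
    rw [xiCoeff, show (2 * p - 2 : ℂ) = 2 * (p - 1) by ring]; field_simp; ring
  have e3 : prevTerm (fun i => rrH4 p q (2 * i + 1)) j * prevTerm (xiCoeff p q X) j =
      (p - 2 * j) * (p - 2 * j + 1) / (p - 1) * rrNorm p q (2 * j) * prevTerm (alphaCoeff p q X) j := by
    cases j with
    | zero => simp [prevTerm]
    | succ k =>
      push_cast at h
      simp only [prevTerm]
      rw [rrH4_eq q (by push_cast; linarith), xiCoeff, show (2 * p - 2 : ℂ) = 2 * (p - 1) by ring]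
      push_cast
      rw [show 2 * k + 1 + 1 = 2 * (k + 1) by ring]
      field_simp
      ring
  rw [XiRecurrence, e3, e1, e2, rrH4_eq q (by push_cast; linarith)]
  push_cast at h1 ⊢
  have e4 : (p - 2 * j + 1) * (p - 2 * j) / (p - 2 * j - 1) * rrNorm p q (2 * j) *
      prevTerm (alphaCoeff p q X) j * (p - 2 * j - 1) =
      (p - 2 * j + 1) * (p - 2 * j) * rrNorm p q (2 * j) * prevTerm (alphaCoeff p q X) j := by
    field_simp
  rw [show 2 * j + 1 + 1 = 2 * j + 2 by ring] at h1
  have h3 := congrArg (fun x => x * ((p - 2 * j - 1 : ℂ) / (p - 1))) h1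
  simp only [zero_mul] at h3
  rw [← h3]
  linear_combination (p - 2 * j - 1) / (p - 1) * alphaCoeff p q X (j + 1) * h2 -
    1 / (p - 1) * e4

theorem prevTerm_congr {a b : ℕ → ℂ} {j : ℕ} (h : ∀ i < j, a i = b i) :
    prevTerm a j = prevTerm b j := by
  cases j with
  | zero => rfl
  | succ j => exact h j (by omega)

/-- The coefficient h⁽⁴⁾_{2j+1} of the newest term is nonzero, so the recurrence determines α
successively; only indices within the range enter. -/
theorem alphaRecurrence_unique {p : ℝ} (q X : ℝ) (hp : 1 / 2 < p) (α : ℕ → ℂ) :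
    (α 0 = 1 ∧ ∀ j : ℕ, 2 * (j : ℝ) + 2 < p - 1 / 2 → AlphaRecurrence p q X α j) ↔
      ∀ j : ℕ, 2 * (j : ℝ) < p - 1 / 2 → α j = alphaCoeff p q X j := by
  constructor
  · rintro ⟨h0, h⟩ j
    induction j using Nat.strong_induction_on with
    | _ j ih =>
      intro hj
      cases j with
      | zero => rw [h0, alphaCoeff_zero q X hp]
      | succ j =>
        push_cast at hj
        have ih' (i : ℕ) (hi : i ≤ j) : α i = alphaCoeff p q X i :=
          ih i (by omega) (by have : (i : ℝ) ≤ j := Nat.cast_le.2 hi; linarith)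
        have h1 := h j (by linarith)
        have h2 := alphaRecurrence_alphaCoeff q X (j := j) (p := p) (by linarith)
        rw [AlphaRecurrence] at h1 h2
        rw [ih' j le_rfl, prevTerm_congr fun i hi => ih' i hi.le] at h1
        have h3 := rrH4_ne_zero q (j := 2 * j + 1) (p := p) (by push_cast; linarith)
        exact mul_left_cancel₀ h3 (by linear_combination h1 - h2)
  · intro h
    refine ⟨by rw [h 0 (by push_cast; linarith), alphaCoeff_zero q X hp], fun j hj => ?_⟩
    have h2 := alphaRecurrence_alphaCoeff q X hj
    rw [AlphaRecurrence] at h2 ⊢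
    rwa [h j (by linarith), h (j + 1) (by push_cast; linarith),
      prevTerm_congr (b := alphaCoeff p q X) fun i hi => h i (by
        have : (i : ℝ) ≤ j := Nat.cast_le.2 hi.le
        linarith)]

theorem xiRecurrence_unique {p : ℝ} (q X : ℝ) (hp : 1 < p) (ξ : ℕ → ℂ) :
    (ξ 0 = 1 ∧ ∀ j : ℕ, 2 * (j : ℝ) + 3 < p → XiRecurrence p q X ξ j) ↔
      ∀ j : ℕ, 2 * (j : ℝ) + 1 < p → ξ j = xiCoeff p q X j := by
  constructor
  · rintro ⟨h0, h⟩ j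
    induction j using Nat.strong_induction_on with
    | _ j ih =>
      intro hj
      cases j with
      | zero => rw [h0, xiCoeff_zero q X hp]
      | succ j =>
        push_cast at hj
        have hj0 : (0 : ℝ) ≤ j := j.cast_nonneg
        have ih' (i : ℕ) (hi : i ≤ j) : ξ i = xiCoeff p q X i :=
          ih i (by omega) (by have : (i : ℝ) ≤ j := Nat.cast_le.2 hi; linarith)
        have h1 := h j (by linarith)
        have h2 := xiRecurrence_xiCoeff q X (j := j) (p := p) (by linarith)
        rw [XiRecurrence] at h1 h2
        rw [ih' j le_rfl, prevTerm_congr fun i hi => ih' i hi.le] at h1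
        have h3 := rrH4_ne_zero q (j := 2 * j) (p := p) (by push_cast; linarith)
        have h4 : rrZeta p q (j + 1) ≠ 0 := fun h5 => by
          have h6 := rrZeta_mul q (k := j) (p := p) (by linarith)
          rw [h5, zero_mul, zero_mul] at h6
          exact mul_ne_zero (complex_ne_zero_of_re_pos (by simp; linarith))
            (rrNorm_ne_zero q (by push_cast; linarith)) h6.symm
        exact mul_left_cancel₀ (mul_ne_zero h4 h3) (by linear_combination h1 - h2)
  · intro h
    refine ⟨by rw [h 0 (by push_cast; linarith), xiCoeff_zero q X hp], fun j hj => ?_⟩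
    have h2 := xiRecurrence_xiCoeff q X hj
    rw [XiRecurrence] at h2 ⊢
    rwa [h j (by linarith), h (j + 1) (by push_cast; linarith),
      prevTerm_congr (b := xiCoeff p q X) fun i hi => h i (by
        have : (i : ℝ) ≤ j := Nat.cast_le.2 hi.le
        linarith)]

theorem xiCoeff_eq {p : ℝ} (q X : ℝ) {j : ℕ} (h : 2 * (j : ℝ) + 1 < p) :
    xiCoeff p q X j =
      Complex.Gamma (2 * p - 1) / Complex.Gamma (-cauchyParam p q) *
        ((-1) ^ j * ((2 : ℂ) ^ (2 * j))⁻¹ * Complex.Gamma (-cauchyParam p q - 2 * j) /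
          ((2 * p - 2) * Complex.Gamma (2 * j + 1) * Complex.Gamma (2 * p - 4 * j - 2)) *
          cauchyWilson p q X j) := by
  have a1 : (2 * p - 4 * j - 2 : ℂ) ≠ 0 := complex_ne_zero_of_re_pos (by simp; linarith)
  have g1 := Complex.Gamma_add_one _ a1
  rw [show (2 * p - 4 * j - 2 + 1 : ℂ) = 2 * p - 4 * j - 1 by ring] at g1
  rw [xiCoeff, alphaCoeff, g1]
  generalize Complex.Gamma (2 * p - 4 * j - 2) = G
  generalize (2 * p - 4 * j - 2 : ℂ) = y at *
  generalize (2 * p - 2 : ℂ) = x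
  have : y * y⁻¹ = 1 := mul_inv_cancel₀ a1
  simp only [div_eq_mul_inv, mul_inv]
  generalize Complex.Gamma (2 * p - 1) * (Complex.Gamma (-cauchyParam p q))⁻¹ = A
  generalize ((-1 : ℂ) ^ j * (2 ^ (2 * j))⁻¹) = B
  generalize Complex.Gamma (-cauchyParam p q - 2 * j) = D
  generalize (Complex.Gamma (2 * j + 1))⁻¹ = E
  linear_combination (x⁻¹ * A * B * D * E * G⁻¹ * cauchyWilson p q X j) * this

/-! ### The tridiagonal matrix and the skew orthogonal polynomials -/

theorem skew4_sub_C_mul_right {V : ℝ → ℝ} {φ ψ χ : ℂ[X]} (a : ℂ)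
    (h : Integrable (integrand4 V φ ψ)) (h' : Integrable (integrand4 V φ χ)) :
    skew4 V φ (ψ - C a * χ) = skew4 V φ ψ - a * skew4 V φ χ := by
  have h1 : ∫ z : ℝ, integrand4 V φ (ψ - C a * χ) z =
      ∫ z : ℝ, integrand4 V φ ψ z - a * integrand4 V φ χ z := by
    refine integral_congr_ae (Filter.Eventually.of_forall fun z => ?_)
    simp only [integrand4, derivative_sub, derivative_C_mul, eval_sub, eval_mul, eval_C]; ring
  rw [skew4, h1, integral_sub h (h'.const_mul a), integral_const_mul, skew4, skew4]; ring

theorem skew4_rrOdd_right {p : ℝ} (q : ℝ) {φ : ℂ[X]} {n : ℕ}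
    (hφ : (φ.natDegree : ℝ) < p - 1 / 2) (hn : 2 * (n : ℝ) + 1 < p - 1 / 2) :
    skew4 (cauchyV2 p q) φ (rrOdd p q n) =
      skew4 (cauchyV2 p q) φ (routhRomanovski p q (2 * n + 1)) - rrZeta p q n *
        prevTerm (fun i => skew4 (cauchyV2 p q) φ (routhRomanovski p q (2 * i + 1))) n := by
  cases n with
  | zero => simp [rrOdd, prevTerm]
  | succ n =>
    push_cast at hn
    exact skew4_sub_C_mul_right _
      (integrable_integrand4 p q hφ (natDegree_rr_lt p q (by push_cast; linarith)))
      (integrable_integrand4 p q hφ (natDegree_rr_lt p q (by push_cast; linarith)))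

/-- ⟨,⟩₁ contributes only to the diagonal. ⟨,⟩₄ contributes two diagonals through p_{2n+1} and,
through -ζ_n p_{2n-1}, a correction of the diagonal and one further diagonal. -/
theorem skewX_rr_rrOdd {p : ℝ} (q X : ℝ) {m n : ℕ} (hm : 2 * (m : ℝ) < p - 1 / 2)
    (hn : 2 * (n : ℝ) + 1 < p - 1 / 2) :
    skewX X (cauchyV1 p q) (cauchyV2 p q) (routhRomanovski p q (2 * m)) (rrOdd p q n) =
      (if m = n then rrMiddle p q X n else 0) - (if m = n + 1 then rrH4 p q (2 * n + 1) else 0) -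
        (if n = m + 1 then rrZeta p q n * rrH4 p q (2 * m) else 0) := by
  have hm0 : (0 : ℝ) ≤ m := m.cast_nonneg
  rw [skewX, skew1_rr_rrOdd q (by linarith) (by linarith) (by linarith),
    skew4_rrOdd_right q (natDegree_rr_lt p q (by push_cast; linarith)) hn,
    skew4_rr_even_odd q hm hn]
  cases n with
  | zero =>
    simp only [prevTerm, rrZeta_zero, rrMiddle, eq_comm (a := 0) (b := m)]
    split_ifs <;> first | omega | ring
  | succ n =>
    push_cast at hn
    simp only [prevTerm, rrMiddle]
    rw [skew4_rr_even_odd q hm (by linarith)]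
    rcases eq_or_ne n m with rfl | h
    · simp
    · rcases eq_or_ne m (n + 1) with rfl | h'
      · simp; ring
      · simp [h, h', h'.symm, eq_comm (a := m)]

theorem skewX_rr_even {p : ℝ} (q X : ℝ) {m n : ℕ} (hm : 2 * (m : ℝ) < p - 1 / 2)
    (hn : 2 * (n : ℝ) < p - 1 / 2) :
    skewX X (cauchyV1 p q) (cauchyV2 p q) (routhRomanovski p q (2 * m))
      (routhRomanovski p q (2 * n)) = 0 := by
  rw [skewX, skew1_rr_even q (by linarith) (by linarith),
    skew4_rr_of_parity q (by omega) (by push_cast; linarith) (by push_cast; linarith)]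
  ring

theorem skewX_rrOdd {p : ℝ} (q X : ℝ) {m n : ℕ} (hm : 2 * (m : ℝ) + 1 < p - 1 / 2)
    (hn : 2 * (n : ℝ) + 1 < p - 1 / 2) :
    skewX X (cauchyV1 p q) (cauchyV2 p q) (rrOdd p q m) (rrOdd p q n) = 0 := by
  have key {i j : ℕ} (hi : 2 * (i : ℝ) + 1 < p - 1 / 2) (hj : 2 * (j : ℝ) + 1 < p - 1 / 2) :
      skew4 (cauchyV2 p q) (routhRomanovski p q (2 * i + 1)) (rrOdd p q j) = 0 := by
    rw [skew4_rrOdd_right q (natDegree_rr_lt p q (by push_cast; linarith)) hj,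
      skew4_rr_of_parity q (by omega) (by push_cast; linarith) (by push_cast; linarith)]
    cases j with
    | zero => simp [prevTerm]
    | succ j =>
      push_cast at hj
      simp only [prevTerm]
      rw [skew4_rr_of_parity q (by omega) (by push_cast; linarith) (by push_cast; linarith)]
      ring
  rw [skewX, skew1_rrOdd q (by linarith) (by linarith),
    skew4_rrOdd_right q (natDegree_rrOdd_lt p q hm) hn, skew4_antisymm, key hn hm]
  cases n with
  | zero => simp [prevTerm]
  | succ n =>
    push_cast at hn
    simp only [prevTerm]
    rw [skew4_antisymm, key (by linarith) hm]
    ring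

/-- The truncation matters: when l is the last index the neighbour l+1 is missing, which is the only
way the sum can fail to be a full recurrence. -/
theorem sum_range_mul_tridiagonal (a Z : ℕ → ℂ) (M H : ℂ) {l N : ℕ} (hl : l < N) :
    ∑ k ∈ Finset.range N, a k * ((if k = l then M else 0) - (if k = l + 1 then H else 0) -
        (if l = k + 1 then Z k else 0)) =
      a l * M - (if l + 1 < N then a (l + 1) * H else 0) - prevTerm (fun k => a k * Z k) l := by
  simp only [mul_sub, Finset.sum_sub_distrib, mul_ite, mul_zero]
  congr 1
  · rw [Finset.sum_ite_eq', Finset.sum_ite_eq']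
    simp [hl]
  · cases l with
    | zero => simp [prevTerm]
    | succ l =>
      simp only [prevTerm, add_left_inj]
      rw [Finset.sum_ite_eq]
      simp [show l < N by omega]

/-- For l < m the sum is the negative of the left-hand side of the recurrence for α at l. For l = m
the truncation removes the α_{m+1} term and leaves the positive value found above. -/
theorem sum_alphaCoeff_mul {p : ℝ} (q X : ℝ) {m l : ℕ} (hm : 2 * (m : ℝ) < p - 1 / 2)
    (hl : 2 * (l : ℝ) + 1 < p - 1 / 2) (hlm : l ≤ m) :
    (∑ k ∈ Finset.range (m + 1), alphaCoeff p q X k *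
      skewX X (cauchyV1 p q) (cauchyV2 p q) (routhRomanovski p q (2 * k)) (rrOdd p q l) = 0) ↔
      l ≠ m := by
  have h1 : ∀ k ∈ Finset.range (m + 1), alphaCoeff p q X k *
      skewX X (cauchyV1 p q) (cauchyV2 p q) (routhRomanovski p q (2 * k)) (rrOdd p q l) =
      alphaCoeff p q X k * ((if k = l then rrMiddle p q X l else 0) -
        (if k = l + 1 then rrH4 p q (2 * l + 1) else 0) -
        (if l = k + 1 then rrZeta p q l * rrH4 p q (2 * k) else 0)) := fun k hk => by
    have : (k : ℝ) ≤ m := Nat.cast_le.2 (Finset.mem_range_succ_iff.1 hk)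
    rw [skewX_rr_rrOdd q X (by linarith) hl]
  rw [Finset.sum_congr rfl h1,
    sum_range_mul_tridiagonal _ (fun k => rrZeta p q l * rrH4 p q (2 * k)) _ _
      (Nat.lt_succ_of_le hlm)]
  have h2 : prevTerm (fun k => alphaCoeff p q X k * (rrZeta p q l * rrH4 p q (2 * k))) l =
      rrZeta p q l * prevTerm (fun i => rrH4 p q (2 * i)) l * prevTerm (alphaCoeff p q X) l := by
    cases l with
    | zero => simp [prevTerm]
    | succ l => simp only [prevTerm]; ring
  rw [h2]
  rcases hlm.eq_or_lt with rfl | hlt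
  · rw [if_neg (by omega), sub_zero, mul_comm (alphaCoeff p q X l)]
    simpa using rrMiddle_mul_sub_ne_zero q X hl
  · rw [if_pos (by omega)]
    have : (l : ℝ) + 1 ≤ m := by exact_mod_cast hlt
    have h3 := alphaRecurrence_alphaCoeff q X (j := l) (p := p) (by linarith)
    rw [AlphaRecurrence] at h3
    simp only [ne_eq, hlt.ne, not_false_eq_true, iff_true]
    linear_combination -h3

/-- The same along a row: the super- and subdiagonal exchange roles, and the recurrence for ξ at k
appears in full because k < n. -/
theorem sum_xiCoeff_mul {p : ℝ} (q X : ℝ) {n k : ℕ} (hn : 2 * (n : ℝ) + 1 < p - 1 / 2)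
    (hk : k < n) :
    ∑ l ∈ Finset.range (n + 1), xiCoeff p q X l *
      skewX X (cauchyV1 p q) (cauchyV2 p q) (routhRomanovski p q (2 * k)) (rrOdd p q l) = 0 := by
  have hkn : (k : ℝ) + 1 ≤ n := by exact_mod_cast hk
  have h1 : ∀ l ∈ Finset.range (n + 1), xiCoeff p q X l *
      skewX X (cauchyV1 p q) (cauchyV2 p q) (routhRomanovski p q (2 * k)) (rrOdd p q l) =
      xiCoeff p q X l * ((if l = k then rrMiddle p q X k else 0) -
        (if l = k + 1 then rrZeta p q (k + 1) * rrH4 p q (2 * k) else 0) -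
        (if k = l + 1 then rrH4 p q (2 * l + 1) else 0)) := fun l hl => by
    have : (l : ℝ) ≤ n := Nat.cast_le.2 (Finset.mem_range_succ_iff.1 hl)
    rw [skewX_rr_rrOdd q X (by linarith) (by linarith), sub_right_comm]
    congr 3
    · rcases eq_or_ne k l with rfl | h
      · rfl
      · rw [if_neg h, if_neg h.symm]
    · split_ifs with h
      · rw [h]
      · rfl
  rw [Finset.sum_congr rfl h1,
    sum_range_mul_tridiagonal _ (fun l => rrH4 p q (2 * l + 1)) _ _ (by omega),
    if_pos (by omega)]
  have h3 := xiRecurrence_xiCoeff q X (j := k) (p := p) (by linarith)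
  rw [XiRecurrence] at h3
  have h2 : prevTerm (fun l => xiCoeff p q X l * rrH4 p q (2 * l + 1)) k =
      prevTerm (fun i => rrH4 p q (2 * i + 1)) k * prevTerm (xiCoeff p q X) k := by
    cases k with
    | zero => simp [prevTerm]
    | succ k => simp only [prevTerm]; ring
  rw [h2]
  linear_combination -h3

theorem QEven_eq (p q X : ℝ) (m : ℕ) :
    QEven p q X m = ∑ k ∈ Finset.range (m + 1),
      C ((alphaCoeff p q X m)⁻¹ * alphaCoeff p q X k) * routhRomanovski p q (2 * k) := by
  simp only [QEven, Finset.mul_sum, C_mul, mul_assoc]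

theorem QOdd_eq (p q X : ℝ) (m : ℕ) :
    QOdd p q X m = ∑ k ∈ Finset.range (m + 1),
      C ((xiCoeff p q X m)⁻¹ * xiCoeff p q X k) * rrOdd p q k := by
  simp only [QOdd, Finset.mul_sum, C_mul, mul_assoc]

theorem natDegree_rr_even_lt_of_mem {p : ℝ} (q : ℝ) {m k : ℕ} (hm : 2 * (m : ℝ) < p - 1 / 2)
    (hk : k ∈ Finset.range (m + 1)) : ((routhRomanovski p q (2 * k)).natDegree : ℝ) < p - 1 / 2 := by
  have : (k : ℝ) ≤ m := Nat.cast_le.2 (Finset.mem_range_succ_iff.1 hk)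
  exact natDegree_rr_lt p q (by push_cast; linarith)

theorem natDegree_rrOdd_lt_of_mem {p : ℝ} (q : ℝ) {m k : ℕ} (hm : 2 * (m : ℝ) + 1 < p - 1 / 2)
    (hk : k ∈ Finset.range (m + 1)) : ((rrOdd p q k).natDegree : ℝ) < p - 1 / 2 := by
  have : (k : ℝ) ≤ m := Nat.cast_le.2 (Finset.mem_range_succ_iff.1 hk)
  exact natDegree_rrOdd_lt p q (by linarith)

theorem skewX_QEven_QEven {p : ℝ} (q X : ℝ) {m n : ℕ} (hm : 2 * (m : ℝ) < p - 1 / 2)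
    (hn : 2 * (n : ℝ) < p - 1 / 2) :
    skewX X (cauchyV1 p q) (cauchyV2 p q) (QEven p q X m) (QEven p q X n) = 0 := by
  have hm0 : (0 : ℝ) ≤ m := m.cast_nonneg
  rw [QEven_eq, QEven_eq, skewX_sum_sum p q (by linarith) X _ _ _ _ _ _
    (fun i hi => natDegree_rr_even_lt_of_mem q hm hi)
    fun i hi => natDegree_rr_even_lt_of_mem q hn hi]
  refine Finset.sum_eq_zero fun i hi => Finset.sum_eq_zero fun j hj => ?_
  have hi' : (i : ℝ) ≤ m := Nat.cast_le.2 (Finset.mem_range_succ_iff.1 hi)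
  have hj' : (j : ℝ) ≤ n := Nat.cast_le.2 (Finset.mem_range_succ_iff.1 hj)
  rw [skewX_rr_even q X (by linarith) (by linarith), mul_zero]

theorem skewX_QOdd_QOdd {p : ℝ} (q X : ℝ) {m n : ℕ} (hm : 2 * (m : ℝ) + 1 < p - 1 / 2)
    (hn : 2 * (n : ℝ) + 1 < p - 1 / 2) :
    skewX X (cauchyV1 p q) (cauchyV2 p q) (QOdd p q X m) (QOdd p q X n) = 0 := by
  have hm0 : (0 : ℝ) ≤ m := m.cast_nonneg
  rw [QOdd_eq, QOdd_eq, skewX_sum_sum p q (by linarith) X _ _ _ _ _ _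
    (fun i hi => natDegree_rrOdd_lt_of_mem q hm hi)
    fun i hi => natDegree_rrOdd_lt_of_mem q hn hi]
  refine Finset.sum_eq_zero fun i hi => Finset.sum_eq_zero fun j hj => ?_
  have hi' : (i : ℝ) ≤ m := Nat.cast_le.2 (Finset.mem_range_succ_iff.1 hi)
  have hj' : (j : ℝ) ≤ n := Nat.cast_le.2 (Finset.mem_range_succ_iff.1 hj)
  rw [skewX_rrOdd q X (by linarith) (by linarith), mul_zero]

/-- The double sum is evaluated in the order in which the inner recurrence is complete: over the ξ
index when m < n, over the α index when n ≤ m. -/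
theorem skewX_QEven_QOdd {p : ℝ} (q X : ℝ) {m n : ℕ} (hm : 2 * (m : ℝ) < p - 1 / 2)
    (hn : 2 * (n : ℝ) + 1 < p - 1 / 2) :
    skewX X (cauchyV1 p q) (cauchyV2 p q) (QEven p q X m) (QOdd p q X n) = 0 ↔ m ≠ n := by
  have hm0 : (0 : ℝ) ≤ m := m.cast_nonneg
  have h1 : skewX X (cauchyV1 p q) (cauchyV2 p q) (QEven p q X m) (QOdd p q X n) =
      (alphaCoeff p q X m)⁻¹ * (xiCoeff p q X n)⁻¹ * ∑ k ∈ Finset.range (m + 1),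
        ∑ l ∈ Finset.range (n + 1), alphaCoeff p q X k * xiCoeff p q X l *
          skewX X (cauchyV1 p q) (cauchyV2 p q) (routhRomanovski p q (2 * k)) (rrOdd p q l) := by
    rw [QEven_eq, QOdd_eq, skewX_sum_sum p q (by linarith) X _ _ _ _ _ _
      (fun i hi => natDegree_rr_even_lt_of_mem q hm hi)
      fun i hi => natDegree_rrOdd_lt_of_mem q hn hi]
    simp only [Finset.mul_sum]
    refine Finset.sum_congr rfl fun i _ => Finset.sum_congr rfl fun j _ => ?_
    ring
  have hα := alphaCoeff_ne_zero q X hm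
  have hξ := xiCoeff_ne_zero q X (j := n) (p := p) (by linarith)
  rw [h1, mul_eq_zero_iff_left (mul_ne_zero (inv_ne_zero hα) (inv_ne_zero hξ))]
  rcases lt_or_ge m n with h | h
  · refine iff_of_true (Finset.sum_eq_zero fun k hk => ?_) h.ne
    have := sum_xiCoeff_mul q X hn (k := k) (by have := Finset.mem_range_succ_iff.1 hk; omega)
    simp only [mul_assoc]
    rw [← Finset.mul_sum, this, mul_zero]
  -- The columns l < n ≤ m are annihilated by α, so only the last column n survives.
  · have h2 : ∑ k ∈ Finset.range (m + 1), ∑ l ∈ Finset.range (n + 1),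
        alphaCoeff p q X k * xiCoeff p q X l *
          skewX X (cauchyV1 p q) (cauchyV2 p q) (routhRomanovski p q (2 * k)) (rrOdd p q l) =
        xiCoeff p q X n * ∑ k ∈ Finset.range (m + 1), alphaCoeff p q X k *
          skewX X (cauchyV1 p q) (cauchyV2 p q) (routhRomanovski p q (2 * k)) (rrOdd p q n) := by
      rw [Finset.sum_comm, Finset.sum_range_succ, Finset.sum_eq_zero, zero_add, Finset.mul_sum]
      · exact Finset.sum_congr rfl fun k _ => by ring
      · intro l hl
        have hl' := Finset.mem_range.1 hl
        have hl2 : (l : ℝ) + 1 ≤ n := by exact_mod_cast hl'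
        have := (sum_alphaCoeff_mul q X hm (l := l) (by linarith) (by omega)).2 (by omega)
        rw [← mul_zero (xiCoeff p q X l), ← this, Finset.mul_sum]
        exact Finset.sum_congr rfl fun k _ => by ring
    rw [h2, mul_eq_zero_iff_left hξ, sum_alphaCoeff_mul q X hm hn h, ne_comm]

/-! ### Leading terms, and the remaining identifications -/

theorem monic_sum_of_natDegree {m d : ℕ} (φ : ℕ → ℂ[X]) (a : ℕ → ℂ) (ha : a m ≠ 0)
    (hlt : ∀ k < m, (φ k).natDegree < d) (hm : (φ m).Monic) (hd : (φ m).natDegree = d) :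
    (C ((a m)⁻¹) * ∑ k ∈ Finset.range (m + 1), C (a k) * φ k).Monic ∧
      (C ((a m)⁻¹) * ∑ k ∈ Finset.range (m + 1), C (a k) * φ k).natDegree = d := by
  have hle : (C ((a m)⁻¹) * ∑ k ∈ Finset.range (m + 1), C (a k) * φ k).natDegree ≤ d := by
    refine (natDegree_C_mul_le _ _).trans (natDegree_sum_le_of_forall_le _ _ fun k hk => ?_)
    refine (natDegree_C_mul_le _ _).trans ?_
    rcases (Finset.mem_range_succ_iff.1 hk).eq_or_lt with rfl | h
    · exact hd.le
    · exact (hlt k h).le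
  have hc : (C ((a m)⁻¹) * ∑ k ∈ Finset.range (m + 1), C (a k) * φ k).coeff d = 1 := by
    rw [coeff_C_mul, finsetSum_coeff, Finset.sum_range_succ, Finset.sum_eq_zero, zero_add,
      coeff_C_mul, ← hd, coeff_natDegree, hm.leadingCoeff, mul_one, inv_mul_cancel₀ ha]
    intro k hk
    rw [coeff_C_mul, coeff_eq_zero_of_natDegree_lt (hlt k (Finset.mem_range.1 hk)), mul_zero]
  exact ⟨monic_of_natDegree_le_of_coeff_eq_one d hle hc,
    natDegree_eq_of_le_of_coeff_ne_zero hle (by rw [hc]; exact one_ne_zero)⟩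

theorem monic_QEven {p : ℝ} (q X : ℝ) {m : ℕ} (hm : 2 * (m : ℝ) < p - 1 / 2) :
    (QEven p q X m).Monic ∧ (QEven p q X m).natDegree = 2 * m := by
  have hm' : ((2 * m : ℕ) : ℝ) < p := by push_cast; linarith
  exact monic_sum_of_natDegree (fun k => routhRomanovski p q (2 * k)) _ (alphaCoeff_ne_zero q X hm)
    (fun k hk => (natDegree_routhRomanovski_le p q _).trans_lt (by omega))
    (monic_routhRomanovski q hm') (natDegree_routhRomanovski q hm')

theorem monic_rrOdd {p : ℝ} (q : ℝ) {m : ℕ} (hm : 2 * (m : ℝ) + 1 < p) :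
    (rrOdd p q m).Monic ∧ (rrOdd p q m).natDegree = 2 * m + 1 := by
  have hm' : ((2 * m + 1 : ℕ) : ℝ) < p := by push_cast; linarith
  have hc : (rrOdd p q m).coeff (2 * m + 1) = 1 := by
    have h1 := monic_routhRomanovski q hm'
    rw [Monic, leadingCoeff, natDegree_routhRomanovski q hm'] at h1
    rw [rrOdd, coeff_sub, h1, coeff_C_mul]
    cases m with
    | zero => simp [prevTerm]
    | succ m =>
      simp only [prevTerm]
      rw [coeff_eq_zero_of_natDegree_lt
        ((natDegree_routhRomanovski_le p q _).trans_lt (by omega)), mul_zero, sub_zero]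
  exact ⟨monic_of_natDegree_le_of_coeff_eq_one _ (natDegree_rrOdd_le p q m) hc,
    natDegree_eq_of_le_of_coeff_ne_zero (natDegree_rrOdd_le p q m) (by rw [hc]; exact one_ne_zero)⟩

theorem monic_QOdd {p : ℝ} (q X : ℝ) {m : ℕ} (hm : 2 * (m : ℝ) + 1 < p - 1 / 2) :
    (QOdd p q X m).Monic ∧ (QOdd p q X m).natDegree = 2 * m + 1 := by
  have h := monic_rrOdd q (m := m) (p := p) (by linarith)
  exact monic_sum_of_natDegree (rrOdd p q) _ (xiCoeff_ne_zero q X (by linarith))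
    (fun k hk => (natDegree_rrOdd_le p q k).trans_lt (by omega)) h.1 h.2

theorem exp_cauchyV_eq_cauchyWeight (p q z : ℝ) :
    ((Real.exp (-2 * cauchyV p q z) : ℝ) : ℂ) = cauchyWeight (cauchyParam p q) z ∧
      ((Real.exp (-cauchyV1 p q z) : ℝ) : ℂ) = cauchyWeight ((cauchyParam p q - 1) / 2) z ∧
      ((Real.exp (-cauchyV2 p q z) : ℝ) : ℂ) = cauchyWeight ((cauchyParam p q + 1) / 2) z := by
  refine ⟨?_, ?_, ?_⟩
  · rw [exp_neg_two_mul_cauchyV, ← cauchyWeight_eq_cw, cauchyParam]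
  · rw [exp_neg_cauchyV1, ← cauchyWeight_eq_cw, cauchyParam]
    congr 1; push_cast; ring
  · rw [exp_neg_cauchyV2, ← cauchyWeight_eq_cw, cauchyParam]
    congr 1; push_cast; ring

theorem inner2_routhRomanovski {p : ℝ} (q : ℝ) (hp : 1 / 2 < p) {n m : ℕ} (hn : (n : ℝ) < p)
    (h : (n : ℝ) + m < 2 * p - 1) :
    inner2 (cauchyV p q) (routhRomanovski p q n) (routhRomanovski p q m) =
      if n = m then rrNorm p q n else 0 := by
  rw [inner2_eq_cauchyL]
  split_ifs with hnm
  · subst hnm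
    exact cauchyL_routhRomanovski_mul_self q hp hn h
  · exact cauchyL_routhRomanovski_mul_of_ne q hnm h

end

theorem mainTheorem7 (p q X : ℝ) (hp : 1 / 2 < p) :
    -- the weights
    (∀ z : ℝ,
      ((Real.exp (-2 * cauchyV p q z) : ℝ) : ℂ) = cauchyWeight (cauchyParam p q) z ∧
      ((Real.exp (-cauchyV1 p q z) : ℝ) : ℂ) = cauchyWeight ((cauchyParam p q - 1) / 2) z ∧
      ((Real.exp (-cauchyV2 p q z) : ℝ) : ℂ) = cauchyWeight ((cauchyParam p q + 1) / 2) z) ∧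
    -- convergence of the integrals that occur below
    (∀ φ ψ : Polynomial ℂ,
      (((φ.natDegree : ℝ) + ψ.natDegree < 2 * p - 1) →
        Integrable (integrand2 (cauchyV p q) φ ψ)) ∧
      ((φ.natDegree : ℝ) < p → (ψ.natDegree : ℝ) < p →
        Integrable (integrand1 (cauchyV1 p q) φ ψ)) ∧
      ((φ.natDegree : ℝ) < p - 1 / 2 → (ψ.natDegree : ℝ) < p - 1 / 2 →
        Integrable (integrand4 (cauchyV2 p q) φ ψ))) ∧
    -- the Routh–Romanovski polynomials are the monic orthogonal polynomials
    (∀ n : ℕ, (n : ℝ) < p →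
      (routhRomanovski p q n).Monic ∧ (routhRomanovski p q n).natDegree = n) ∧
    (∀ n m : ℕ, (n : ℝ) < p → (m : ℝ) < p → (n : ℝ) + m < 2 * p - 1 →
      inner2 (cauchyV p q) (routhRomanovski p q n) (routhRomanovski p q m) =
        if n = m then rrNorm p q n else 0) ∧
    -- the `β = 1` relations, with the data `ζ` and `h1`
    (∀ m n : ℕ, 2 * (m : ℝ) < p → 2 * (n : ℝ) + 1 < p →
      skew1 (cauchyV1 p q) (routhRomanovski p q (2 * m)) (rrOdd p q n) =
        if n = m then rrH1 p q n else 0) ∧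
    (∀ m n : ℕ, 2 * (m : ℝ) < p → 2 * (n : ℝ) < p →
      skew1 (cauchyV1 p q) (routhRomanovski p q (2 * m)) (routhRomanovski p q (2 * n)) = 0) ∧
    (∀ m n : ℕ, 2 * (m : ℝ) + 1 < p → 2 * (n : ℝ) + 1 < p →
      skew1 (cauchyV1 p q) (rrOdd p q m) (rrOdd p q n) = 0) ∧
    -- the `β = 4` relations, with the data `h4`
    (∀ m n : ℕ, 2 * (m : ℝ) < p - 1 / 2 → 2 * (n : ℝ) + 1 < p - 1 / 2 →
      skew4 (cauchyV2 p q) (routhRomanovski p q (2 * m)) (routhRomanovski p q (2 * n + 1)) =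
        (if n = m then rrH4 p q (2 * n) else 0) -
          (if m = n + 1 then rrH4 p q (2 * n + 1) else 0)) ∧
    (∀ m n : ℕ, 2 * (m : ℝ) < p - 1 / 2 → 2 * (n : ℝ) < p - 1 / 2 →
      skew4 (cauchyV2 p q) (routhRomanovski p q (2 * m)) (routhRomanovski p q (2 * n)) = 0) ∧
    (∀ m n : ℕ, 2 * (m : ℝ) + 1 < p - 1 / 2 → 2 * (n : ℝ) + 1 < p - 1 / 2 →
      skew4 (cauchyV2 p q) (routhRomanovski p q (2 * m + 1))
        (routhRomanovski p q (2 * n + 1)) = 0) ∧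
    -- the coefficients `α`
    (∀ α : ℕ → ℂ,
      (α 0 = 1 ∧ ∀ j : ℕ, 2 * (j : ℝ) + 2 < p - 1 / 2 → AlphaRecurrence p q X α j) ↔
        ∀ j : ℕ, 2 * (j : ℝ) < p - 1 / 2 → α j = alphaCoeff p q X j) ∧
    (∀ j : ℕ, 2 * (j : ℝ) < p - 1 / 2 → alphaCoeff p q X j ≠ 0) ∧
    -- the coefficients `ξ`
    (1 < p → ∀ ξ : ℕ → ℂ,
      (ξ 0 = 1 ∧ ∀ j : ℕ, 2 * (j : ℝ) + 3 < p → XiRecurrence p q X ξ j) ↔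
        ∀ j : ℕ, 2 * (j : ℝ) + 1 < p → ξ j = xiCoeff p q X j) ∧
    (∀ j : ℕ, 2 * (j : ℝ) + 1 < p →
      xiCoeff p q X j ≠ 0 ∧
      xiCoeff p q X j =
        Complex.Gamma (2 * p - 1) / Complex.Gamma (-cauchyParam p q) *
          ((-1) ^ j * ((2 : ℂ) ^ (2 * j))⁻¹ * Complex.Gamma (-cauchyParam p q - 2 * j) /
            ((2 * p - 2) * Complex.Gamma (2 * j + 1) * Complex.Gamma (2 * p - 4 * j - 2)) *
            cauchyWilson p q X j)) ∧
    -- the resulting monic skew orthogonal polynomials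
    (∀ m : ℕ, 2 * (m : ℝ) < p - 1 / 2 →
      (QEven p q X m).Monic ∧ (QEven p q X m).natDegree = 2 * m) ∧
    (∀ m : ℕ, 2 * (m : ℝ) + 1 < p - 1 / 2 →
      (QOdd p q X m).Monic ∧ (QOdd p q X m).natDegree = 2 * m + 1) ∧
    (∀ m n : ℕ, 2 * (m : ℝ) < p - 1 / 2 → 2 * (n : ℝ) + 1 < p - 1 / 2 →
      (skewX X (cauchyV1 p q) (cauchyV2 p q) (QEven p q X m) (QOdd p q X n) = 0 ↔ m ≠ n)) ∧
    (∀ m n : ℕ, 2 * (m : ℝ) < p - 1 / 2 → 2 * (n : ℝ) < p - 1 / 2 →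
      skewX X (cauchyV1 p q) (cauchyV2 p q) (QEven p q X m) (QEven p q X n) = 0) ∧
    (∀ m n : ℕ, 2 * (m : ℝ) + 1 < p - 1 / 2 → 2 * (n : ℝ) + 1 < p - 1 / 2 →
      skewX X (cauchyV1 p q) (cauchyV2 p q) (QOdd p q X m) (QOdd p q X n) = 0) := by
  exact ⟨exp_cauchyV_eq_cauchyWeight p q,
    fun φ ψ => ⟨integrable_integrand2 p q φ ψ, integrable_integrand1 p q, integrable_integrand4 p q⟩,
    fun n hn => ⟨monic_routhRomanovski q hn, natDegree_routhRomanovski q hn⟩,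
    fun n m hn _ h => inner2_routhRomanovski q hp hn h,
    fun m n hm hn => skew1_rr_rrOdd q hp hm hn,
    fun m n hm hn => skew1_rr_even q hm hn,
    fun m n hm hn => skew1_rrOdd q hm hn,
    fun m n hm hn => skew4_rr_even_odd q hm hn,
    fun m n hm hn => skew4_rr_of_parity q (by omega) (by push_cast; exact hm) (by push_cast; exact hn),
    fun m n hm hn => skew4_rr_of_parity q (by omega) (by push_cast; exact hm) (by push_cast; exact hn),
    alphaRecurrence_unique q X hp,
    fun j hj => alphaCoeff_ne_zero q X hj,
    fun hp' => xiRecurrence_unique q X hp',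
    fun j hj => ⟨xiCoeff_ne_zero q X hj, xiCoeff_eq q X hj⟩,
    fun m hm => monic_QEven q X hm,
    fun m hm => monic_QOdd q X hm,
    fun m n hm hn => skewX_QEven_QOdd q X hm hn,
    fun m n hm hn => skewX_QEven_QEven q X hm hn,
    fun m n hm hn => skewX_QOdd_QOdd q X hm hn⟩
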